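/- Let $a_1,a_2,a_3\in\mathbb R^2$ (the feet) and let $l_i,m_i>0$ with $l_i\neq m_i$ ($i=1,2,3$) be the lengths of the two bars of leg $i$ of a 3-leg (tripod) spider. Its configuration space is $$\mathcal C=\{(x,p_1,p_2,p_3)\in(\mathbb R^2)^4:\ \|p_i-a_i\|=l_i,\ \|x-p_i\|=m_i\ (i=1,2,3)\}.$$ Put $R_i=l_i+m_i$, $R_i^-=|l_i-m_i|>0$, and $z=\tfrac13(a_1+a_2+a_3)$. The centre $x$ of the spider ranges over the workspace $$W=\{x\in\mathbb R^2:\ R_i^-\le\|x-a_i\|\le R_i\ (i=1,2,3)\}.$$ Assume that $W$ is a triangular disc with three holes around $z$, in the following sense: * the three closed discs of centre $a_i$ and radius $R_i^-$ are pairwise disjoint, and each of them lies in the interior of all three discs of centre $a_j$ and radius $R_j$; * $z$ is an interior point of $W$; * $W$ has three corners, one for each pair of outer circles: for $i\ne j$ there is exactly one point $x\in W$ with $\|x-a_i\|=R_i$ and $\|x-a_j\|=R_j$; * for each $i$, the ray from $a_i$ through $z$ leaves $W$ through the boundary arc centred at $a_i$, not at a corner: the point $y_i=a_i+R_i\frac{z-a_i}{\|z-a_i\|}$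 satisfies $\|y_i-a_j\|<R_j$ for all $j\neq i$. Then $\mathcal C$ is a smooth closed connected orientable surface of genus $12$, that is, of Euler characteristic $-22$. The Hooke energy $H(x)=\sum_{i=1}^3\|x-a_i\|^2$, regarded as a function on $\mathcal C$ through the projection $(x,p_1,p_2,p_3)\mapsto x$, is a Morse function on $\mathcal C$ with exactly $8$ minima, $36$ saddles and $6$ maxima (nondegenerate critical points of index $0$, $1$ and $2$). -/

import Mathlib

open scoped ContDiff Topology

noncomputable section

namespace Tripod

/-- The Euclidean plane. -/
abbrev Plane : Type := EuclideanSpace ℝ (Fin 2)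

/-! ### Closed surfaces in a normed space, Morse theory on them -/

section Surface

variable {E : Type*} [NormedAddCommGroup E] [NormedSpace ℝ E]

/-- `φ : U → S` is a smooth regular local parametrization of the two-dimensional set `S`: a smooth
injective immersion of the open set `U` of the plane which is a homeomorphism onto a relatively
open subset of `S`. -/
structure IsLocalParam (S : Set E) (U : Set Plane) (φ : Plane → E) : Prop where
  isOpen : IsOpen U
  contDiffOn : ContDiffOn ℝ ∞ φ U
  immersion : ∀ u ∈ U, Function.Injective (fderiv ℝ φ u)
  injOn : Set.InjOn φ U
  isOpen_image : ∀ O ⊆ U, IsOpen O → ∃ V : Set E, IsOpen V ∧ φ '' O = S ∩ V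

/-- `S` is a smooth surface, that is, an embedded two-dimensional smooth submanifold of `E`
(without boundary). -/
def IsSmoothSurface (S : Set E) : Prop :=
  ∀ p ∈ S, ∃ (U : Set Plane) (φ : Plane → E), IsLocalParam S U φ ∧ p ∈ φ '' U

/-- The smooth surface `S` is orientable: it carries a continuous field of alternating 2-forms
that vanishes on no tangent plane of `S` (the tangent plane at `φ u` is the range of the
derivative of the parametrization `φ` at `u`). -/
def IsOrientable (S : Set E) : Prop :=
  ∃ α : E → E [⋀^Fin 2]→L[ℝ] ℝ, ContinuousOn α S ∧
    ∀ (U : Set Plane) (φ : Plane → E), IsLocalParam S U φ → ∀ u ∈ U,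
      (α (φ u)).compContinuousLinearMap (fderiv ℝ φ u) ≠ 0

/-- `S` has Euler characteristic `χ`: it is a finite CW complex whose alternating number of cells
is `χ`. -/
def HasEulerCharacteristic {X : Type*} [TopologicalSpace X] (S : Set X) (χ : ℤ) : Prop :=
  ∃ _ : Topology.CWComplex S, ∃ N : ℕ,
    (∀ n, Finite (Topology.CWComplex.cell S n)) ∧
    (∀ n, N ≤ n → IsEmpty (Topology.CWComplex.cell S n)) ∧
    ∑ n ∈ Finset.range N, (-1 : ℤ) ^ n * (Nat.card (Topology.CWComplex.cell S n) : ℤ) = χ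

/-- `S` is a smooth closed connected orientable surface of genus `g`. -/
structure IsClosedSurfaceOfGenus (S : Set E) (g : ℕ) : Prop where
  isSmoothSurface : IsSmoothSurface S
  isCompact : IsCompact S
  isConnected : IsConnected S
  isOrientable : IsOrientable S
  eulerCharacteristic : HasEulerCharacteristic S (2 - 2 * (g : ℤ))

/-- `p` is a critical point of the restriction of `f` to the surface `S`. -/
def IsCriticalPointOn (f : E → ℝ) (S : Set E) (p : E) : Prop :=
  ∃ (U : Set Plane) (φ : Plane → E) (u : Plane), IsLocalParam S U φ ∧ u ∈ U ∧ φ u = p ∧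
    fderiv ℝ (f ∘ φ) u = 0

/-- The bilinear form `B` is nondegenerate of index `k`: the space splits as the direct sum of a
`k`-dimensional subspace on which `B` is negative definite and a subspace on which `B` is positive
definite. -/
def HasIndex (B : Plane →L[ℝ] Plane →L[ℝ] ℝ) (k : ℕ) : Prop :=
  ∃ N P : Submodule ℝ Plane, IsCompl N P ∧ Module.finrank ℝ N = k ∧
    (∀ v ∈ N, v ≠ 0 → B v v < 0) ∧ (∀ v ∈ P, v ≠ 0 → 0 < B v v)

/-- `p` is a nondegenerate critical point of Morse index `k` of the restriction of `f` to the
surface `S`: the Hessian in a local parametrization is nondegenerate of index `k`. -/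
def IsMorsePointOn (f : E → ℝ) (S : Set E) (k : ℕ) (p : E) : Prop :=
  ∃ (U : Set Plane) (φ : Plane → E) (u : Plane), IsLocalParam S U φ ∧ u ∈ U ∧ φ u = p ∧
    fderiv ℝ (f ∘ φ) u = 0 ∧ HasIndex (fderiv ℝ (fderiv ℝ (f ∘ φ)) u) k

/-- The restriction of `f` to the surface `S` is a Morse function. -/
def IsMorseOn (f : E → ℝ) (S : Set E) : Prop :=
  (∀ (U : Set Plane) (φ : Plane → E), IsLocalParam S U φ → ContDiffOn ℝ ∞ (f ∘ φ) U) ∧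
    ∀ p, IsCriticalPointOn f S p → ∃ k, IsMorsePointOn f S k p

/-- The nondegenerate minima of `f` on `S`: critical points of index 0. -/
def minima (f : E → ℝ) (S : Set E) : Set E := {p | IsMorsePointOn f S 0 p}

/-- The nondegenerate saddles of `f` on `S`: critical points of index 1. -/
def saddles (f : E → ℝ) (S : Set E) : Set E := {p | IsMorsePointOn f S 1 p}

/-- The nondegenerate maxima of `f` on `S`: critical points of index 2. -/
def maxima (f : E → ℝ) (S : Set E) : Set E := {p | IsMorsePointOn f S 2 p}

end Surface

/-! ### Three-leg spiders -/

/-- A three-leg spider in the plane: leg `i` joins the fixed foot `foot i` to the common centre by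
two bars of different positive lengths `lower i` (at the foot) and `upper i` (at the centre). -/
structure Spider where
  foot : Fin 3 → Plane
  lower : Fin 3 → ℝ
  upper : Fin 3 → ℝ
  lower_pos : ∀ i, 0 < lower i
  upper_pos : ∀ i, 0 < upper i
  lower_ne_upper : ∀ i, lower i ≠ upper i

namespace Spider

variable (s : Spider)

/-- A position `(x, p)` of the spider: the centre `x` and the three elbows `p i`. -/
abbrev Position : Type := Plane × (Fin 3 → Plane)

/-- The configuration space. -/
def configSpace : Set Position :=
  {q | ∀ i, dist (s.foot i) (q.2 i) = s.lower i ∧ dist (q.2 i) q.1 = s.upper i}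

/-- The largest distance of the centre from foot `i`. -/
def outer (i : Fin 3) : ℝ := s.lower i + s.upper i

/-- The smallest distance of the centre from foot `i`. -/
def inner (i : Fin 3) : ℝ := |s.lower i - s.upper i|

/-- The workspace, that is, the set of possible positions of the centre
(see `image_fst_configSpace`). -/
def workspace : Set Plane :=
  {x | ∀ i, s.inner i ≤ dist x (s.foot i) ∧ dist x (s.foot i) ≤ s.outer i}

/-- A leg with bars of lengths `l` and `m` can reach every point at distance between `|l - m|` and
`l + m` from its foot. -/
theorem exists_elbow (a x : Plane) (l m : ℝ) (hl : 0 < l) (hm : 0 < m) (hlm : l ≠ m)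
    (h1 : |l - m| ≤ dist x a) (h2 : dist x a ≤ l + m) :
    ∃ p : Plane, dist a p = l ∧ dist p x = m := by
  have hd : 0 < dist x a := lt_of_lt_of_le (abs_pos.mpr (sub_ne_zero.mpr hlm)) h1
  obtain ⟨h3, h4⟩ := abs_le.mp h1
  have hsq : dist x a ^ 2 = (x 0 - a 0) ^ 2 + (x 1 - a 1) ^ 2 := by
    rw [EuclideanSpace.dist_eq, Real.sq_sqrt (Finset.sum_nonneg fun i _ => sq_nonneg _)]
    simp [Fin.sum_univ_two, Real.dist_eq, sq_abs]
  generalize dist x a = d at *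
  set c : ℝ := (d ^ 2 + l ^ 2 - m ^ 2) / (2 * d ^ 2) with hc
  have hcd : 2 * d ^ 2 * c = d ^ 2 + l ^ 2 - m ^ 2 := by rw [hc]; field_simp
  have hnn : 0 ≤ l ^ 2 / d ^ 2 - c ^ 2 := by
    have : l ^ 2 / d ^ 2 - c ^ 2 = (2 * d * l - (d ^ 2 + l ^ 2 - m ^ 2)) *
        (2 * d * l + (d ^ 2 + l ^ 2 - m ^ 2)) / (4 * d ^ 4) := by
      rw [hc]; field_simp; ring
    rw [this]
    have e1 : 2 * d * l - (d ^ 2 + l ^ 2 - m ^ 2) = (m - d + l) * (m + d - l) := by ring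
    have e2 : 2 * d * l + (d ^ 2 + l ^ 2 - m ^ 2) = (d + l - m) * (d + l + m) := by ring
    rw [e1, e2]
    have := mul_nonneg (by linarith : 0 ≤ m - d + l) (by linarith : 0 ≤ m + d - l)
    have := mul_nonneg (by linarith : 0 ≤ d + l - m) (by linarith : 0 ≤ d + l + m)
    positivity
  obtain ⟨e, he⟩ : ∃ e : ℝ, e ^ 2 = l ^ 2 / d ^ 2 - c ^ 2 := ⟨_, Real.sq_sqrt hnn⟩
  have hed : (c ^ 2 + e ^ 2) * d ^ 2 = l ^ 2 := by rw [he]; field_simp; ring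
  refine ⟨!₂[a 0 + c * (x 0 - a 0) - e * (x 1 - a 1), a 1 + c * (x 1 - a 1) + e * (x 0 - a 0)],
    ?_, ?_⟩
  · rw [EuclideanSpace.dist_eq, Real.sqrt_eq_iff_mul_self_eq_of_pos hl]
    simp only [Fin.sum_univ_two, Real.dist_eq, sq_abs, Matrix.cons_val_zero,
      Matrix.cons_val_one]
    rw [hsq] at hed
    linear_combination -hed
  · rw [EuclideanSpace.dist_eq, Real.sqrt_eq_iff_mul_self_eq_of_pos hm]
    simp only [Fin.sum_univ_two, Real.dist_eq, sq_abs, Matrix.cons_val_zero,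
      Matrix.cons_val_one]
    rw [hsq] at hed hcd
    linear_combination -hed + hcd

/-- The workspace is the projection of the configuration space. -/
theorem image_fst_configSpace : Prod.fst '' s.configSpace = s.workspace := by
  ext x
  constructor
  · rintro ⟨q, hq, rfl⟩ i
    obtain ⟨h1, h2⟩ := hq i
    have t1 := dist_triangle (s.foot i) (q.2 i) q.1
    have t2 := dist_triangle (s.foot i) q.1 (q.2 i)
    have t3 := dist_triangle (q.2 i) (s.foot i) q.1
    rw [dist_comm q.1 (q.2 i)] at t2
    rw [dist_comm (q.2 i) (s.foot i)] at t3
    rw [inner, outer, dist_comm q.1]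
    exact ⟨abs_le.mpr ⟨by linarith, by linarith⟩, by linarith⟩
  · intro hx
    choose p hp using fun i => exists_elbow (s.foot i) x (s.lower i) (s.upper i)
      (s.lower_pos i) (s.upper_pos i) (s.lower_ne_upper i) (hx i).1 (hx i).2
    exact ⟨(x, p), hp, rfl⟩

/-- The Hooke energy of a point of the plane. -/
def hooke (x : Plane) : ℝ := ∑ i, ‖x - s.foot i‖ ^ 2

/-- The Hooke energy of a position, that is, of its centre. -/
def energy (q : Position) : ℝ := s.hooke q.1

/-- The centre of gravity of the feet. -/
def centroid : Plane := (3 : ℝ)⁻¹ • ∑ i, s.foot i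

/-- The point at which the ray from foot `i` through the centre of gravity meets the outer circle
of leg `i`. -/
def exitPoint (i : Fin 3) : Plane :=
  s.foot i + (s.outer i / dist s.centroid (s.foot i)) • (s.centroid - s.foot i)

/-- The workspace is a disc with three holes around the centre of gravity: a triangle
bounded by one arc of each outer circle, from which the three pairwise disjoint inner discs, lying
in its interior, are taken out. -/
structure IsThreeHoledTriangle : Prop where
  /-- the three closed inner discs are pairwise disjoint -/
  holes_disjoint : ∀ i j, i ≠ j → s.inner i + s.inner j < dist (s.foot i) (s.foot j)
  /-- the inner discs lie in the interior of the outer discs -/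
  holes_inside : ∀ i j, i ≠ j → dist (s.foot i) (s.foot j) + s.inner i < s.outer j
  /-- the workspace is a neighbourhood of the centre of gravity -/
  centroid_mem : s.centroid ∈ interior s.workspace
  /-- the workspace has three corners, one for each pair of outer circles -/
  corners : ∀ i j, i ≠ j → ∃! x, x ∈ s.workspace ∧
    dist x (s.foot i) = s.outer i ∧ dist x (s.foot j) = s.outer j
  /-- the ray from each foot through the centre of gravity leaves the workspace through the arc
  that is centred at this foot, and not in a corner -/
  exits : ∀ i j, i ≠ j → dist (s.exitPoint i) (s.foot j) < s.outer j

end Spider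

end Tripod

end

/-! Over a centre x in the workspace W every leg has two possible elbows, mirror images in the line
from its foot to x, which coincide exactly when the leg is stretched or folded ("aligned"). So the
configuration space consists of eight copies ("sheets") of W, one for each pattern of signs, glued
where signs lose their meaning, and the fibre over x has 2^(3-k) points if k legs are aligned
(`ncard_fibre`). By the hypotheses two legs are aligned at once only if both are stretched, that is,
at a corner (`aligned_cases`), and there the third leg is not aligned.

Smoothness: where at most leg i is aligned, the angles of its two bars are coordinates
(`exists_chart_angles`); at a corner the bending angles of the two stretched legs are
(`exists_chart_corner`). Orientability: let ω be the area form of the centre and s_i twice the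
signed area of the triangle of leg i. The form `orientation` is ω / (s_0 s_1 s_2) times a sum of
squares, written so that it extends over the zeros of the s_i. Connectedness: W is connected, and
two sheets that differ in one sign meet over an inner circle.

Euler characteristic: W is swept by the rays from foot 0. The directions of the three corners and of
the four tangents to the two other holes cut the circle of directions into arcs. Over these
directions and arcs W falls into cells on which the set of aligned legs is constant, and a cell with
k aligned legs has 2^(3-k) lifts. An arc or a generic direction contributes 0 in total, a corner
direction -2 and a tangent direction -4 (these add up if they coincide), whence 3(-2) + 4(-4) = -22.

Energy: H = 3|x - z|^2 + const (`hooke_eq`). Where no leg is aligned only z is critical, which gives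
8 minima. Where exactly leg i is aligned, x is critical if it lies on the line through foot i and z:
one point of the outer circle (the opposite one is not in W, `antipode_notMem`) and two of the inner
circle. The Hessian determinant in the bar angles is negative, so the 9 points give 9 * 4 = 36
saddles. At a corner x - z is a positive combination of x - a_i and x - a_j, so H increases to first
order with both bending cosines, which are largest at the corner: 3 * 2 = 6 nondegenerate maxima.

The planar geometry behind this is `corner_cone`. Since a pair of outer circles has only one corner
in W, the mirror image of a corner in the line through the two feet is outside W; hence the corner
is on the side of the third foot and of z. Together with the position of the exit points this puts z
into the cone at the corner spanned by the directions to the two feet. -/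

noncomputable section

namespace Tripod

/-! ### Local parametrizations, transition maps and invariance of the Morse index -/

section Surface

variable {E : Type*} [NormedAddCommGroup E] [NormedSpace ℝ E]

/-- A smooth map with a differentiable left inverse, defined near the relatively open part of `S`
that it parametrizes, is a local parametrization. -/
theorem IsLocalParam.of_leftInverse {S V : Set E} {U : Set Plane} {φ : Plane → E} {ψ : E → Plane}
    (hU : IsOpen U) (hV : IsOpen V) (hφ : ContDiffOn ℝ ∞ φ U)
    (hψ : ∀ q ∈ V, DifferentiableAt ℝ ψ q) (hmaps : ∀ u ∈ U, φ u ∈ S ∩ V)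
    (hleft : ∀ u ∈ U, ψ (φ u) = u) (hright : ∀ q ∈ S ∩ V, ψ q ∈ U → φ (ψ q) = q) :
    IsLocalParam S U φ where
  isOpen := hU
  contDiffOn := hφ
  immersion u hu := by
    have h1 : HasFDerivAt φ (fderiv ℝ φ u) u :=
      ((hφ.contDiffAt (hU.mem_nhds hu)).differentiableAt (by simp)).hasFDerivAt
    have h2 := (hψ _ (hmaps u hu).2).hasFDerivAt.comp u h1
    have h3 : HasFDerivAt (ψ ∘ φ) (ContinuousLinearMap.id ℝ Plane) u :=
      (hasFDerivAt_id u).congr_of_eventuallyEq <| by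
        filter_upwards [hU.mem_nhds hu] with v hv using hleft v hv
    have h4 := h2.unique h3
    intro v w hvw
    have := congrArg (fderiv ℝ ψ (φ u)) hvw
    change ((fderiv ℝ ψ (φ u)).comp (fderiv ℝ φ u)) v = ((fderiv ℝ ψ (φ u)).comp (fderiv ℝ φ u)) w
      at this
    rwa [h4] at this
  injOn u hu v hv huv := by rw [← hleft u hu, ← hleft v hv, huv]
  isOpen_image O hOU hO := by
    refine ⟨V ∩ ψ ⁻¹' O, ContinuousOn.isOpen_inter_preimage
      (fun q hq => (hψ q hq).continuousAt.continuousWithinAt) hV hO, ?_⟩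
    ext q
    constructor
    · rintro ⟨u, hu, rfl⟩
      have := hmaps u (hOU hu)
      exact ⟨this.1, this.2, by rwa [Set.mem_preimage, hleft u (hOU hu)]⟩
    · rintro ⟨hS, hqV, hqO⟩
      exact ⟨ψ q, hqO, hright q ⟨hS, hqV⟩ (hOU hqO)⟩

theorem IsLocalParam.mem {S : Set E} {U : Set Plane} {φ : Plane → E} (h : IsLocalParam S U φ)
    {u : Plane} (hu : u ∈ U) : φ u ∈ S := by
  obtain ⟨V, -, hV⟩ := h.isOpen_image U subset_rfl h.isOpen
  have : φ u ∈ φ '' U := ⟨u, hu, rfl⟩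
  rw [hV] at this
  exact this.1

theorem IsLocalParam.contDiffAt {S : Set E} {U : Set Plane} {φ : Plane → E}
    (h : IsLocalParam S U φ) {u : Plane} (hu : u ∈ U) : ContDiffAt ℝ ∞ φ u :=
  h.contDiffOn.contDiffAt (h.isOpen.mem_nhds hu)

/-- Two local parametrizations of a surface differ by a local diffeomorphism. -/
theorem IsLocalParam.exists_transition [FiniteDimensional ℝ E] {S : Set E} {U U' : Set Plane}
    {φ ψ : Plane → E} (hφ : IsLocalParam S U φ) (hψ : IsLocalParam S U' ψ) {u u' : Plane}
    (hu : u ∈ U) (hu' : u' ∈ U') (h : φ u = ψ u') :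
    ∃ τ : Plane → Plane, τ u = u' ∧ ContDiffAt ℝ ∞ τ u ∧ φ =ᶠ[𝓝 u] ψ ∘ τ := by
  -- Composed with a linear left inverse `L` of its derivative, `ψ` becomes a map of the plane with
  -- derivative the identity at `u'`, to which the inverse function theorem applies. The transition
  -- map is `(L ∘ ψ)⁻¹ ∘ L ∘ φ`.
  obtain ⟨L₀, hL₀⟩ := LinearMap.exists_leftInverse_of_injective
    (fderiv ℝ ψ u' : Plane →ₗ[ℝ] E) (LinearMap.ker_eq_bot.mpr (hψ.immersion u' hu'))
  set L : E →L[ℝ] Plane := LinearMap.toContinuousLinearMap L₀ with hL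
  have hg : ContDiffAt ℝ ∞ (L ∘ ψ) u' := L.contDiff.contDiffAt.comp u' (hψ.contDiffAt hu')
  have hg' : HasFDerivAt (L ∘ ψ) ((ContinuousLinearEquiv.refl ℝ Plane : Plane ≃L[ℝ] Plane) :
      Plane →L[ℝ] Plane) u' := by
    have h1 := L.hasFDerivAt.comp u' ((hψ.contDiffAt hu').differentiableAt (by simp)).hasFDerivAt
    convert! h1 using 1
    ext1 v
    exact (LinearMap.congr_fun hL₀ v).symm
  set e := hg.toOpenPartialHomeomorph (L ∘ ψ) hg' (by simp) with he
  have hes : u' ∈ e.source := hg.mem_toOpenPartialHomeomorph_source hg' (by simp)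
  have hecoe : (e : Plane → Plane) = L ∘ ψ := hg.toOpenPartialHomeomorph_coe hg' (by simp)
  have hinv : ContDiffAt ℝ ∞ e.symm (L (ψ u')) := by
    have := hg.to_localInverse hg' (by simp)
    exact this
  -- Relative openness of the image is what makes the points of `S` near `φ u` come from parameters
  -- of `ψ` in the domain of the local inverse.
  obtain ⟨V, hV, hVeq⟩ := hψ.isOpen_image (e.source ∩ U') Set.inter_subset_right
    (e.open_source.inter hψ.isOpen)
  have hmem : φ u ∈ V := by
    have : ψ u' ∈ ψ '' (e.source ∩ U') := ⟨u', ⟨hes, hu'⟩, rfl⟩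
    rw [hVeq] at this
    rw [h]; exact this.2
  refine ⟨e.symm ∘ L ∘ φ, ?_, ?_, ?_⟩
  · have := e.left_inv hes
    simp only [Function.comp_apply, h]
    rwa [hecoe] at this
  · refine ContDiffAt.comp u ?_ (L.contDiff.contDiffAt.comp u (hφ.contDiffAt hu))
    simpa [h] using hinv
  · have h1 : ∀ᶠ v in 𝓝 u, φ v ∈ V :=
      (hφ.contDiffAt hu).continuousAt.eventually (hV.mem_nhds hmem)
    filter_upwards [h1, hφ.isOpen.mem_nhds hu] with v hv hvU
    have : φ v ∈ ψ '' (e.source ∩ U') := by rw [hVeq]; exact ⟨hφ.mem hvU, hv⟩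
    obtain ⟨w, ⟨hw, -⟩, hwv⟩ := this
    have := e.left_inv hw
    rw [hecoe] at this
    simp only [Function.comp_apply] at this ⊢
    rw [← hwv, this]

theorem fderiv_injective_of_comp {φ ψ : Plane → E} {τ : Plane → Plane} {u : Plane}
    (hτ : DifferentiableAt ℝ τ u) (hψ : DifferentiableAt ℝ ψ (τ u)) (h : φ =ᶠ[𝓝 u] ψ ∘ τ)
    (hinj : Function.Injective (fderiv ℝ φ u)) : Function.Injective (fderiv ℝ τ u) := by
  rw [h.fderiv_eq, fderiv_comp u hψ hτ] at hinj
  exact Function.Injective.of_comp hinj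

/-- The Hessian at a critical point is transformed as a bilinear form. -/
theorem fderiv_fderiv_comp_of_critical {g : Plane → ℝ} {τ : Plane → Plane} {u : Plane}
    (hg : ContDiffAt ℝ ∞ g (τ u)) (hτ : ContDiffAt ℝ ∞ τ u) (hcrit : fderiv ℝ g (τ u) = 0)
    (v w : Plane) : fderiv ℝ (fderiv ℝ (g ∘ τ)) u v w =
      fderiv ℝ (fderiv ℝ g) (τ u) (fderiv ℝ τ u v) (fderiv ℝ τ u w) := by
  have h1 : fderiv ℝ (g ∘ τ) =ᶠ[𝓝 u] fun x => (fderiv ℝ g (τ x)).comp (fderiv ℝ τ x) := by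
    have e1 : ∀ᶠ x in 𝓝 u, DifferentiableAt ℝ τ x :=
      ((hτ.of_le (m := 1) (by simp)).eventually (by simp)).mono
        fun x hx => hx.differentiableAt (by simp)
    have e2 : ∀ᶠ x in 𝓝 u, DifferentiableAt ℝ g (τ x) :=
      hτ.continuousAt.eventually
        (((hg.of_le (m := 1) (by simp)).eventually (by simp)).mono
          fun x hx => hx.differentiableAt (by simp))
    filter_upwards [e1, e2] with x h1 h2 using fderiv_comp x h2 h1
  have h2 : HasFDerivAt (fderiv ℝ τ) (fderiv ℝ (fderiv ℝ τ) u) u :=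
    ((hτ.fderiv_right (m := ∞) (by simp)).differentiableAt (by simp)).hasFDerivAt
  have h3 : HasFDerivAt (fderiv ℝ g) (fderiv ℝ (fderiv ℝ g) (τ u)) (τ u) :=
    ((hg.fderiv_right (m := ∞) (by simp)).differentiableAt (by simp)).hasFDerivAt
  have h4 := (h3.comp u (hτ.differentiableAt (by simp)).hasFDerivAt).clm_comp h2
  have h5 : fderiv ℝ (fderiv ℝ (g ∘ τ)) u = _ := h1.fderiv_eq.trans h4.fderiv
  rw [h5]
  -- The other term, the derivative of `g` applied to the second derivative of `τ`, vanishes at a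
  -- critical point.
  simp [hcrit]

/-- An injective endomorphism of the plane is an automorphism, so it carries a splitting for the
pulled-back form to a splitting for `B`. -/
theorem HasIndex.of_comp {B B' : Plane →L[ℝ] Plane →L[ℝ] ℝ} {T : Plane →L[ℝ] Plane}
    (hT : Function.Injective T) (h : ∀ v w, B' v w = B (T v) (T w)) {k : ℕ}
    (hB : HasIndex B' k) : HasIndex B k := by
  obtain ⟨N, P, hNP, hk, hN, hP⟩ := hB
  set e : Plane ≃ₗ[ℝ] Plane := LinearEquiv.ofInjectiveEndo (T : Plane →ₗ[ℝ] Plane) hT with he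
  have happ : ∀ v, e v = T v := fun v => rfl
  refine ⟨N.map (e : Plane →ₗ[ℝ] Plane), P.map (e : Plane →ₗ[ℝ] Plane), ?_, ?_, ?_, ?_⟩
  · exact hNP.map (Submodule.orderIsoMapComap e)
  · rw [← hk]; exact LinearEquiv.finrank_map_eq e N
  · rintro _ ⟨v, hv, rfl⟩ hne
    have hv0 : v ≠ 0 := by rintro rfl; exact hne (map_zero _)
    have := hN v hv hv0
    rwa [h] at this
  · rintro _ ⟨v, hv, rfl⟩ hne
    have hv0 : v ≠ 0 := by rintro rfl; exact hne (map_zero _)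
    have := hP v hv hv0
    rwa [h] at this

/-- Sylvester's law of inertia: the negative space of one splitting and the positive space of the
other meet only in zero, since the form cannot have both signs on a vector. Then count dimensions.
-/
theorem HasIndex.le {B : Plane →L[ℝ] Plane →L[ℝ] ℝ} {k k' : ℕ} (h : HasIndex B k)
    (h' : HasIndex B k') : k ≤ k' := by
  obtain ⟨N, P, hNP, hk, hN, hP⟩ := h
  obtain ⟨N', P', hNP', hk', hN', hP'⟩ := h'
  have hd : Disjoint N P' := by
    rw [Submodule.disjoint_def]
    intro v hv hv'
    by_contra h0
    exact lt_asymm (hN v hv h0) (hP' v hv' h0)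
  have h1 := Submodule.finrank_add_finrank_le_of_disjoint hd
  have h2 := Submodule.finrank_add_eq_of_isCompl hNP'
  omega

theorem HasIndex.unique {B : Plane →L[ℝ] Plane →L[ℝ] ℝ} {k k' : ℕ} (h : HasIndex B k)
    (h' : HasIndex B k') : k = k' :=
  le_antisymm (h.le h') (h'.le h)

/-- Criticality can be tested in any local parametrization. -/
theorem IsLocalParam.fderiv_eq_zero_of_isCriticalPointOn [FiniteDimensional ℝ E] {S : Set E}
    {U : Set Plane} {ψ : Plane → E} {f : E → ℝ} (hψ : IsLocalParam S U ψ) (hf : ContDiff ℝ ∞ f)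
    {u : Plane} (hu : u ∈ U) (h : IsCriticalPointOn f S (ψ u)) : fderiv ℝ (f ∘ ψ) u = 0 := by
  obtain ⟨U', φ, v, hφ, hv, hvu, h0⟩ := h
  obtain ⟨τ, hτ, hτd, hev⟩ := hψ.exists_transition hφ hu hv hvu.symm
  have hev' : f ∘ ψ =ᶠ[𝓝 u] (f ∘ φ) ∘ τ := hev.fun_comp f
  subst hτ
  rw [hev'.fderiv_eq, fderiv_comp u
    ((hf.contDiffAt.comp _ (hφ.contDiffAt hv)).differentiableAt (by simp))
    (hτd.differentiableAt (by simp)), h0]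
  simp

/-- The Morse index can be computed in any local parametrization. -/
theorem IsLocalParam.hasIndex_of_isMorsePointOn [FiniteDimensional ℝ E] {S : Set E}
    {U : Set Plane} {ψ : Plane → E} {f : E → ℝ} (hψ : IsLocalParam S U ψ) (hf : ContDiff ℝ ∞ f)
    {u : Plane} (hu : u ∈ U) {k : ℕ} (h : IsMorsePointOn f S k (ψ u)) :
    fderiv ℝ (f ∘ ψ) u = 0 ∧ HasIndex (fderiv ℝ (fderiv ℝ (f ∘ ψ)) u) k := by
  obtain ⟨U', φ, v, hφ, hv, hvu, h0, hk⟩ := h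
  have hcrit := hψ.fderiv_eq_zero_of_isCriticalPointOn hf hu ⟨U', φ, v, hφ, hv, hvu, h0⟩
  refine ⟨hcrit, ?_⟩
  obtain ⟨τ, hτ, hτd, hev⟩ := hφ.exists_transition hψ hv hu hvu
  have hev' : f ∘ φ =ᶠ[𝓝 v] (f ∘ ψ) ∘ τ := hev.fun_comp f
  subst hτ
  have hinj := fderiv_injective_of_comp (hτd.differentiableAt (by simp))
    ((hψ.contDiffAt hu).differentiableAt (by simp)) hev (hφ.immersion v hv)
  refine hk.of_comp hinj fun x y => ?_
  rw [hev'.fderiv.fderiv_eq]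
  exact fderiv_fderiv_comp_of_critical (hf.contDiffAt.comp _ (hψ.contDiffAt hu)) hτd hcrit x y

theorem IsMorsePointOn.isCriticalPointOn {S : Set E} {f : E → ℝ} {k : ℕ} {p : E}
    (h : IsMorsePointOn f S k p) : IsCriticalPointOn f S p := by
  obtain ⟨U, φ, u, h1, h2, h3, h4, -⟩ := h
  exact ⟨U, φ, u, h1, h2, h3, h4⟩

end Surface


/-! ### Finite cell decompositions of dimension at most two -/

/-- The points `(a, b)` of the open unit cube of dimension `d ≤ 2`, the superfluous coordinates
being zero. -/
def InOpenCube (d : ℕ) (a b : ℝ) : Prop := |a| < 1 ∧ |b| < 1 ∧ (d < 1 → a = 0) ∧ (d < 2 → b = 0)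

/-- The points `(a, b)` of the closed unit cube of dimension `d ≤ 2`, the superfluous coordinates
being zero. -/
def InClosedCube (d : ℕ) (a b : ℝ) : Prop :=
  |a| ≤ 1 ∧ |b| ≤ 1 ∧ (d < 1 → a = 0) ∧ (d < 2 → b = 0)

/-- The coordinate number `i` of a vector, zero if there is none. -/
def coord {n : ℕ} (v : Fin n → ℝ) (i : ℕ) : ℝ := if h : i < n then v ⟨i, h⟩ else 0

theorem continuous_coord (n i : ℕ) : Continuous fun v : Fin n → ℝ => coord v i := by
  unfold coord
  split_ifs with h
  · exact continuous_apply _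
  · exact continuous_const

theorem abs_coord_le {n : ℕ} {v : Fin n → ℝ} (hv : v ∈ Metric.closedBall (0 : Fin n → ℝ) 1)
    (i : ℕ) : |coord v i| ≤ 1 := by
  rw [mem_closedBall_zero_iff, pi_norm_le_iff_of_nonneg zero_le_one] at hv
  unfold coord
  split_ifs with h
  · exact hv _
  · simp

theorem inClosedCube_coord {n : ℕ} {v : Fin n → ℝ}
    (hv : v ∈ Metric.closedBall (0 : Fin n → ℝ) 1) :
    InClosedCube n (coord v 0) (coord v 1) :=
  ⟨abs_coord_le hv 0, abs_coord_le hv 1, fun h => dif_neg (by omega), fun h => dif_neg (by omega)⟩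

theorem inOpenCube_coord {n : ℕ} {v : Fin n → ℝ} (hn : n ≤ 2) :
    InOpenCube n (coord v 0) (coord v 1) ↔ v ∈ Metric.ball (0 : Fin n → ℝ) 1 := by
  rw [mem_ball_zero_iff, pi_norm_lt_iff zero_lt_one]
  constructor
  · rintro ⟨h0, h1, -, -⟩ ⟨i, hi⟩
    rw [Real.norm_eq_abs]
    obtain rfl | rfl : i = 0 ∨ i = 1 := by omega
    · rwa [coord, dif_pos hi] at h0
    · rwa [coord, dif_pos hi] at h1
  · intro h
    refine ⟨?_, ?_, fun h => dif_neg (by omega), fun h => dif_neg (by omega)⟩ <;>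
    · unfold coord
      split_ifs
      · exact h _
      · simp

theorem exists_coord {n : ℕ} {a b : ℝ} (h : InOpenCube n a b) :
    ∃ v ∈ Metric.ball (0 : Fin n → ℝ) 1, coord v 0 = a ∧ coord v 1 = b := by
  obtain ⟨h0, h1, h2, h3⟩ := h
  refine ⟨fun i => if i.1 = 0 then a else if i.1 = 1 then b else 0, ?_, ?_, ?_⟩
  · rw [mem_ball_zero_iff, pi_norm_lt_iff zero_lt_one]
    intro i
    split_ifs <;> simp [h0, h1]
  · unfold coord
    split_ifs with h
    · simp
    · exact (h2 (by omega)).symm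
  · unfold coord
    split_ifs with h
    · simp
    · exact (h3 (by omega)).symm

theorem coord_injective {n : ℕ} (hn : n ≤ 2) {v w : Fin n → ℝ} (h0 : coord v 0 = coord w 0)
    (h1 : coord v 1 = coord w 1) : v = w := by
  ext ⟨i, hi⟩
  obtain rfl | rfl : i = 0 ∨ i = 1 := by omega
  · rwa [coord, coord, dif_pos hi, dif_pos hi] at h0
  · rwa [coord, coord, dif_pos hi, dif_pos hi] at h1

/-- The inverse of a continuous map on a compact set is continuous on the image of a saturated
subset on which the map is injective. -/
theorem continuousOn_invFunOn {α X : Type*} [TopologicalSpace α] [TopologicalSpace X] [T2Space X]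
    [Nonempty α] {f : α → X} {B K : Set α} (hK : IsCompact K) (hBK : B ⊆ K)
    (hf : ContinuousOn f K) (hinj : Set.InjOn f B) (hsat : ∀ a ∈ K, ∀ b ∈ B, f a = f b → a ∈ B) :
    ContinuousOn (Function.invFunOn f B) (f '' B) := by
  rw [continuousOn_iff_isClosed]
  intro t ht
  -- The image of the compact set `K ∩ t` is closed. Saturation ensures that, within the image of
  -- `B`, the points of `K` outside `B` add nothing to it.
  refine ⟨f '' (K ∩ t), ((hK.inter_right ht).image_of_continuousOn
    (hf.mono Set.inter_subset_left)).isClosed, ?_⟩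
  ext x
  constructor
  · rintro ⟨hx, b, hb, rfl⟩
    have h1 := Function.invFunOn_mem (f := f) (s := B) ⟨b, hb, rfl⟩
    exact ⟨⟨_, ⟨hBK h1, hx⟩, Function.invFunOn_eq (f := f) ⟨b, hb, rfl⟩⟩, b, hb, rfl⟩
  · rintro ⟨⟨a, ⟨haK, hat⟩, ha⟩, b, hb, rfl⟩
    have haB := hsat a haK b hb ha
    have hab := hinj haB hb ha
    subst hab
    exact ⟨by rw [Set.mem_preimage, hinj.leftInvOn_invFunOn hb]; exact hat, a, hb, rfl⟩

/-- A decomposition of `S` into finitely many open cells of dimension at most two, with continuous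
characteristic maps that send the boundary of a cell to cells of lower dimension, computes the
Euler characteristic of `S`. -/
theorem hasEulerCharacteristic_of_cells {X : Type} [TopologicalSpace X] [T2Space X] {S : Set X}
    {K : Type} [Fintype K] (d : K → ℕ) (hd : ∀ k, d k ≤ 2) (f : K → ℝ → ℝ → X)
    (hcont : ∀ k, ContinuousOn (fun p : ℝ × ℝ => f k p.1 p.2) {p | |p.1| ≤ 1 ∧ |p.2| ≤ 1})
    (hmem : ∀ k a b, InOpenCube (d k) a b → f k a b ∈ S)
    (hinj : ∀ k a b k' a' b', InOpenCube (d k) a b → InOpenCube (d k') a' b' →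
      f k a b = f k' a' b' → k = k' ∧ a = a' ∧ b = b')
    (hcover : ∀ x ∈ S, ∃ k a b, InOpenCube (d k) a b ∧ f k a b = x)
    (hbdry : ∀ k a b, InClosedCube (d k) a b → ¬ InOpenCube (d k) a b →
      ∃ k' a' b', d k' < d k ∧ InOpenCube (d k') a' b' ∧ f k' a' b' = f k a b) :
    HasEulerCharacteristic S (∑ k, (-1 : ℤ) ^ d k) := by
  classical
  -- In the sup norm the balls of `Fin n → ℝ` are cubes; with missing coordinates read as zero, maps
  -- of two real variables serve for all dimensions up to two.
  set F : ∀ n, {k // d k = n} → (Fin n → ℝ) → X := fun n k v => f k.1 (coord v 0) (coord v 1)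
    with hF
  have hFinj : ∀ n k n' k' v v', v ∈ Metric.ball 0 1 → v' ∈ Metric.ball 0 1 →
      F n k v = F n' k' v' → k.1 = k'.1 ∧ coord v 0 = coord v' 0 ∧ coord v 1 = coord v' 1 := by
    rintro n ⟨k, rfl⟩ n' ⟨k', rfl⟩ v v' hv hv' h
    exact hinj _ _ _ _ _ _ ((inOpenCube_coord (hd k)).mpr hv)
      ((inOpenCube_coord (hd k')).mpr hv') h
  have hinjOn : ∀ n k, Set.InjOn (F n k) (Metric.ball 0 1) := by
    rintro n ⟨k, rfl⟩ v hv w hw h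
    obtain ⟨-, h0, h1⟩ := hFinj _ _ _ _ _ _ hv hw h
    exact coord_injective (hd k) h0 h1
  have hFcont : ∀ n k, ContinuousOn (F n k) (Metric.closedBall 0 1) := by
    intro n k
    exact (hcont k.1).comp (((continuous_coord n 0).prodMk (continuous_coord n 1)).continuousOn)
      fun v hv => ⟨abs_coord_le hv 0, abs_coord_le hv 1⟩
  have hlower : ∀ n k, ∀ v ∈ Metric.closedBall (0 : Fin n → ℝ) 1, v ∉ Metric.ball 0 1 →
      ∃ m < n, ∃ k' : {k // d k = m}, ∃ w ∈ Metric.ball 0 1, F m k' w = F n k v := by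
    rintro n ⟨k, rfl⟩ v hv hv'
    obtain ⟨k', a', b', hlt, ho, heq⟩ := hbdry k _ _ (inClosedCube_coord hv)
      (fun h => hv' ((inOpenCube_coord (hd k)).mp h))
    obtain ⟨w, hw, rfl, rfl⟩ := exists_coord ho
    exact ⟨d k', hlt, ⟨k', rfl⟩, w, hw, heq⟩
  have hFmem : ∀ n k, ∀ v ∈ Metric.ball 0 1, F n k v ∈ S := by
    rintro n ⟨k, rfl⟩ v hv
    exact hmem _ _ _ ((inOpenCube_coord (hd k)).mpr hv)
  have hempty : ∀ n, 3 ≤ n → IsEmpty {k // d k = n} :=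
    fun n hn => ⟨fun k => by have := hd k.1; have := k.2; omega⟩
  let map : ∀ n, {k // d k = n} → PartialEquiv (Fin n → ℝ) X := fun n k =>
    { toFun := F n k
      invFun := Function.invFunOn (F n k) (Metric.ball 0 1)
      source := Metric.ball 0 1
      target := F n k '' Metric.ball 0 1
      map_source' := fun v hv => ⟨v, hv, rfl⟩
      map_target' := fun x hx => Function.invFunOn_mem hx
      left_inv' := fun v hv => (hinjOn n k).leftInvOn_invFunOn hv
      right_inv' := fun x hx => Function.invFunOn_eq hx }
  refine ⟨Topology.CWComplex.mkFinite S (fun n => {k // d k = n}) map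
    (Filter.eventually_atTop.mpr ⟨3, hempty⟩) (fun n => inferInstance) (fun n k => rfl) hFcont
    (fun n k => ?_) ?_ (fun n k v hv => ?_) ?_, 3, fun n => ?_, hempty, ?_⟩
  · refine continuousOn_invFunOn (isCompact_closedBall 0 1) Metric.ball_subset_closedBall
      (hFcont n k) (hinjOn n k) fun a ha b hb hab => ?_
    -- A boundary point is sent into an open cell of lower dimension, which is disjoint from the
    -- present open cell.
    by_contra hna
    obtain ⟨m, hm, k', w, hw, heq⟩ := hlower n k a ha hna
    obtain ⟨h1, -⟩ := hFinj _ _ _ _ _ _ hw hb (heq.trans hab)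
    have e1 := k'.2
    have e2 := k.2
    rw [h1] at e1
    omega
  · rintro ⟨n, k⟩ - ⟨n', k'⟩ - hne
    rw [Function.onFun, Set.disjoint_left]
    rintro _ ⟨v, hv, rfl⟩ ⟨w, hw, h⟩
    obtain ⟨h1, -⟩ := hFinj _ _ _ _ _ _ hw hv h
    apply hne
    obtain ⟨k, rfl⟩ := k
    obtain ⟨k', rfl⟩ := k'
    simp only at h1
    subst h1
    rfl
  · obtain ⟨m, hm, k', w, hw, heq⟩ := hlower n k v (Metric.sphere_subset_closedBall hv)
      (fun h => by rw [mem_sphere_zero_iff_norm] at hv; rw [mem_ball_zero_iff] at h; linarith)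
    simp only [Set.mem_iUnion]
    exact ⟨m, hm, k', w, Metric.ball_subset_closedBall hw, heq⟩
  · refine subset_antisymm ?_ ?_
    · simp only [Set.iUnion_subset_iff]
      rintro n k _ ⟨v, hv, rfl⟩
      by_cases hvb : v ∈ Metric.ball 0 1
      · exact hFmem n k v hvb
      · obtain ⟨m, hm, k', w, hw, heq⟩ := hlower n k v hv hvb
        change F n k v ∈ S
        rw [← heq]
        exact hFmem m k' w hw
    · intro x hx
      obtain ⟨k, a, b, ho, rfl⟩ := hcover x hx
      obtain ⟨w, hw, rfl, rfl⟩ := exists_coord ho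
      simp only [Set.mem_iUnion]
      exact ⟨d k, ⟨k, rfl⟩, w, Metric.ball_subset_closedBall hw, rfl⟩
  · exact inferInstanceAs (Finite {k // d k = n})
  · change ∑ n ∈ Finset.range 3, (-1 : ℤ) ^ n * (Nat.card {k // d k = n} : ℤ) = _
    rw [← Finset.sum_fiberwise_of_maps_to (s := Finset.univ) (t := Finset.range 3) (g := d)
      (fun k _ => Finset.mem_range.mpr (Nat.lt_succ_of_le (hd k)))]
    refine Finset.sum_congr rfl fun n _ => ?_
    rw [Finset.sum_congr rfl (g := fun _ => (-1 : ℤ) ^ n)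
      (fun k hk => by rw [(Finset.mem_filter.mp hk).2]), Finset.sum_const, Nat.card_eq_fintype_card,
      Fintype.card_subtype, nsmul_eq_mul, mul_comm]


/-! ### Coordinates in the plane -/

/-- The scalar product of the plane in coordinates. -/
def dot (v w : Plane) : ℝ := v 0 * w 0 + v 1 * w 1

/-- The determinant of two vectors of the plane. -/
def cross (v w : Plane) : ℝ := v 0 * w 1 - v 1 * w 0

/-- The rotation by a right angle. -/
def rot : Plane →L[ℝ] Plane := LinearMap.toContinuousLinearMap
  { toFun := fun v => !₂[-v 1, v 0]
    map_add' := fun v w => by ext i; fin_cases i <;> simp [add_comm]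
    map_smul' := fun c v => by ext i; fin_cases i <;> simp }

@[simp] theorem rot_zero (v : Plane) : rot v 0 = -v 1 := rfl
@[simp] theorem rot_one (v : Plane) : rot v 1 = v 0 := rfl

theorem plane_ext {v w : Plane} (h0 : v 0 = w 0) (h1 : v 1 = w 1) : v = w := by
  ext i; fin_cases i <;> assumption

theorem norm_sq_eq_dot (v : Plane) : ‖v‖ ^ 2 = dot v v := by
  rw [EuclideanSpace.norm_eq, Real.sq_sqrt (Finset.sum_nonneg fun i _ => sq_nonneg _)]
  simp [Fin.sum_univ_two, dot, sq]

theorem dist_sq_eq_dot (x y : Plane) : dist x y ^ 2 = dot (x - y) (x - y) := by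
  rw [dist_eq_norm, norm_sq_eq_dot]

theorem dot_self_eq_zero {v : Plane} : dot v v = 0 ↔ v = 0 := by
  rw [← norm_sq_eq_dot]; simp

theorem dot_self_pos {v : Plane} : 0 < dot v v ↔ v ≠ 0 := by
  rw [← norm_sq_eq_dot, sq_pos_iff, norm_ne_zero_iff]

theorem dist_eq_iff_dot {x y : Plane} {r : ℝ} (hr : 0 ≤ r) :
    dist x y = r ↔ dot (x - y) (x - y) = r ^ 2 := by
  rw [← dist_sq_eq_dot, sq_eq_sq₀ dist_nonneg hr]

theorem dist_le_iff_dot {x y : Plane} {r : ℝ} (hr : 0 ≤ r) :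
    dist x y ≤ r ↔ dot (x - y) (x - y) ≤ r ^ 2 := by
  rw [← dist_sq_eq_dot, sq_le_sq₀ dist_nonneg hr]

theorem dist_lt_iff_dot {x y : Plane} {r : ℝ} (hr : 0 ≤ r) :
    dist x y < r ↔ dot (x - y) (x - y) < r ^ 2 := by
  rw [← dist_sq_eq_dot, sq_lt_sq₀ dist_nonneg hr]

theorem le_dist_iff_dot {x y : Plane} {r : ℝ} (hr : 0 ≤ r) :
    r ≤ dist x y ↔ r ^ 2 ≤ dot (x - y) (x - y) := by
  rw [← dist_sq_eq_dot, sq_le_sq₀ hr dist_nonneg]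

theorem lt_dist_iff_dot {x y : Plane} {r : ℝ} (hr : 0 ≤ r) :
    r < dist x y ↔ r ^ 2 < dot (x - y) (x - y) := by
  rw [← dist_sq_eq_dot, sq_lt_sq₀ hr dist_nonneg]

theorem contDiff_plane_apply (i : Fin 2) : ContDiff ℝ ∞ fun v : Plane => v i :=
  (EuclideanSpace.proj i : Plane →L[ℝ] ℝ).contDiff

section Smooth

variable {F : Type*} [NormedAddCommGroup F] [NormedSpace ℝ F] {f g : F → Plane} {u : F}

theorem ContDiffAt.dot (hf : ContDiffAt ℝ ∞ f u) (hg : ContDiffAt ℝ ∞ g u) :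
    ContDiffAt ℝ ∞ (fun x => dot (f x) (g x)) u :=
  (((contDiff_plane_apply 0).contDiffAt.comp u hf).mul
    ((contDiff_plane_apply 0).contDiffAt.comp u hg)).add
  (((contDiff_plane_apply 1).contDiffAt.comp u hf).mul
    ((contDiff_plane_apply 1).contDiffAt.comp u hg))

end Smooth

@[fun_prop] theorem continuous_dot {Z : Type*} [TopologicalSpace Z] {f g : Z → Plane}
    (hf : Continuous f) (hg : Continuous g) : Continuous fun x => dot (f x) (g x) := by
  unfold dot; fun_prop

@[fun_prop] theorem continuous_cross {Z : Type*} [TopologicalSpace Z] {f g : Z → Plane}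
    (hf : Continuous f) (hg : Continuous g) : Continuous fun x => cross (f x) (g x) := by
  unfold cross; fun_prop

/-! ### Triangles with given sides -/

/-- Four times the squared area of a triangle whose sides have the squares `t`, `L`, `M`. -/
def disc (t L M : ℝ) : ℝ := t * L - ((t + L - M) / 2) ^ 2

/-- The apex of the triangle over the base `a`, `b` whose sides at `a` and `b` have the squared
lengths `L` and `M`; the sign `ε` tells on which side of the base it lies. -/
def apex (a b : Plane) (L M ε : ℝ) : Plane :=
  a + (dot (b - a) (b - a))⁻¹ • (((dot (b - a) (b - a) + L - M) / 2) • (b - a) +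
    (ε * √(disc (dot (b - a) (b - a)) L M)) • rot (b - a))

theorem dot_apex_sub_left {a b : Plane} {L M ε : ℝ} (hab : b ≠ a)
    (hd : 0 ≤ disc (dot (b - a) (b - a)) L M) (hε : ε ^ 2 = 1) :
    dot (apex a b L M ε - a) (apex a b L M ε - a) = L := by
  have ht : dot (b - a) (b - a) ≠ 0 := (dot_self_pos.mpr (sub_ne_zero.mpr hab)).ne'
  have hs := Real.sq_sqrt hd
  unfold apex
  generalize √(disc (dot (b - a) (b - a)) L M) = r at *
  generalize hv : b - a = v at *
  rw [add_sub_cancel_left]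
  rw [disc] at hs
  generalize htt : dot v v = t at *
  simp only [dot, PiLp.smul_apply, PiLp.add_apply, rot_zero, rot_one, smul_eq_mul] at htt ⊢
  field_simp
  have : v 1 ^ 2 = t - v 0 ^ 2 := by linear_combination htt
  linear_combination (norm := ring_nf) (4 * t * r ^ 2) * hε + 4 * t * hs +
    ((t + L - M) ^ 2 + 4 * (ε * r) ^ 2) * this

theorem dot_apex_sub_right {a b : Plane} {L M ε : ℝ} (hab : b ≠ a)
    (hd : 0 ≤ disc (dot (b - a) (b - a)) L M) (hε : ε ^ 2 = 1) :
    dot (b - apex a b L M ε) (b - apex a b L M ε) = M := by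
  have h1 := dot_apex_sub_left hab hd hε
  have ht : dot (b - a) (b - a) ≠ 0 := (dot_self_pos.mpr (sub_ne_zero.mpr hab)).ne'
  have h2 : dot (b - a) (apex a b L M ε - a) = (dot (b - a) (b - a) + L - M) / 2 := by
    unfold apex
    generalize ε * √(disc (dot (b - a) (b - a)) L M) = r at *
    generalize hv : b - a = v at *
    rw [add_sub_cancel_left]
    generalize htt : dot v v = t at *
    simp only [dot, PiLp.smul_apply, PiLp.add_apply, rot_zero, rot_one, smul_eq_mul] at htt ⊢
    field_simp
    linear_combination (t + L - M) * htt
  generalize apex a b L M ε = p at *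
  simp only [dot, PiLp.sub_apply] at *
  linear_combination h1 - 2 * h2

theorem cross_apex {a b : Plane} {L M ε : ℝ} (hab : b ≠ a) :
    cross (b - a) (apex a b L M ε - a) = ε * √(disc (dot (b - a) (b - a)) L M) := by
  have ht : dot (b - a) (b - a) ≠ 0 := (dot_self_pos.mpr (sub_ne_zero.mpr hab)).ne'
  unfold apex
  generalize ε * √(disc (dot (b - a) (b - a)) L M) = r at *
  generalize hv : b - a = v at *
  rw [add_sub_cancel_left]
  generalize htt : dot v v = t at *
  simp only [dot, cross, PiLp.smul_apply, PiLp.add_apply, rot_zero, rot_one, smul_eq_mul] at htt ⊢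
  field_simp
  linear_combination (2 * r) * htt

theorem disc_eq_cross_sq {a b p : Plane} {L M : ℝ} (hL : dot (p - a) (p - a) = L)
    (hM : dot (b - p) (b - p) = M) :
    disc (dot (b - a) (b - a)) L M = cross (b - a) (p - a) ^ 2 := by
  subst hL hM
  simp only [disc, dot, cross, PiLp.sub_apply]
  ring

/-- In the orthogonal frame `b - a`, `rot (b - a)` the coefficients of `p - a` are its scalar
product and its determinant with `b - a`, over the squared length of the base. The law of cosines
fixes the first; `hε` prescribes the second. -/
theorem eq_apex {a b p : Plane} {L M ε : ℝ} (hab : b ≠ a) (hL : dot (p - a) (p - a) = L)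
    (hM : dot (b - p) (b - p) = M)
    (hε : ε * √(disc (dot (b - a) (b - a)) L M) = cross (b - a) (p - a)) :
    p = apex a b L M ε := by
  have ht : dot (b - a) (b - a) ≠ 0 := (dot_self_pos.mpr (sub_ne_zero.mpr hab)).ne'
  have h2 : dot (b - a) (p - a) = (dot (b - a) (b - a) + L - M) / 2 := by
    subst hL hM
    simp only [dot, PiLp.sub_apply]
    ring
  unfold apex
  rw [hε, ← h2]
  rw [← sub_eq_iff_eq_add']
  generalize hv : b - a = v at *
  generalize hw : p - a = w at *
  generalize htt : dot v v = t at *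
  apply plane_ext <;>
  · simp only [dot, cross, PiLp.smul_apply, PiLp.add_apply, rot_zero, rot_one, smul_eq_mul]
      at htt ⊢
    field_simp
    rw [← htt]
    ring

theorem apex_eq_of_mul_eq {a b : Plane} {L M ε ε' : ℝ}
    (h : ε * √(disc (dot (b - a) (b - a)) L M) = ε' * √(disc (dot (b - a) (b - a)) L M)) :
    apex a b L M ε = apex a b L M ε' := by
  unfold apex
  rw [h]

theorem contDiffAt_apex {F : Type*} [NormedAddCommGroup F] [NormedSpace ℝ F] {a : Plane}
    {b : F → Plane} {L M : F → ℝ} {ε : ℝ} {u : F} (hb : ContDiffAt ℝ ∞ b u)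
    (hL : ContDiffAt ℝ ∞ L u) (hM : ContDiffAt ℝ ∞ M u) (hab : b u ≠ a)
    (hd : 0 < disc (dot (b u - a) (b u - a)) (L u) (M u)) :
    ContDiffAt ℝ ∞ (fun x => apex a (b x) (L x) (M x) ε) u := by
  have ht : dot (b u - a) (b u - a) ≠ 0 := (dot_self_pos.mpr (sub_ne_zero.mpr hab)).ne'
  have h1 : ContDiffAt ℝ ∞ (fun x => b x - a) u := hb.sub contDiffAt_const
  have h2 := ContDiffAt.dot h1 h1
  have h3 : ContDiffAt ℝ ∞ (fun x => disc (dot (b x - a) (b x - a)) (L x) (M x)) u := by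
    unfold disc
    exact (h2.mul hL).sub ((((h2.add hL).sub hM).div_const 2).pow 2)
  unfold apex
  exact contDiffAt_const.add ((h2.inv ht).smul (((((h2.add hL).sub hM).div_const 2).smul h1).add
    ((contDiffAt_const.mul (h3.sqrt hd.ne')).smul (rot.contDiff.contDiffAt.comp u h1))))

/-- Unlike smoothness, continuity needs no positive discriminant, because the square root is
continuous on the whole line. So the sheets are continuous up to the boundary of the workspace. -/
theorem continuousAt_apex {a b : Plane} {L M ε : ℝ} (hab : b ≠ a) :
    ContinuousAt (fun x => apex a x L M ε) b := by
  have ht : dot (b - a) (b - a) ≠ 0 := (dot_self_pos.mpr (sub_ne_zero.mpr hab)).ne'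
  unfold apex disc
  have h1 : Continuous fun x : Plane => dot (x - a) (x - a) := by fun_prop
  refine continuousAt_const.add ((h1.continuousAt.inv₀ ht).smul (Continuous.continuousAt ?_))
  fun_prop


/-- The sign of a side of a line. -/
def sgn (b : Bool) : ℝ := if b then 1 else -1

theorem sgn_sq (b : Bool) : sgn b ^ 2 = 1 := by cases b <;> simp [sgn]

theorem sgn_mul_self (b : Bool) : sgn b * sgn b = 1 := by cases b <;> simp [sgn]

theorem sgn_ne_zero (b : Bool) : sgn b ≠ 0 := by cases b <;> simp [sgn]

theorem sgn_injective : Function.Injective sgn := by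
  intro a b h
  cases a <;> cases b <;> simp [sgn] at h ⊢ <;> linarith

/-- Heron's formula. Applied to the bars of a leg, it makes the discriminant vanish exactly at the
largest and at the smallest reach. -/
theorem four_mul_disc (d R S : ℝ) :
    4 * disc (d ^ 2) (R ^ 2) (S ^ 2) = ((R + S) ^ 2 - d ^ 2) * (d ^ 2 - (R - S) ^ 2) := by
  unfold disc; ring

theorem dot_sq_le (v w : Plane) : dot v w ^ 2 ≤ dot v v * dot w w := by
  unfold dot
  nlinarith [sq_nonneg (v 0 * w 1 - v 1 * w 0)]

theorem exists_third {i j : Fin 3} (h : i ≠ j) :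
    ∃ k, k ≠ i ∧ k ≠ j ∧ ∀ n, n = i ∨ n = j ∨ n = k := by
  revert i j; decide

/-! ### The sheets of the configuration space over the workspace -/

namespace Spider

variable (s : Spider)

/-- The squared distance from foot `i`. -/
def sqDist (i : Fin 3) (x : Plane) : ℝ := dot (x - s.foot i) (x - s.foot i)

/-- Four times the squared area of the triangle formed by leg `i`. -/
def legDisc (i : Fin 3) (x : Plane) : ℝ := disc (s.sqDist i x) (s.lower i ^ 2) (s.upper i ^ 2)

/-- The position of elbow `i` when the centre is at `x`, on a given side of the line through the
foot and the centre. -/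
def elbow (i : Fin 3) (b : Bool) (x : Plane) : Plane :=
  apex (s.foot i) x (s.lower i ^ 2) (s.upper i ^ 2) (sgn b)

/-- The section of the projection to the workspace with given sides of the elbows. -/
def sheet (ε : Fin 3 → Bool) (x : Plane) : Position := (x, fun i => s.elbow i (ε i) x)

theorem outer_pos (i : Fin 3) : 0 < s.outer i := add_pos (s.lower_pos i) (s.upper_pos i)

theorem inner_pos (i : Fin 3) : 0 < s.inner i := abs_pos.mpr (sub_ne_zero.mpr (s.lower_ne_upper i))

theorem inner_sq (i : Fin 3) : s.inner i ^ 2 = (s.lower i - s.upper i) ^ 2 := sq_abs _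

theorem inner_lt_outer (i : Fin 3) : s.inner i < s.outer i := by
  have := s.lower_pos i
  have := s.upper_pos i
  rw [inner, outer, abs_lt]
  constructor <;> linarith

theorem dist_sq_eq_sqDist (i : Fin 3) (x : Plane) : dist x (s.foot i) ^ 2 = s.sqDist i x :=
  dist_sq_eq_dot _ _

theorem four_mul_legDisc (i : Fin 3) (x : Plane) :
    4 * s.legDisc i x = (s.outer i ^ 2 - s.sqDist i x) * (s.sqDist i x - s.inner i ^ 2) := by
  rw [legDisc, ← dist_sq_eq_sqDist, four_mul_disc, inner_sq, outer]

theorem mem_configSpace {q : Position} : q ∈ s.configSpace ↔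
    ∀ i, dot (q.2 i - s.foot i) (q.2 i - s.foot i) = s.lower i ^ 2 ∧
      dot (q.1 - q.2 i) (q.1 - q.2 i) = s.upper i ^ 2 := by
  refine forall_congr' fun i => ?_
  rw [dist_comm (s.foot i), dist_comm (q.2 i) q.1, dist_eq_iff_dot (s.lower_pos i).le,
    dist_eq_iff_dot (s.upper_pos i).le]

theorem mem_workspace {x : Plane} : x ∈ s.workspace ↔
    ∀ i, s.inner i ^ 2 ≤ s.sqDist i x ∧ s.sqDist i x ≤ s.outer i ^ 2 := by
  refine forall_congr' fun i => ?_
  rw [le_dist_iff_dot (s.inner_pos i).le, dist_le_iff_dot (s.outer_pos i).le]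
  rfl

theorem fst_mem_workspace {q : Position} (hq : q ∈ s.configSpace) : q.1 ∈ s.workspace := by
  rw [← s.image_fst_configSpace]; exact ⟨q, hq, rfl⟩

variable {s}

theorem ne_foot {x : Plane} (hx : x ∈ s.workspace) (i : Fin 3) : x ≠ s.foot i := by
  have := (hx i).1
  intro h
  rw [h, dist_self] at this
  exact absurd (s.inner_pos i) (not_lt.mpr this)

theorem legDisc_nonneg {x : Plane} (hx : x ∈ s.workspace) (i : Fin 3) : 0 ≤ s.legDisc i x := by
  have h := s.mem_workspace.mp hx i
  have h4 := s.four_mul_legDisc i x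
  nlinarith [mul_nonneg (sub_nonneg.mpr h.2) (sub_nonneg.mpr h.1)]

theorem legDisc_eq_zero {x : Plane} {i : Fin 3} :
    s.legDisc i x = 0 ↔ dist x (s.foot i) = s.inner i ∨ dist x (s.foot i) = s.outer i := by
  have h4 := s.four_mul_legDisc i x
  rw [dist_eq_iff_dot (s.inner_pos i).le, dist_eq_iff_dot (s.outer_pos i).le]
  change _ ↔ s.sqDist i x = _ ∨ s.sqDist i x = _
  constructor
  · intro h
    rw [h, mul_zero, eq_comm, mul_eq_zero] at h4
    rcases h4 with h4 | h4
    · right; linarith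
    · left; linarith
  · rintro (h | h) <;> rw [h] at h4 <;> linarith

theorem legDisc_eq_cross_sq {q : Position} (hq : q ∈ s.configSpace) (i : Fin 3) :
    s.legDisc i q.1 = cross (q.1 - s.foot i) (q.2 i - s.foot i) ^ 2 :=
  disc_eq_cross_sq (s.mem_configSpace.mp hq i).1 (s.mem_configSpace.mp hq i).2

theorem sheet_mem {x : Plane} (hx : x ∈ s.workspace) (ε : Fin 3 → Bool) :
    s.sheet ε x ∈ s.configSpace :=
  s.mem_configSpace.mpr fun i =>
    ⟨dot_apex_sub_left (ne_foot hx i) (legDisc_nonneg hx i) (sgn_sq _),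
      dot_apex_sub_right (ne_foot hx i) (legDisc_nonneg hx i) (sgn_sq _)⟩

theorem cross_sheet {x : Plane} (hx : x ∈ s.workspace) (ε : Fin 3 → Bool) (i : Fin 3) :
    cross (x - s.foot i) ((s.sheet ε x).2 i - s.foot i) = sgn (ε i) * √(s.legDisc i x) :=
  cross_apex (ne_foot hx i)

theorem elbow_eq {q : Position} (hq : q ∈ s.configSpace) {i : Fin 3} {b : Bool}
    (h : 0 ≤ sgn b * cross (q.1 - s.foot i) (q.2 i - s.foot i)) : s.elbow i b q.1 = q.2 i := by
  refine (eq_apex (ne_foot (s.fst_mem_workspace hq) i) (s.mem_configSpace.mp hq i).1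
    (s.mem_configSpace.mp hq i).2 ?_).symm
  change _ * √(s.legDisc i q.1) = _
  rw [legDisc_eq_cross_sq hq i, Real.sqrt_sq_eq_abs]
  cases b <;> simp only [sgn] at h ⊢
  · rw [abs_of_nonpos (by simpa using h)]
    simp
  · rw [abs_of_nonneg (by simpa using h)]
    simp

theorem exists_sgn (r : ℝ) : ∃ b, 0 ≤ sgn b * r := by
  rcases le_total 0 r with h | h
  · exact ⟨true, by simpa [sgn]⟩
  · exact ⟨false, by simpa [sgn]⟩

theorem sheet_eq {q : Position} (hq : q ∈ s.configSpace) {ε : Fin 3 → Bool}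
    (h : ∀ i, 0 ≤ sgn (ε i) * cross (q.1 - s.foot i) (q.2 i - s.foot i)) :
    s.sheet ε q.1 = q :=
  Prod.ext rfl (funext fun i => elbow_eq hq (h i))

theorem exists_sheet {q : Position} (hq : q ∈ s.configSpace) : ∃ ε, s.sheet ε q.1 = q := by
  choose ε hε using fun i => exists_sgn (cross (q.1 - s.foot i) (q.2 i - s.foot i))
  exact ⟨ε, sheet_eq hq hε⟩

/-- The gluing rule of the eight sheets: a sign enters the position of its elbow only through the
product with the square root of the discriminant of the leg. -/
theorem sheet_eq_sheet {x : Plane} (hx : x ∈ s.workspace) {ε ε' : Fin 3 → Bool} :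
    s.sheet ε x = s.sheet ε' x ↔ ∀ i, s.legDisc i x ≠ 0 → ε i = ε' i := by
  constructor
  · intro h i hi
    have h1 := cross_sheet hx ε i
    rw [h, cross_sheet hx ε' i] at h1
    have h2 : √(s.legDisc i x) ≠ 0 :=
      (Real.sqrt_pos.mpr (lt_of_le_of_ne (legDisc_nonneg hx i) (Ne.symm hi))).ne'
    exact (sgn_injective (mul_right_cancel₀ h2 h1)).symm
  · intro h
    refine Prod.ext rfl (funext fun i => apex_eq_of_mul_eq ?_)
    by_cases hi : s.legDisc i x = 0
    · change _ * √(s.legDisc i x) = _ * √(s.legDisc i x)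
      simp [hi]
    · rw [h i hi]

theorem continuousOn_sheet (ε : Fin 3 → Bool) : ContinuousOn (s.sheet ε) s.workspace := by
  intro x hx
  refine ContinuousAt.continuousWithinAt (continuousAt_id.prodMk (continuousAt_pi.mpr fun i => ?_))
  exact continuousAt_apex (ne_foot hx i)

/-- The sign patterns that count the positions over a point at which the legs in `A` are
aligned. -/
abbrev Signs (A : Finset (Fin 3)) : Type := {ε : Fin 3 → Bool // ∀ i ∈ A, ε i = true}

theorem card_signs (A : Finset (Fin 3)) : Fintype.card (Signs A) = 2 ^ (3 - A.card) := by
  revert A; decide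

/-- The legs that are stretched or folded when the centre is at `x`. -/
def aligned (s : Spider) (x : Plane) : Finset (Fin 3) := {i | s.legDisc i x = 0}

theorem mem_aligned {x : Plane} {i : Fin 3} : i ∈ s.aligned x ↔ s.legDisc i x = 0 := by
  simp [aligned]

/-- Reset the signs of the legs in `A`. -/
def Signs.reset (A : Finset (Fin 3)) (ε : Fin 3 → Bool) : Signs A :=
  ⟨fun i => if i ∈ A then true else ε i, fun i hi => by simp [hi]⟩

theorem sheet_reset {x : Plane} (hx : x ∈ s.workspace) {A : Finset (Fin 3)}
    (hA : A ⊆ s.aligned x) (ε : Fin 3 → Bool) :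
    s.sheet (Signs.reset A ε).1 x = s.sheet ε x := by
  rw [sheet_eq_sheet hx]
  intro i hi
  have : i ∉ A := fun h => hi (mem_aligned.mp (hA h))
  simp [Signs.reset, this]

theorem sheet_injective {x : Plane} (hx : x ∈ s.workspace) {A : Finset (Fin 3)}
    (hA : s.aligned x ⊆ A) {ε ε' : Signs A} (h : s.sheet ε.1 x = s.sheet ε'.1 x) : ε = ε' := by
  rw [sheet_eq_sheet hx] at h
  ext i
  by_cases hi : i ∈ A
  · rw [ε.2 i hi, ε'.2 i hi]
  · rw [h i fun h0 => hi (hA (mem_aligned.mpr h0))]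

/-- The positions with centre `x` are distinguished by the sides of the elbows that are not
aligned. -/
theorem ncard_fibre {x : Plane} (hx : x ∈ s.workspace) :
    {q | q ∈ s.configSpace ∧ q.1 = x}.ncard = 2 ^ (3 - (s.aligned x).card) := by
  have : {q | q ∈ s.configSpace ∧ q.1 = x} =
      Set.range fun ε : Signs (s.aligned x) => s.sheet ε.1 x := by
    ext q
    constructor
    · rintro ⟨hq, rfl⟩
      obtain ⟨ε, hε⟩ := exists_sheet hq
      exact ⟨Signs.reset _ ε, (sheet_reset hx subset_rfl ε).trans hε⟩
    · rintro ⟨ε, rfl⟩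
      exact ⟨sheet_mem hx _, rfl⟩
  rw [this, Set.ncard_range_of_injective fun ε ε' h => sheet_injective hx subset_rfl h,
    Nat.card_eq_fintype_card, card_signs]

theorem card_aligned_eq {x : Plane} {A : Finset (Fin 3)}
    (h : ∀ i, s.legDisc i x = 0 ↔ i ∈ A) : s.aligned x = A := by
  ext i; rw [mem_aligned, h]

end Spider


/-! ### The corners of the workspace, seen from the feet and the centre of gravity -/

/-- The reflection of `c` in the line spanned by `A`. -/
def mirror (A c : Plane) : Plane := (2 * dot c A / dot A A) • A - c

theorem dot_mirror_self {A : Plane} (hA : A ≠ 0) (c : Plane) :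
    dot (mirror A c) (mirror A c) = dot c c := by
  have h := (dot_self_pos.mpr hA).ne'
  unfold mirror
  generalize ht : dot A A = t at *
  simp only [dot, PiLp.sub_apply, PiLp.smul_apply, smul_eq_mul] at ht ⊢
  field_simp
  linear_combination (4 * (c 0 * A 0 + c 1 * A 1) ^ 2) * ht

theorem dot_mirror_axis {A : Plane} (hA : A ≠ 0) (c : Plane) : dot (mirror A c) A = dot c A := by
  have h := (dot_self_pos.mpr hA).ne'
  unfold mirror
  generalize ht : dot A A = t at *
  simp only [dot, PiLp.sub_apply, PiLp.smul_apply, smul_eq_mul] at ht ⊢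
  field_simp
  linear_combination (2 * (c 0 * A 0 + c 1 * A 1)) * ht

/-- The vector `c - mirror A c` is normal to `A` and proportional to `cross A c`. Hence comparing
the scalar products of `c` and of its mirror image with `B` decides whether `c` and `B` are on the
same side of the axis. -/
theorem dot_sub_dot_mirror {A : Plane} (hA : A ≠ 0) (c B : Plane) :
    dot A A * (dot c B - dot (mirror A c) B) = 2 * cross A c * cross A B := by
  have h := (dot_self_pos.mpr hA).ne'
  unfold mirror
  generalize ht : dot A A = t at *
  simp only [dot, cross, PiLp.sub_apply, PiLp.smul_apply, smul_eq_mul] at ht ⊢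
  field_simp
  linear_combination (-2 * (c 0 * B 0 + c 1 * B 1)) * ht

/-- Of two vectors of equal length on one side of the axis, the one with the smaller component along
`A` makes the larger angle with `A`. So `c` turns towards `y` in the same sense as towards `A`. -/
theorem cross_mul_cross_pos {A c y : Plane} (h : 0 < cross A c * cross A y)
    (hn : dot c c = dot y y) (hd : dot c A < dot y A) : 0 < cross c y * cross c A := by
  have hA : A ≠ 0 := by rintro rfl; simp [cross] at h
  have ht := dot_self_pos.mpr hA
  have e1 : dot A A * (cross c y * cross c A) =
      cross A c * (cross A c * dot y A) - cross A c * cross A y * dot c A := by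
    simp only [dot, cross]; ring
  have e2 : dot c A ^ 2 + cross A c ^ 2 = dot y A ^ 2 + cross A y ^ 2 := by
    have f1 : dot c A ^ 2 + cross A c ^ 2 = dot A A * dot c c := by simp only [dot, cross]; ring
    have f2 : dot y A ^ 2 + cross A y ^ 2 = dot A A * dot y y := by simp only [dot, cross]; ring
    rw [f1, f2, hn]
  refine pos_of_mul_pos_right (a := dot A A) ?_ ht.le
  rw [e1]
  generalize cross A c = q at *
  generalize cross A y = q' at *
  generalize dot c A = p at *
  generalize dot y A = p' at *
  have hq : 0 < q ^ 2 := by have : q ≠ 0 := (by rintro rfl; simp at h); positivity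
  have hq' : 0 < q' ^ 2 := by have : q' ≠ 0 := (by rintro rfl; simp at h); positivity
  -- Here `(p, q)` and `(p', q')` lie on one circle, `p < p'`, and `q`, `q'` have the same sign. The
  -- claim is `q * q' * p < q ^ 2 * p'`; the signs of `p` and `p'` decide which of `q ^ 2`, `q' ^ 2`
  -- is larger.
  rcases le_or_gt p 0 with hp | hp
  · rcases le_or_gt 0 p' with hp' | hp'
    · rcases hp'.eq_or_lt with h0 | h0
      · subst h0; nlinarith
      · nlinarith [mul_pos hq h0]
    · have hlt : q ^ 2 < q' ^ 2 := by nlinarith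
      have : q ^ 2 < q * q' := by nlinarith [mul_pos hq hq']
      nlinarith
  · have hlt : q' ^ 2 < q ^ 2 := by nlinarith
    have : q * q' < q ^ 2 := by nlinarith [mul_pos hq hq']
    nlinarith

theorem cross_smul_right (v w : Plane) (r : ℝ) : cross v (r • w) = r * cross v w := by
  simp [cross]; ring

theorem dot_smul_right (v w : Plane) (r : ℝ) : dot v (r • w) = r * dot v w := by
  simp [dot]; ring

namespace Spider

variable {s : Spider}

theorem three_mul_centroid {i j k : Fin 3} (hij : i ≠ j) (hki : k ≠ i) (hkj : k ≠ j) (n : Fin 2) :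
    3 * s.centroid n = s.foot i n + s.foot j n + s.foot k n := by
  have h : ∑ m, s.foot m n = s.foot i n + s.foot j n + s.foot k n := by
    have : (Finset.univ : Finset (Fin 3)) = {i, j, k} := by revert i j k; decide
    rw [this, Finset.sum_insert (by simp [hij, hki.symm]), Finset.sum_pair hkj.symm]; ring
  rw [← h, centroid]
  simp

/-- Comparison of distances on a circle around foot `i`. -/
theorem dot_lt_dot_of_dist_lt {a b x y : Plane} (hxy : dist x a = dist y a)
    (h : dist x b < dist y b) : dot (y - a) (b - a) < dot (x - a) (b - a) := by
  have h1 : dist x b ^ 2 < dist y b ^ 2 := by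
    have : 0 ≤ dist x b := dist_nonneg
    nlinarith
  have h2 : dist x a ^ 2 = dist y a ^ 2 := by rw [hxy]
  rw [dist_sq_eq_dot, dist_sq_eq_dot] at h1 h2
  simp only [dot, PiLp.sub_apply] at *
  linarith

theorem dot_le_dot_of_dist_le {a b x y : Plane} (hxy : dist x a = dist y a)
    (h : dist x b ≤ dist y b) : dot (y - a) (b - a) ≤ dot (x - a) (b - a) := by
  have h1 : dist x b ^ 2 ≤ dist y b ^ 2 := by
    have : 0 ≤ dist x b := dist_nonneg
    nlinarith
  have h2 : dist x a ^ 2 = dist y a ^ 2 := by rw [hxy]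
  rw [dist_sq_eq_dot, dist_sq_eq_dot] at h1 h2
  simp only [dot, PiLp.sub_apply] at *
  linarith

theorem exitPoint_sub (s : Spider) (i : Fin 3) : s.exitPoint i - s.foot i =
    (s.outer i / dist s.centroid (s.foot i)) • (s.centroid - s.foot i) := by
  rw [exitPoint, add_sub_cancel_left]

namespace IsThreeHoledTriangle

variable (hs : s.IsThreeHoledTriangle)

include hs

theorem foot_ne {i j : Fin 3} (h : i ≠ j) : s.foot i ≠ s.foot j := by
  have := hs.holes_disjoint i j h
  have := s.inner_pos i
  have := s.inner_pos j
  rw [← dist_pos]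
  linarith

theorem foot_sub_ne {i j : Fin 3} (h : i ≠ j) : s.foot j - s.foot i ≠ 0 :=
  sub_ne_zero.mpr (hs.foot_ne h.symm)

theorem centroid_lt_outer (i : Fin 3) : dist s.centroid (s.foot i) < s.outer i := by
  have h : s.centroid ∈ interior (Metric.closedBall (s.foot i) (s.outer i)) :=
    interior_mono (fun x hx => (hx i).2) hs.centroid_mem
  rwa [interior_closedBall _ (s.outer_pos i).ne'] at h

theorem inner_lt_centroid (i : Fin 3) : s.inner i < dist s.centroid (s.foot i) := by
  have h : s.centroid ∈ interior (Metric.ball (s.foot i) (s.inner i))ᶜ :=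
    interior_mono (fun x hx => by simpa using (hx i).1) hs.centroid_mem
  rw [interior_compl, closure_ball _ (s.inner_pos i).ne'] at h
  simpa using h

theorem centroid_mem_workspace : s.centroid ∈ s.workspace := interior_subset hs.centroid_mem

theorem dist_centroid_pos (i : Fin 3) : 0 < dist s.centroid (s.foot i) :=
  (s.inner_pos i).trans (hs.inner_lt_centroid i)

/-- A point of an outer circle lies outside of the other inner discs. -/
theorem inner_lt_of_outer {i j : Fin 3} (h : i ≠ j) {x : Plane}
    (hx : dist x (s.foot i) = s.outer i) : s.inner j < dist x (s.foot j) := by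
  have h1 := hs.holes_inside j i h.symm
  have h2 := dist_triangle x (s.foot j) (s.foot i)
  linarith

/-- A point of an inner circle lies outside of the other inner discs. -/
theorem inner_lt_of_inner {i j : Fin 3} (h : i ≠ j) {x : Plane}
    (hx : dist x (s.foot i) = s.inner i) : s.inner j < dist x (s.foot j) := by
  have h1 := hs.holes_disjoint i j h
  have h2 := dist_triangle (s.foot i) x (s.foot j)
  rw [dist_comm (s.foot i) x] at h2
  linarith

/-- A point of an inner circle lies inside the other outer circles. -/
theorem lt_outer_of_inner {i j : Fin 3} (h : i ≠ j) {x : Plane}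
    (hx : dist x (s.foot i) = s.inner i) : dist x (s.foot j) < s.outer j := by
  have h1 := hs.holes_inside i j h
  have h2 := dist_triangle x (s.foot i) (s.foot j)
  linarith

theorem dist_exitPoint (i : Fin 3) : dist (s.exitPoint i) (s.foot i) = s.outer i := by
  have h := hs.dist_centroid_pos i
  rw [exitPoint, dist_eq_norm, add_sub_cancel_left, norm_smul, ← dist_eq_norm,
    Real.norm_of_nonneg (div_pos (s.outer_pos i) h).le]
  field_simp

/-- Two outer circles meet transversally. -/
theorem cross_ne_zero {i j : Fin 3} (h : i ≠ j) {x : Plane} (hi : dist x (s.foot i) = s.outer i)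
    (hj : dist x (s.foot j) = s.outer j) :
    cross (s.foot j - s.foot i) (x - s.foot i) ≠ 0 := by
  have h1 := disc_eq_cross_sq (a := s.foot i) (b := s.foot j) (p := x)
    ((dist_eq_iff_dot (s.outer_pos i).le).mp hi) (M := s.outer j ^ 2)
    (by rw [← dist_sq_eq_dot, dist_comm, hj])
  rw [← dist_sq_eq_dot] at h1
  have h2 := four_mul_disc (dist (s.foot j) (s.foot i)) (s.outer i) (s.outer j)
  have h3 := hs.exits i j h
  have h4 := hs.exits j i h.symm
  have h5 := hs.holes_inside i j h
  have h5' := hs.holes_inside j i h.symm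
  -- The exit point of leg `i` is on circle `i` and inside circle `j`, so `outer i - outer j` is
  -- less than the distance of the feet; likewise with `i` and `j` exchanged. As `holes_inside`
  -- makes that distance less than `outer i + outer j`, both factors in Heron's formula are
  -- positive.
  have h6 := dist_triangle (s.exitPoint i) (s.foot j) (s.foot i)
  have h7 := dist_triangle (s.exitPoint j) (s.foot i) (s.foot j)
  rw [hs.dist_exitPoint] at h6 h7
  rw [dist_comm (s.foot i) (s.foot j)] at h7 h5
  have := s.inner_pos i
  have := s.inner_pos j
  intro h0
  rw [h0] at h1
  rw [h1] at h2
  have h8 : 0 < (s.outer i + s.outer j) ^ 2 - dist (s.foot j) (s.foot i) ^ 2 := by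
    have : 0 ≤ dist (s.foot j) (s.foot i) := dist_nonneg
    nlinarith
  have h9 : 0 < dist (s.foot j) (s.foot i) ^ 2 - (s.outer i - s.outer j) ^ 2 := by
    have : 0 ≤ dist (s.foot j) (s.foot i) := dist_nonneg
    nlinarith
  nlinarith [mul_pos h8 h9]

/-- The mirror image of a corner in the line through two feet is not in the workspace. -/
theorem outer_lt_mirror {i j k : Fin 3} (h : i ≠ j) (hki : k ≠ i) (hkj : k ≠ j) {c : Plane}
    (hc : c ∈ s.workspace) (hi : dist c (s.foot i) = s.outer i)
    (hj : dist c (s.foot j) = s.outer j) :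
    s.outer k < dist (s.foot i + mirror (s.foot j - s.foot i) (c - s.foot i)) (s.foot k) := by
  by_contra hle
  rw [not_lt] at hle
  have hA := hs.foot_sub_ne h
  set c' := s.foot i + mirror (s.foot j - s.foot i) (c - s.foot i) with hc'
  have hi' : dist c' (s.foot i) = s.outer i := by
    rw [dist_eq_iff_dot (s.outer_pos i).le, hc', add_sub_cancel_left, dot_mirror_self hA]
    exact (dist_eq_iff_dot (s.outer_pos i).le).mp hi
  have hj' : dist c' (s.foot j) = s.outer j := by
    have e : ∀ v w : Plane, dot (v - w) (v - w) = dot v v + dot w w - 2 * dot v w := by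
      intro v w; simp only [dot, PiLp.sub_apply]; ring
    have e2 : ∀ x : Plane, dot (x - s.foot j) (x - s.foot j) =
        dot (x - s.foot i) (x - s.foot i) + dot (s.foot j - s.foot i) (s.foot j - s.foot i) -
          2 * dot (x - s.foot i) (s.foot j - s.foot i) := by
      intro x; rw [← e, sub_sub_sub_cancel_right]
    rw [dist_eq_iff_dot (s.outer_pos j).le] at hj ⊢
    rw [e2] at hj ⊢
    rw [hc', add_sub_cancel_left, dot_mirror_self hA, dot_mirror_axis hA]
    exact hj
  have hmem : c' ∈ s.workspace := by
    intro n
    by_cases hn : n = k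
    · subst hn; exact ⟨(hs.inner_lt_of_outer hki.symm hi').le, hle⟩
    · by_cases hn' : n = i
      · subst hn'; exact ⟨hi'.symm ▸ (s.inner_lt_outer n).le, hi'.le⟩
      · have : n = j := by omega
        subst this; exact ⟨hj'.symm ▸ (s.inner_lt_outer n).le, hj'.le⟩
  -- By uniqueness of the corner `c` would be its own mirror image and thus lie on the line through
  -- the feet. Testing against the normal of this line contradicts transversality.
  have heq := (hs.corners i j h).unique ⟨hmem, hi', hj'⟩ ⟨hc, hi, hj⟩
  have h0 := dot_sub_dot_mirror hA (c - s.foot i) (rot (s.foot j - s.foot i))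
  have h1 : mirror (s.foot j - s.foot i) (c - s.foot i) = c - s.foot i := by
    exact eq_sub_of_add_eq' (hc'.symm.trans heq)
  rw [h1, sub_self, mul_zero] at h0
  have h2 : cross (s.foot j - s.foot i) (rot (s.foot j - s.foot i)) =
      dot (s.foot j - s.foot i) (s.foot j - s.foot i) := by
    simp only [cross, dot, rot_zero, rot_one]; ring
  rw [h2] at h0
  have h3 := (dot_self_pos.mpr hA).ne'
  have h4 := hs.cross_ne_zero h hi hj
  rcases mul_eq_zero.mp h0.symm with h5 | h5
  · exact h4 (by linarith)
  · exact h3 h5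

theorem dist_mirror {i j : Fin 3} (h : i ≠ j) (c : Plane) :
    dist (s.foot i + mirror (s.foot j - s.foot i) (c - s.foot i)) (s.foot i) =
      dist c (s.foot i) := by
  rw [dist_eq_iff_dot dist_nonneg, add_sub_cancel_left, dot_mirror_self (hs.foot_sub_ne h),
    dist_sq_eq_dot]

/-- A corner and the centre of gravity lie on the same side of the line through two feet. -/
theorem corner_same_side {i j : Fin 3} (h : i ≠ j) {c : Plane}
    (hc : c ∈ s.workspace) (hi : dist c (s.foot i) = s.outer i)
    (hj : dist c (s.foot j) = s.outer j) :
    0 < cross (s.foot j - s.foot i) (c - s.foot i) *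
      cross (s.foot j - s.foot i) (s.centroid - s.foot i) := by
  obtain ⟨k, hki, hkj, -⟩ := exists_third h
  have hA := hs.foot_sub_ne h
  have h1 := dot_lt_dot_of_dist_lt (hs.dist_mirror h c).symm
    ((hc k).2.trans_lt (hs.outer_lt_mirror h hki hkj hc hi hj))
  rw [add_sub_cancel_left] at h1
  have h2 := dot_sub_dot_mirror hA (c - s.foot i) (s.foot k - s.foot i)
  have h3 := dot_self_pos.mpr hA
  -- Feet `i` and `j` are on the line, so the third foot has three times the signed distance of the
  -- centre of gravity.
  have h4 : cross (s.foot j - s.foot i) (s.foot k - s.foot i) =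
      3 * cross (s.foot j - s.foot i) (s.centroid - s.foot i) := by
    have e0 := three_mul_centroid (s := s) h hki hkj 0
    have e1 := three_mul_centroid (s := s) h hki hkj 1
    simp only [cross, PiLp.sub_apply]
    linear_combination -(s.foot j 0 - s.foot i 0) * e1 + (s.foot j 1 - s.foot i 1) * e0
  rw [h4] at h2
  have := mul_pos h3 (sub_pos.mpr h1)
  linarith

theorem exit_ratio_pos (i : Fin 3) : 0 < s.outer i / dist s.centroid (s.foot i) :=
  div_pos (s.outer_pos i) (hs.dist_centroid_pos i)

/-- Along the outer circle of leg `i` the energy increases towards a corner. -/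
theorem corner_cone {i j : Fin 3} (h : i ≠ j) {c : Plane}
    (hc : c ∈ s.workspace) (hi : dist c (s.foot i) = s.outer i)
    (hj : dist c (s.foot j) = s.outer j) :
    0 < cross (c - s.foot i) (s.centroid - s.foot i) *
      cross (c - s.foot i) (s.foot j - s.foot i) := by
  have h1 := hs.corner_same_side h hc hi hj
  have hr := hs.exit_ratio_pos i
  have h2 : dist (s.exitPoint i) (s.foot i) = dist c (s.foot i) := by rw [hs.dist_exitPoint, hi]
  have h3 := dot_lt_dot_of_dist_lt h2 ((hs.exits i j h).trans_eq hj.symm)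
  have h4 : dot (c - s.foot i) (c - s.foot i) =
      dot (s.exitPoint i - s.foot i) (s.exitPoint i - s.foot i) := by
    rw [← dist_sq_eq_dot, ← dist_sq_eq_dot, h2]
  -- The corner and the exit point lie on circle `i`, on one side of the line through the feet, and
  -- the corner is farther from foot `j`. So the turn from the corner to the exit point, hence to
  -- the centre of gravity, goes towards foot `j`.
  have h5 := cross_mul_cross_pos (A := s.foot j - s.foot i) (c := c - s.foot i)
    (y := s.exitPoint i - s.foot i) (by
      rw [s.exitPoint_sub, cross_smul_right]
      nlinarith [mul_pos hr h1]) h4 h3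
  rw [s.exitPoint_sub, cross_smul_right, mul_assoc] at h5
  exact pos_of_mul_pos_right h5 hr.le

/-- No point of the workspace lies on all outer circles. -/
theorem lt_outer_of_corner {i j k : Fin 3} (h : i ≠ j) (hki : k ≠ i) (hkj : k ≠ j) {c : Plane}
    (hc : c ∈ s.workspace) (hi : dist c (s.foot i) = s.outer i)
    (hj : dist c (s.foot j) = s.outer j) : dist c (s.foot k) < s.outer k := by
  refine lt_of_le_of_ne (hc k).2 fun hk => ?_
  have h1 := hs.corner_cone h hc hi hj
  have h2 := hs.corner_cone hki.symm hc hi hk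
  have h3 := hs.corner_cone h.symm hc hj hi
  have h4 := hs.corner_cone hkj.symm hc hj hk
  have h5 := hs.corner_cone hki hc hk hi
  have h6 := hs.corner_cone hkj hc hk hj
  have key2 : ∀ i j : Fin 3, cross (c - s.foot i) (s.foot j - s.foot i) =
      -cross (c - s.foot i) (c - s.foot j) := by
    intro i j
    simp only [cross, PiLp.sub_apply]; ring
  rw [key2] at h1 h2 h3 h4 h5 h6
  have a1 : cross (c - s.foot j) (c - s.foot i) = -cross (c - s.foot i) (c - s.foot j) := by
    simp only [cross]; ring
  have a2 : cross (c - s.foot k) (c - s.foot j) = -cross (c - s.foot j) (c - s.foot k) := by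
    simp only [cross]; ring
  have a3 : cross (c - s.foot i) (c - s.foot k) = -cross (c - s.foot k) (c - s.foot i) := by
    simp only [cross]; ring
  rw [a3] at h2
  rw [a1] at h3
  rw [a2] at h6
  generalize cross (c - s.foot i) (c - s.foot j) = x at *
  generalize cross (c - s.foot j) (c - s.foot k) = y at *
  generalize cross (c - s.foot k) (c - s.foot i) = w at *
  generalize cross (c - s.foot i) (s.centroid - s.foot i) = u1 at *
  generalize cross (c - s.foot j) (s.centroid - s.foot j) = u2 at *
  generalize cross (c - s.foot k) (s.centroid - s.foot k) = u3 at *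
  -- The cone conditions for the six ordered pairs of legs say that the cyclic determinants `x`,
  -- `y`, `w` have pairwise opposite signs, which is impossible for three numbers.
  have aux : ∀ {u a b : ℝ}, 0 < u * a → 0 < u * b → 0 < a * b := fun {u a b} ha hb =>
    pos_of_mul_pos_right (a := u * u) (by nlinarith [mul_pos ha hb]) (mul_self_nonneg u)
  have b1 := aux h1 h2
  have b2 := aux h3 h4
  have b3 := aux h5 h6
  nlinarith [mul_pos b1 b2, mul_nonneg (sq_nonneg x) b3.le]

/-- The point of an outer circle that is opposite to the exit point is not in the workspace. -/
theorem antipode_notMem {i : Fin 3} {x : Plane} (hx : x ∈ s.workspace)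
    (hi : dist x (s.foot i) = s.outer i)
    (h : x - s.foot i = -(s.exitPoint i - s.foot i)) : False := by
  obtain ⟨j, hij⟩ : ∃ j, i ≠ j := ⟨i + 1, by clear h hi; revert i; decide⟩
  obtain ⟨k, hki, hkj, -⟩ := exists_third hij
  obtain ⟨c, ⟨hc, hci, hcj⟩, -⟩ := hs.corners i j hij
  have hA := hs.foot_sub_ne hij
  have hm := hs.dist_mirror hij c
  -- Compare `x` with the mirror image of a corner on the same circle: `x` is nearer to foot `k` and
  -- no farther from foot `j`. Adding both comparisons, `x` has the strictly larger component in the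
  -- direction of the centre of gravity, although the antipode of the exit point has the least one
  -- on the circle.
  have h1 := dot_lt_dot_of_dist_lt (hi.trans (hci.symm.trans hm.symm))
    ((hx k).2.trans_lt (hs.outer_lt_mirror hij hki hkj hc hci hcj))
  have h2 := dot_le_dot_of_dist_le (hi.trans hci.symm) ((hx j).2.trans hcj.ge)
  rw [add_sub_cancel_left] at h1
  rw [← dot_mirror_axis hA] at h2
  have hm2 : dot (mirror (s.foot j - s.foot i) (c - s.foot i))
      (mirror (s.foot j - s.foot i) (c - s.foot i)) = s.outer i ^ 2 := by
    rw [dot_mirror_self hA, ← dist_sq_eq_dot, hci]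
  have hr := hs.exit_ratio_pos i
  rw [s.exitPoint_sub] at h
  generalize mirror (s.foot j - s.foot i) (c - s.foot i) = v at *
  have e0 := three_mul_centroid (s := s) hij hki hkj 0
  have e1 := three_mul_centroid (s := s) hij hki hkj 1
  have hsum : ∀ w : Plane, dot w (s.foot j - s.foot i) + dot w (s.foot k - s.foot i) =
      3 * dot w (s.centroid - s.foot i) := by
    intro w
    simp only [dot, PiLp.sub_apply]
    linear_combination -w 0 * e0 - w 1 * e1
  have h3 : dot v (s.centroid - s.foot i) < dot (x - s.foot i) (s.centroid - s.foot i) := by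
    have := hsum v
    have := hsum (x - s.foot i)
    linarith
  have hd := hs.dist_centroid_pos i
  have hz := dist_sq_eq_dot s.centroid (s.foot i)
  rw [h] at h3
  have h4 : dot (-((s.outer i / dist s.centroid (s.foot i)) • (s.centroid - s.foot i)))
      (s.centroid - s.foot i) = -(s.outer i * dist s.centroid (s.foot i)) := by
    have : ∀ (r : ℝ) (w : Plane), dot (-(r • w)) w = -(r * dot w w) := by
      intro r w; simp [dot]; ring
    rw [this, ← hz]
    field_simp
  rw [h4] at h3
  have h5 := dot_sq_le v (s.centroid - s.foot i)
  rw [hm2, ← hz] at h5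
  have := s.outer_pos i
  nlinarith [mul_pos this hd]

end IsThreeHoledTriangle

end Spider


/-! ### Unit vectors; charts by the centre and by the angles of the bars -/

/-- The unit vector with a given angle. -/
def dir (θ : ℝ) : Plane := !₂[Real.cos θ, Real.sin θ]

@[simp] theorem dir_zero (θ : ℝ) : dir θ 0 = Real.cos θ := rfl
@[simp] theorem dir_one (θ : ℝ) : dir θ 1 = Real.sin θ := rfl

theorem dot_dir_self (θ : ℝ) : dot (dir θ) (dir θ) = 1 := by
  simp only [dot, dir_zero, dir_one]; linear_combination Real.cos_sq_add_sin_sq θ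

theorem cross_dir (α β : ℝ) : cross (dir α) (dir β) = Real.sin (β - α) := by
  rw [Real.sin_sub]; simp only [cross, dir_zero, dir_one]; ring

theorem dot_dir (α β : ℝ) : dot (dir α) (dir β) = Real.cos (β - α) := by
  rw [Real.cos_sub]; simp only [dot, dir_zero, dir_one]; ring

theorem contDiff_dir : ContDiff ℝ ∞ dir := by
  rw [contDiff_euclidean]
  intro i
  fin_cases i
  · exact Real.contDiff_cos
  · exact Real.contDiff_sin

theorem continuous_dir : Continuous dir := contDiff_dir.continuous

theorem exists_dir {w : Plane} (hw : dot w w = 1) : ∃ θ, dir θ = w := by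
  have h : ‖(⟨w 0, w 1⟩ : ℂ)‖ = 1 := by
    rw [← sq_eq_sq₀ (norm_nonneg _) zero_le_one, Complex.sq_norm, Complex.normSq_mk, one_pow]
    exact hw
  have hne : (⟨w 0, w 1⟩ : ℂ) ≠ 0 := by rw [← norm_ne_zero_iff, h]; exact one_ne_zero
  refine ⟨Complex.arg ⟨w 0, w 1⟩, plane_ext ?_ ?_⟩
  · rw [dir_zero, Complex.cos_arg hne, h, div_one]
  · rw [dir_one, Complex.sin_arg, h, div_one]

theorem exists_smul_dir {w : Plane} {r : ℝ} (hr : 0 < r) (hw : dot w w = r ^ 2) :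
    ∃ θ, w = r • dir θ := by
  obtain ⟨θ, hθ⟩ := exists_dir (w := r⁻¹ • w) (by
    simp only [dot, PiLp.smul_apply, smul_eq_mul] at hw ⊢
    field_simp
    linear_combination hw)
  exact ⟨θ, by rw [hθ, smul_inv_smul₀ hr.ne']⟩

theorem abs_lt_one_of_sq_add_sq {a b : ℝ} (h : a ^ 2 + b ^ 2 = 1) (ha : 0 < a) : |b| < 1 := by
  rw [abs_lt]; constructor <;> nlinarith

/-- The sine determines an angle between `-π/2` and `π/2`. -/
theorem sin_cos_arcsin {a b : ℝ} (h : a ^ 2 + b ^ 2 = 1) (ha : 0 < a) :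
    Real.sin (Real.arcsin b) = b ∧ Real.cos (Real.arcsin b) = a := by
  obtain ⟨h1, h2⟩ := abs_lt.mp (abs_lt_one_of_sq_add_sq h ha)
  refine ⟨Real.sin_arcsin h1.le h2.le, ?_⟩
  rw [Real.cos_arcsin, ← h, add_sub_cancel_right, Real.sqrt_sq ha.le]

/-- In the open half plane around `dir θ` the deviation from `θ` is less than a right angle, so its
sine determines it. This is the inverse of the angle coordinates. -/
theorem dir_add_arcsin {θ : ℝ} {w : Plane} (hw : dot w w = 1) (h : 0 < dot (dir θ) w) :
    dir (θ + Real.arcsin (cross (dir θ) w)) = w := by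
  have h1 : dot (dir θ) w ^ 2 + cross (dir θ) w ^ 2 = 1 := by
    have : dot (dir θ) w ^ 2 + cross (dir θ) w ^ 2 = dot (dir θ) (dir θ) * dot w w := by
      simp only [dot, cross]; ring
    rw [this, dot_dir_self, hw, one_mul]
  obtain ⟨h2, h3⟩ := sin_cos_arcsin h1 h
  have h4 := Real.cos_sq_add_sin_sq θ
  apply plane_ext
  · rw [dir_zero, Real.cos_add, h2, h3]
    simp only [dot, cross, dir_zero, dir_one]
    linear_combination w 0 * h4
  · rw [dir_one, Real.sin_add, h2, h3]
    simp only [dot, cross, dir_zero, dir_one]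
    linear_combination w 1 * h4

theorem dir_add_arcsin' {θ r : ℝ} (hr : 0 < r) {w : Plane} (hw : dot w w = r ^ 2)
    (h : 0 < dot (dir θ) w) : r • dir (θ + Real.arcsin (cross (dir θ) w / r)) = w := by
  have e1 : cross (dir θ) w / r = cross (dir θ) (r⁻¹ • w) := by
    rw [cross_smul_right, div_eq_inv_mul]
  rw [e1, dir_add_arcsin, smul_inv_smul₀ hr.ne']
  · simp only [dot, PiLp.smul_apply, smul_eq_mul] at hw ⊢
    field_simp
    linear_combination hw
  · rw [dot_smul_right]; positivity

theorem abs_cross_div_lt_one {θ r : ℝ} (hr : 0 < r) {w : Plane} (hw : dot w w = r ^ 2)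
    (h : 0 < dot (dir θ) w) : |cross (dir θ) w / r| < 1 := by
  refine abs_lt_one_of_sq_add_sq (a := dot (dir θ) w / r) ?_ (by positivity)
  have : dot (dir θ) w ^ 2 + cross (dir θ) w ^ 2 = dot (dir θ) (dir θ) * dot w w := by
    simp only [dot, cross]; ring
  rw [dot_dir_self, hw] at this
  field_simp
  linarith

namespace Spider

variable {s : Spider}

theorem legDisc_pos_iff {i : Fin 3} {x : Plane} : 0 < s.legDisc i x ↔
    s.inner i ^ 2 < s.sqDist i x ∧ s.sqDist i x < s.outer i ^ 2 := by
  have h4 := s.four_mul_legDisc i x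
  have h1 := s.inner_pos i
  have h2 := s.inner_lt_outer i
  have h3 : s.inner i ^ 2 < s.outer i ^ 2 := by nlinarith
  constructor
  · intro h
    have h5 : 0 < (s.outer i ^ 2 - s.sqDist i x) * (s.sqDist i x - s.inner i ^ 2) := by linarith
    rcases mul_pos_iff.mp h5 with h6 | h6
    · constructor <;> linarith
    · linarith
  · rintro ⟨h5, h6⟩
    nlinarith [mul_pos (sub_pos.mpr h6) (sub_pos.mpr h5)]

theorem ne_foot_of_legDisc_pos {i : Fin 3} {x : Plane} (h : 0 < s.legDisc i x) :
    x ≠ s.foot i := by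
  rintro rfl
  have := (legDisc_pos_iff.mp h).1
  simp only [sqDist, sub_self] at this
  have h0 : dot (0 : Plane) 0 = 0 := by simp [dot]
  rw [h0] at this
  exact absurd this (not_lt.mpr (sq_nonneg _))

theorem legDisc_pos {x : Plane} (hx : x ∈ s.workspace) {i : Fin 3} (h : s.legDisc i x ≠ 0) :
    0 < s.legDisc i x :=
  lt_of_le_of_ne (legDisc_nonneg hx i) (Ne.symm h)

theorem elbow_spec {i : Fin 3} {x : Plane} (h : 0 < s.legDisc i x) (b : Bool) :
    dot (s.elbow i b x - s.foot i) (s.elbow i b x - s.foot i) = s.lower i ^ 2 ∧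
    dot (x - s.elbow i b x) (x - s.elbow i b x) = s.upper i ^ 2 ∧
    0 < sgn b * cross (x - s.foot i) (s.elbow i b x - s.foot i) := by
  have hne := ne_foot_of_legDisc_pos h
  refine ⟨dot_apex_sub_left hne h.le (sgn_sq _), dot_apex_sub_right hne h.le (sgn_sq _), ?_⟩
  rw [elbow, cross_apex hne, ← mul_assoc, sgn_mul_self, one_mul]
  exact Real.sqrt_pos.mpr h

theorem contDiffAt_elbow {F : Type*} [NormedAddCommGroup F] [NormedSpace ℝ F] {i : Fin 3}
    {f : F → Plane} {u : F} (hf : ContDiffAt ℝ ∞ f u) (h : 0 < s.legDisc i (f u)) (b : Bool) :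
    ContDiffAt ℝ ∞ (fun v => s.elbow i b (f v)) u :=
  contDiffAt_apex hf contDiffAt_const contDiffAt_const (ne_foot_of_legDisc_pos h) h

@[fun_prop] theorem continuous_legDisc (i : Fin 3) : Continuous (s.legDisc i) := by
  unfold legDisc sqDist disc; fun_prop

theorem exists_sgn_pos {r : ℝ} (hr : r ≠ 0) : ∃ b, 0 < sgn b * r := by
  obtain ⟨b, hb⟩ := exists_sgn r
  exact ⟨b, lt_of_le_of_ne hb (mul_ne_zero (sgn_ne_zero b) hr).symm⟩

theorem cross_ne_zero_of_legDisc {q : Position} (hq : q ∈ s.configSpace) {i : Fin 3}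
    (h : s.legDisc i q.1 ≠ 0) : cross (q.1 - s.foot i) (q.2 i - s.foot i) ≠ 0 := by
  rw [legDisc_eq_cross_sq hq] at h
  exact fun h0 => h (by rw [h0]; simp)

/-- Where no leg is aligned, the centre is a local coordinate. -/
theorem exists_chart_centre {q : Position} (hq : q ∈ s.configSpace)
    (h : ∀ i, s.legDisc i q.1 ≠ 0) :
    ∃ (U : Set Plane) (φ : Plane → Position), IsLocalParam s.configSpace U φ ∧ q.1 ∈ U ∧
      φ q.1 = q ∧ ∀ v, (φ v).1 = v := by
  choose ε hε using fun i => exists_sgn_pos (cross_ne_zero_of_legDisc hq (h i))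
  have hW := s.fst_mem_workspace hq
  have key : ∀ x, (∀ i, 0 < s.legDisc i x) → s.sheet ε x ∈ s.configSpace := fun x hx =>
    s.mem_configSpace.mpr fun i => ⟨(elbow_spec (hx i) (ε i)).1, (elbow_spec (hx i) (ε i)).2.1⟩
  refine ⟨{x | ∀ i, 0 < s.legDisc i x}, s.sheet ε, ?_, fun i => legDisc_pos hW (h i),
    sheet_eq hq fun i => (hε i).le, fun v => rfl⟩
  -- The open set `V` isolates the sheet `ε`, on which the projection to the centre is inverse to
  -- the parametrization.
  refine IsLocalParam.of_leftInverse (ψ := Prod.fst)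
    (V := {q | ∀ i, 0 < sgn (ε i) * cross (q.1 - s.foot i) (q.2 i - s.foot i)}) ?_ ?_ ?_
    (fun _ _ => differentiableAt_fst) ?_ (fun _ _ => rfl) ?_
  · rw [Set.ofPred_forall]
    exact isOpen_iInter_of_finite fun i => isOpen_lt continuous_const (continuous_legDisc i)
  · rw [Set.ofPred_forall]
    exact isOpen_iInter_of_finite fun i => isOpen_lt continuous_const (by fun_prop)
  · intro x hx
    exact (contDiffAt_id.prodMk (contDiffAt_pi.mpr fun i =>
      contDiffAt_elbow contDiffAt_id (hx i) _)).contDiffWithinAt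
  · exact fun x hx => ⟨key x hx, fun i => (elbow_spec (hx i) (ε i)).2.2⟩
  · exact fun p hp _ => sheet_eq hp.1 fun i => (hp.2 i).le

/-- The position with given angles of the bars of leg `i`. -/
def anglePos (s : Spider) (i : Fin 3) (ε : Fin 3 → Bool) (u : Plane) : Position :=
  (s.foot i + s.lower i • dir (u 0) + s.upper i • dir (u 1), fun j =>
    if j = i then s.foot i + s.lower i • dir (u 0)
    else s.elbow j (ε j) (s.foot i + s.lower i • dir (u 0) + s.upper i • dir (u 1)))

theorem contDiff_dir_apply (n : Fin 2) : ContDiff ℝ ∞ fun u : Plane => dir (u n) :=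
  contDiff_dir.comp (contDiff_plane_apply n)

/-- Where at most leg `i` is aligned, the angles of its bars are local coordinates. -/
theorem exists_chart_angles {q : Position} (hq : q ∈ s.configSpace) {i : Fin 3}
    (h : ∀ j, j ≠ i → s.legDisc j q.1 ≠ 0) :
    ∃ (U : Set Plane) (φ : Plane → Position) (u : Plane), IsLocalParam s.configSpace U φ ∧
      u ∈ U ∧ φ u = q ∧
      ∀ v, (φ v).1 = s.foot i + s.lower i • dir (v 0) + s.upper i • dir (v 1) := by
  have hW := s.fst_mem_workspace hq
  have hl := s.lower_pos i
  have hm := s.upper_pos i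
  obtain ⟨α, hα⟩ := exists_smul_dir hl (s.mem_configSpace.mp hq i).1
  obtain ⟨β, hβ⟩ := exists_smul_dir hm (s.mem_configSpace.mp hq i).2
  choose ε hε using fun j =>
    exists_sgn (cross (q.1 - s.foot j) (q.2 j - s.foot j))
  have hε' : ∀ j, j ≠ i → 0 < sgn (ε j) * cross (q.1 - s.foot j) (q.2 j - s.foot j) := fun j hj =>
    lt_of_le_of_ne (hε j) (mul_ne_zero (sgn_ne_zero _) (cross_ne_zero_of_legDisc hq (h j hj))).symm
  set X : Plane → Plane := fun u => s.foot i + s.lower i • dir (u 0) + s.upper i • dir (u 1)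
    with hX
  have hXs : ContDiff ℝ ∞ X := (contDiff_const.add ((contDiff_dir_apply 0).const_smul _)).add
    ((contDiff_dir_apply 1).const_smul _)
  have hq1 : q.1 = s.foot i + s.lower i • dir α + s.upper i • dir β := by
    rw [← hα, ← hβ]; abel
  have hq2 : s.foot i + s.lower i • dir α = q.2 i := by rw [← hα]; abel
  set ψ : Position → Plane := fun p =>
    !₂[α + Real.arcsin (cross (dir α) (p.2 i - s.foot i) / s.lower i),
      β + Real.arcsin (cross (dir β) (p.1 - p.2 i) / s.upper i)] with hψ
  have hφψ : ∀ p ∈ s.configSpace, 0 < dot (dir α) (p.2 i - s.foot i) →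
      0 < dot (dir β) (p.1 - p.2 i) →
      (∀ j, j ≠ i → 0 < sgn (ε j) * cross (p.1 - s.foot j) (p.2 j - s.foot j)) →
      s.anglePos i ε (ψ p) = p := by
    intro p hp h1 h2 h3
    have e1 : s.lower i • dir (ψ p 0) = p.2 i - s.foot i :=
      dir_add_arcsin' hl (s.mem_configSpace.mp hp i).1 h1
    have e2 : s.upper i • dir (ψ p 1) = p.1 - p.2 i :=
      dir_add_arcsin' hm (s.mem_configSpace.mp hp i).2 h2
    have e3 : s.foot i + s.lower i • dir (ψ p 0) = p.2 i := by rw [e1]; abel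
    have e4 : s.foot i + s.lower i • dir (ψ p 0) + s.upper i • dir (ψ p 1) = p.1 := by
      rw [e3, e2]; abel
    refine Prod.ext e4 (funext fun j => ?_)
    simp only [anglePos]
    split_ifs with hj
    · rw [e3, hj]
    · rw [e4, elbow_eq hp (h3 j hj).le]
  refine ⟨{u | |u 0 - α| < Real.pi / 2 ∧ |u 1 - β| < Real.pi / 2 ∧
    ∀ j, j ≠ i → 0 < s.legDisc j (X u)}, s.anglePos i ε, !₂[α, β], ?_, ?_, ?_, fun v => rfl⟩
  -- `V` is open in the space of all positions, where the bars have no fixed lengths. Hence the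
  -- bounds that make the arcsines differentiable are imposed in addition to the half plane
  -- conditions, although the latter imply them on the configuration space.
  · refine IsLocalParam.of_leftInverse (ψ := ψ)
      (V := {p | (0 < dot (dir α) (p.2 i - s.foot i) ∧ 0 < dot (dir β) (p.1 - p.2 i)) ∧
        (|cross (dir α) (p.2 i - s.foot i) / s.lower i| < 1 ∧
          |cross (dir β) (p.1 - p.2 i) / s.upper i| < 1) ∧
        ∀ j, j ≠ i → 0 < sgn (ε j) * cross (p.1 - s.foot j) (p.2 j - s.foot j)}) ?_ ?_ ?_ ?_ ?_ ?_ ?_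
    · have o1 : IsOpen {u : Plane | |u 0 - α| < Real.pi / 2} :=
        isOpen_lt (by fun_prop) continuous_const
      have o2 : IsOpen {u : Plane | |u 1 - β| < Real.pi / 2} :=
        isOpen_lt (by fun_prop) continuous_const
      have o3 : IsOpen {u : Plane | ∀ j, j ≠ i → 0 < s.legDisc j (X u)} := by
        simp only [Set.ofPred_forall]
        exact isOpen_iInter_of_finite fun j => isOpen_iInter_of_finite fun _ =>
          isOpen_lt continuous_const ((continuous_legDisc j).comp hXs.continuous)
      exact o1.inter (o2.inter o3)
    · have o1 : IsOpen {p : Position | 0 < dot (dir α) (p.2 i - s.foot i)} :=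
        isOpen_lt continuous_const (by fun_prop)
      have o2 : IsOpen {p : Position | 0 < dot (dir β) (p.1 - p.2 i)} :=
        isOpen_lt continuous_const (by fun_prop)
      have o3 : IsOpen {p : Position | |cross (dir α) (p.2 i - s.foot i) / s.lower i| < 1} :=
        isOpen_lt (by fun_prop) continuous_const
      have o4 : IsOpen {p : Position | |cross (dir β) (p.1 - p.2 i) / s.upper i| < 1} :=
        isOpen_lt (by fun_prop) continuous_const
      have o5 : IsOpen {p : Position | ∀ j, j ≠ i →
          0 < sgn (ε j) * cross (p.1 - s.foot j) (p.2 j - s.foot j)} := by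
        simp only [Set.ofPred_forall]
        exact isOpen_iInter_of_finite fun j => isOpen_iInter_of_finite fun _ =>
          isOpen_lt continuous_const (by fun_prop)
      exact (o1.inter o2).inter ((o3.inter o4).inter o5)
    · rintro u ⟨-, -, hu⟩
      refine (ContDiffAt.prodMk hXs.contDiffAt (contDiffAt_pi.mpr fun j => ?_)).contDiffWithinAt
      by_cases hj : j = i
      · simp only [hj, if_true]
        exact (contDiff_const.add ((contDiff_dir_apply 0).const_smul _)).contDiffAt
      · simp only [hj, if_false]
        exact contDiffAt_elbow hXs.contDiffAt (hu j hj) _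
    · rintro p ⟨-, ⟨h1, h2⟩, -⟩
      obtain ⟨h1, h1'⟩ := abs_lt.mp h1
      obtain ⟨h2, h2'⟩ := abs_lt.mp h2
      rw [differentiableAt_euclidean]
      have d1 : DifferentiableAt ℝ (fun p : Position =>
          cross (dir α) (p.2 i - s.foot i) / s.lower i) p := by
        unfold cross; simp only [PiLp.sub_apply]; fun_prop
      have d2 : DifferentiableAt ℝ (fun p : Position =>
          cross (dir β) (p.1 - p.2 i) / s.upper i) p := by
        unfold cross; simp only [PiLp.sub_apply]; fun_prop
      intro n
      fin_cases n
      · exact ((Real.differentiableAt_arcsin.mpr ⟨h1.ne', h1'.ne⟩).comp p d1).const_add α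
      · exact ((Real.differentiableAt_arcsin.mpr ⟨h2.ne', h2'.ne⟩).comp p d2).const_add β
    · rintro u ⟨h1, h2, h3⟩
      have f1 : (s.anglePos i ε u).2 i - s.foot i = s.lower i • dir (u 0) := by
        simp [anglePos]
      have f2 : (s.anglePos i ε u).1 - (s.anglePos i ε u).2 i = s.upper i • dir (u 1) := by
        simp [anglePos]
      have f3 : ∀ j, j ≠ i → (s.anglePos i ε u).2 j = s.elbow j (ε j) (X u) := by
        intro j hj; simp [anglePos, hj, hX]
      have g : ∀ (r θ : ℝ), dot (r • dir θ) (r • dir θ) = r ^ 2 := by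
        intro r θ
        rw [dot_smul_right, show dot (r • dir θ) (dir θ) = r * dot (dir θ) (dir θ) by
          simp [dot]; ring, dot_dir_self]; ring
      have c1 : 0 < dot (dir α) (s.lower i • dir (u 0)) := by
        rw [dot_smul_right, dot_dir]
        exact mul_pos hl (Real.cos_pos_of_mem_Ioo (abs_lt.mp h1))
      have c2 : 0 < dot (dir β) (s.upper i • dir (u 1)) := by
        rw [dot_smul_right, dot_dir]
        exact mul_pos hm (Real.cos_pos_of_mem_Ioo (abs_lt.mp h2))
      refine ⟨s.mem_configSpace.mpr fun j => ?_, ?_, ?_, ?_⟩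
      · by_cases hj : j = i
        · subst hj
          rw [f1, f2, g, g]; exact ⟨rfl, rfl⟩
        · rw [f3 j hj]
          exact ⟨(elbow_spec (h3 j hj) (ε j)).1, (elbow_spec (h3 j hj) (ε j)).2.1⟩
      · rw [f1, f2]; exact ⟨c1, c2⟩
      · rw [f1, f2]
        exact ⟨abs_cross_div_lt_one hl (g _ _) c1, abs_cross_div_lt_one hm (g _ _) c2⟩
      · intro j hj
        rw [f3 j hj]
        exact (elbow_spec (h3 j hj) (ε j)).2.2
    · rintro u ⟨h1, h2, -⟩
      obtain ⟨h1, h1'⟩ := abs_lt.mp h1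
      obtain ⟨h2, h2'⟩ := abs_lt.mp h2
      have f1 : (s.anglePos i ε u).2 i - s.foot i = s.lower i • dir (u 0) := by
        simp [anglePos]
      have f2 : (s.anglePos i ε u).1 - (s.anglePos i ε u).2 i = s.upper i • dir (u 1) := by
        simp [anglePos]
      refine plane_ext ?_ ?_
      · change α + Real.arcsin (cross (dir α) ((s.anglePos i ε u).2 i - s.foot i) / s.lower i) = _
        rw [f1, cross_smul_right, mul_div_cancel_left₀ _ hl.ne', cross_dir,
          Real.arcsin_sin (by linarith) (by linarith)]
        ring
      · change β + Real.arcsin (cross (dir β) ((s.anglePos i ε u).1 - (s.anglePos i ε u).2 i) /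
          s.upper i) = _
        rw [f2, cross_smul_right, mul_div_cancel_left₀ _ hm.ne', cross_dir,
          Real.arcsin_sin (by linarith) (by linarith)]
        ring
    · rintro p ⟨hp, ⟨h1, h2⟩, -, h3⟩ -
      exact hφψ p hp h1 h2 h3
  · refine ⟨?_, ?_, fun j hj => ?_⟩
    · simp [Real.pi_pos]
    · simp [Real.pi_pos]
    · have : X !₂[α, β] = q.1 := hq1.symm
      rw [this]
      exact legDisc_pos hW (h j hj)
  · refine Prod.ext hq1.symm (funext fun j => ?_)
    by_cases hj : j = i
    · subst hj; simp only [anglePos, if_true]; exact hq2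
    · simp only [anglePos, hj, if_false]
      have : s.foot i + s.lower i • dir ((!₂[α, β] : Plane) 0) +
        s.upper i • dir ((!₂[α, β] : Plane) 1) = q.1 := hq1.symm
      rw [this]
      exact elbow_eq hq (hε j)

end Spider


/-! ### The chart by two bending angles; smoothness and compactness -/

/-- The lower bar of a leg with bars `l`, `m` and bending angle `t` that reaches from `0` to `y`. -/
def lowerBar (l m t : ℝ) (y : Plane) : Plane :=
  (l / (l ^ 2 + m ^ 2 + 2 * l * m * Real.cos t)) •
    ((l + m * Real.cos t) • y - (m * Real.sin t) • rot y)

/-- In complex notation the lower bar `b` and the upper bar `(m / l) e^{it} b` add up to `y`, so `b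
= l y / (l + m e^{it})`. Multiplying by the conjugate of the denominator gives the formula, `rot`
being multiplication by `i`. -/
theorem lowerBar_spec {l m t : ℝ} {y : Plane}
    (hy : dot y y = l ^ 2 + m ^ 2 + 2 * l * m * Real.cos t) (h0 : y ≠ 0) :
    dot (lowerBar l m t y) (lowerBar l m t y) = l ^ 2 ∧
    dot (y - lowerBar l m t y) (y - lowerBar l m t y) = m ^ 2 ∧
    dot (lowerBar l m t y) (y - lowerBar l m t y) = l * m * Real.cos t ∧
    cross (lowerBar l m t y) (y - lowerBar l m t y) = l * m * Real.sin t := by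
  have hN := (dot_self_pos.mpr h0).ne'
  have hcs := Real.cos_sq_add_sin_sq t
  unfold lowerBar
  rw [← hy]
  generalize hNN : dot y y = N at *
  have h1 : dot ((l / N) • ((l + m * Real.cos t) • y - (m * Real.sin t) • rot y))
      ((l / N) • ((l + m * Real.cos t) • y - (m * Real.sin t) • rot y)) = l ^ 2 := by
    have : dot ((l / N) • ((l + m * Real.cos t) • y - (m * Real.sin t) • rot y))
      ((l / N) • ((l + m * Real.cos t) • y - (m * Real.sin t) • rot y)) = (l / N) ^ 2 *
        (((l + m * Real.cos t) ^ 2 + (m * Real.sin t) ^ 2) * dot y y) := by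
      simp only [dot, PiLp.sub_apply, PiLp.smul_apply, smul_eq_mul, rot_zero, rot_one]; ring
    rw [this, hNN, show (l + m * Real.cos t) ^ 2 + (m * Real.sin t) ^ 2 = N by
      rw [hy]; linear_combination m ^ 2 * hcs]
    field_simp
  have h2 : dot ((l / N) • ((l + m * Real.cos t) • y - (m * Real.sin t) • rot y)) y =
      l * (l + m * Real.cos t) := by
    have : dot ((l / N) • ((l + m * Real.cos t) • y - (m * Real.sin t) • rot y)) y =
        (l / N) * ((l + m * Real.cos t) * dot y y) := by
      simp only [dot, PiLp.sub_apply, PiLp.smul_apply, smul_eq_mul, rot_zero, rot_one]; ring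
    rw [this, hNN]
    field_simp
  have h3 : cross ((l / N) • ((l + m * Real.cos t) • y - (m * Real.sin t) • rot y)) y =
      l * (m * Real.sin t) := by
    have : cross ((l / N) • ((l + m * Real.cos t) • y - (m * Real.sin t) • rot y)) y =
        (l / N) * ((m * Real.sin t) * dot y y) := by
      simp only [cross, dot, PiLp.sub_apply, PiLp.smul_apply, smul_eq_mul, rot_zero, rot_one]
      ring
    rw [this, hNN]
    field_simp
  generalize (l / N) • ((l + m * Real.cos t) • y - (m * Real.sin t) • rot y) = b at *
  have e1 : dot (y - b) (y - b) = dot y y - 2 * dot b y + dot b b := by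
    simp only [dot, PiLp.sub_apply]; ring
  have e2 : dot b (y - b) = dot b y - dot b b := by simp only [dot, PiLp.sub_apply]; ring
  have e3 : cross b (y - b) = cross b y := by simp only [cross, PiLp.sub_apply]; ring
  refine ⟨h1, ?_, ?_, ?_⟩
  · rw [e1, h1, h2, hNN, hy]; ring
  · rw [e2, h1, h2]; ring
  · rw [e3, h3]; ring

theorem eq_lowerBar {l m t : ℝ} {b y : Plane} (hl : dot b b = l ^ 2)
    (hm : dot (y - b) (y - b) = m ^ 2) (hc : dot b (y - b) = l * m * Real.cos t)
    (hs : cross b (y - b) = l * m * Real.sin t) (h0 : y ≠ 0) : lowerBar l m t y = b := by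
  have hy : dot y y = l ^ 2 + m ^ 2 + 2 * l * m * Real.cos t := by
    have : dot y y = dot b b + dot (y - b) (y - b) + 2 * dot b (y - b) := by
      simp only [dot, PiLp.sub_apply]; ring
    rw [this, hl, hm, hc]; ring
  have hN := (dot_self_pos.mpr h0).ne'
  unfold lowerBar
  rw [← hy, div_eq_inv_mul, mul_smul, inv_smul_eq_iff₀ hN]
  have e1 : l * (l + m * Real.cos t) = dot b y := by
    have : dot b y = dot b (y - b) + dot b b := by simp only [dot, PiLp.sub_apply]; ring
    rw [this, hc, hl]; ring
  have e2 : l * (m * Real.sin t) = cross b y := by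
    have : cross b y = cross b (y - b) := by simp only [cross, PiLp.sub_apply]; ring
    rw [this, hs]; ring
  rw [smul_sub, smul_smul, smul_smul, e1, e2]
  apply plane_ext <;>
  · simp only [dot, cross, PiLp.sub_apply, PiLp.smul_apply, smul_eq_mul, rot_zero, rot_one]; ring

theorem contDiffAt_lowerBar {F : Type*} [NormedAddCommGroup F] [NormedSpace ℝ F] {l m : ℝ}
    {t : F → ℝ} {y : F → Plane} {u : F} (ht : ContDiffAt ℝ ∞ t u) (hy : ContDiffAt ℝ ∞ y u)
    (h0 : l ^ 2 + m ^ 2 + 2 * l * m * Real.cos (t u) ≠ 0) :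
    ContDiffAt ℝ ∞ (fun v => lowerBar l m (t v) (y v)) u := by
  unfold lowerBar
  have h1 : ContDiffAt ℝ ∞ (fun v => l ^ 2 + m ^ 2 + 2 * l * m * Real.cos (t v)) u :=
    contDiffAt_const.add (contDiffAt_const.mul ht.cos)
  exact (contDiffAt_const.div h1 h0).smul (((contDiffAt_const.add
    (contDiffAt_const.mul ht.cos)).smul hy).sub
    ((contDiffAt_const.mul ht.sin).smul (rot.contDiff.contDiffAt.comp u hy)))

namespace Spider

variable {s : Spider}

/-- The squared reach of leg `i` when it is bent by the angle `t`. -/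
def reach (s : Spider) (i : Fin 3) (c : ℝ) : ℝ :=
  s.lower i ^ 2 + s.upper i ^ 2 + 2 * s.lower i * s.upper i * c

/-- The squared reach is at least `(l - m) ^ 2`, which is positive as the bars are unequal; so the
formula for the lower bar has no pole. -/
theorem reach_pos (i : Fin 3) (t : ℝ) : 0 < s.reach i (Real.cos t) := by
  have h1 := s.inner_pos i
  have h2 := s.inner_sq i
  have h3 := Real.neg_one_le_cos t
  have := mul_pos (s.lower_pos i) (s.upper_pos i)
  unfold reach
  nlinarith [mul_nonneg this.le (by linarith : 0 ≤ Real.cos t + 1), mul_pos h1 h1]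

theorem sqDist_eq_reach {q : Position} (hq : q ∈ s.configSpace) {i : Fin 3} {c : ℝ}
    (h : dot (q.2 i - s.foot i) (q.1 - q.2 i) = s.lower i * s.upper i * c) :
    s.sqDist i q.1 = s.reach i c := by
  obtain ⟨h1, h2⟩ := s.mem_configSpace.mp hq i
  have : s.sqDist i q.1 = dot (q.2 i - s.foot i) (q.2 i - s.foot i) +
      dot (q.1 - q.2 i) (q.1 - q.2 i) + 2 * dot (q.2 i - s.foot i) (q.1 - q.2 i) := by
    simp only [sqDist, dot, PiLp.sub_apply]; ring
  rw [this, h1, h2, h, reach]; ring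

theorem bend_sq {q : Position} (hq : q ∈ s.configSpace) (i : Fin 3) :
    (dot (q.2 i - s.foot i) (q.1 - q.2 i) / (s.lower i * s.upper i)) ^ 2 +
      (cross (q.2 i - s.foot i) (q.1 - q.2 i) / (s.lower i * s.upper i)) ^ 2 = 1 := by
  obtain ⟨h1, h2⟩ := s.mem_configSpace.mp hq i
  have hl := s.lower_pos i
  have hm := s.upper_pos i
  have : dot (q.2 i - s.foot i) (q.1 - q.2 i) ^ 2 + cross (q.2 i - s.foot i) (q.1 - q.2 i) ^ 2 =
      dot (q.2 i - s.foot i) (q.2 i - s.foot i) * dot (q.1 - q.2 i) (q.1 - q.2 i) := by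
    simp only [dot, cross]; ring
  rw [h1, h2] at this
  field_simp
  linarith

/-- The centre of a position at which legs `i` and `j` are bent by given angles. -/
def bendCentre (s : Spider) (i j : Fin 3) (τ : ℝ) (c : Plane) : Plane :=
  apex (s.foot i) (s.foot j) (s.reach i (c 0)) (s.reach j (c 1)) τ

/-- The cosines of the coordinates. -/
def cosines (u : Plane) : Plane := !₂[Real.cos (u 0), Real.cos (u 1)]

theorem contDiff_cosines : ContDiff ℝ ∞ cosines := by
  rw [contDiff_euclidean]
  intro i
  fin_cases i
  · exact Real.contDiff_cos.comp (contDiff_plane_apply 0)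
  · exact Real.contDiff_cos.comp (contDiff_plane_apply 1)

/-- The discriminant of the triangle formed by two feet and the centre. -/
def bendDisc (s : Spider) (i j : Fin 3) (c : Plane) : ℝ :=
  disc (dot (s.foot j - s.foot i) (s.foot j - s.foot i)) (s.reach i (c 0)) (s.reach j (c 1))

theorem contDiffAt_bendCentre {i j : Fin 3} (h : s.foot j ≠ s.foot i) {τ : ℝ} {c : Plane}
    (hc : 0 < s.bendDisc i j c) : ContDiffAt ℝ ∞ (s.bendCentre i j τ) c := by
  refine contDiffAt_apex contDiffAt_const ?_ ?_ h hc
  · exact contDiffAt_const.add (contDiffAt_const.mul (contDiff_plane_apply 0).contDiffAt)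
  · exact contDiffAt_const.add (contDiffAt_const.mul (contDiff_plane_apply 1).contDiffAt)

theorem bendCentre_spec {i j : Fin 3} (h : s.foot j ≠ s.foot i) (b : Bool) {c : Plane}
    (hc : 0 < s.bendDisc i j c) :
    s.sqDist i (s.bendCentre i j (sgn b) c) = s.reach i (c 0) ∧
    s.sqDist j (s.bendCentre i j (sgn b) c) = s.reach j (c 1) ∧
    0 < sgn b * cross (s.foot j - s.foot i) (s.bendCentre i j (sgn b) c - s.foot i) := by
  refine ⟨dot_apex_sub_left h hc.le (sgn_sq b), ?_, ?_⟩
  · rw [← dot_apex_sub_right h hc.le (sgn_sq b)]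
    simp only [sqDist, bendCentre, dot, PiLp.sub_apply]; ring
  · rw [bendCentre, cross_apex h, ← mul_assoc, sgn_mul_self, one_mul]
    exact Real.sqrt_pos.mpr hc

/-- The position at which legs `i` and `j` are bent by given angles. -/
def bendPos (s : Spider) (i j : Fin 3) (τ : ℝ) (b : Bool) (u : Plane) : Position :=
  (s.bendCentre i j τ (cosines u), fun n =>
    if n = i then s.foot i + lowerBar (s.lower i) (s.upper i) (u 0)
      (s.bendCentre i j τ (cosines u) - s.foot i)
    else if n = j then s.foot j + lowerBar (s.lower j) (s.upper j) (u 1)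
      (s.bendCentre i j τ (cosines u) - s.foot j)
    else s.elbow n b (s.bendCentre i j τ (cosines u)))

/-- The sine of the bending angle of leg `i`. -/
def bendSin (s : Spider) (i : Fin 3) (q : Position) : ℝ :=
  cross (q.2 i - s.foot i) (q.1 - q.2 i) / (s.lower i * s.upper i)

theorem continuous_bendSin (i : Fin 3) : Continuous (s.bendSin i) := by
  unfold bendSin; fun_prop

theorem differentiableAt_bendSin (i : Fin 3) (q : Position) :
    DifferentiableAt ℝ (s.bendSin i) q := by
  unfold bendSin cross; simp only [PiLp.sub_apply]; fun_prop

theorem bend_arcsin {q : Position} (hq : q ∈ s.configSpace) {i : Fin 3}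
    (h : 0 < dot (q.2 i - s.foot i) (q.1 - q.2 i)) :
    cross (q.2 i - s.foot i) (q.1 - q.2 i) =
      s.lower i * s.upper i * Real.sin (Real.arcsin (s.bendSin i q)) ∧
    dot (q.2 i - s.foot i) (q.1 - q.2 i) =
      s.lower i * s.upper i * Real.cos (Real.arcsin (s.bendSin i q)) := by
  have hl := s.lower_pos i
  have hm := s.upper_pos i
  obtain ⟨h1, h2⟩ := sin_cos_arcsin (bend_sq hq i) (by positivity)
  rw [bendSin, h1, h2]
  constructor <;> field_simp

/-- The two bending angles fix the distances of the centre from feet `i` and `j`, and `τ` tells the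
side of the line through these feet. The signed angles then fix elbows `i` and `j`, and `b` fixes
elbow `k`. Positive bending cosines let the arcsines recover the angles. -/
theorem bendPos_right {i j k : Fin 3} (hij : s.foot j ≠ s.foot i)
    (hall : ∀ n, n = i ∨ n = j ∨ n = k)
    {τ b : Bool} {q : Position} (hq : q ∈ s.configSpace)
    (hi : 0 < dot (q.2 i - s.foot i) (q.1 - q.2 i)) (hj : 0 < dot (q.2 j - s.foot j) (q.1 - q.2 j))
    (hτ : 0 < sgn τ * cross (s.foot j - s.foot i) (q.1 - s.foot i))
    (hb : 0 < sgn b * cross (q.1 - s.foot k) (q.2 k - s.foot k)) :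
    s.bendPos i j (sgn τ) b !₂[Real.arcsin (s.bendSin i q), Real.arcsin (s.bendSin j q)] = q := by
  have hW := s.fst_mem_workspace hq
  obtain ⟨hi1, hi2⟩ := bend_arcsin hq hi
  obtain ⟨hj1, hj2⟩ := bend_arcsin hq hj
  have hX : s.bendCentre i j (sgn τ)
      (cosines !₂[Real.arcsin (s.bendSin i q), Real.arcsin (s.bendSin j q)]) = q.1 := by
    have hL : dot (q.1 - s.foot i) (q.1 - s.foot i) =
      s.reach i (Real.cos (Real.arcsin (s.bendSin i q))) := sqDist_eq_reach hq hi2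
    have hM : dot (s.foot j - q.1) (s.foot j - q.1) =
        s.reach j (Real.cos (Real.arcsin (s.bendSin j q))) := by
      rw [← sqDist_eq_reach hq hj2, sqDist]
      simp only [dot, PiLp.sub_apply]; ring
    refine (eq_apex hij hL hM ?_).symm
    rw [disc_eq_cross_sq hL hM, Real.sqrt_sq_eq_abs]
    cases τ <;> simp only [sgn] at hτ ⊢
    · rw [abs_of_nonpos (by have : _ := hτ; simp at this; linarith)]
      simp
    · rw [abs_of_nonneg (by have : _ := hτ; simp at this; linarith)]
      simp
  have harm : ∀ n, cross (q.2 n - s.foot n) (q.1 - q.2 n) =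
      s.lower n * s.upper n * Real.sin (Real.arcsin (s.bendSin n q)) →
      dot (q.2 n - s.foot n) (q.1 - q.2 n) =
      s.lower n * s.upper n * Real.cos (Real.arcsin (s.bendSin n q)) →
      s.foot n + lowerBar (s.lower n) (s.upper n) (Real.arcsin (s.bendSin n q))
        (q.1 - s.foot n) = q.2 n := by
    intro n h1 h2
    have e : q.1 - s.foot n - (q.2 n - s.foot n) = q.1 - q.2 n := by abel
    rw [eq_lowerBar (s.mem_configSpace.mp hq n).1 (by rw [e]; exact (s.mem_configSpace.mp hq n).2)
      (by rw [e]; exact h2) (by rw [e]; exact h1) (sub_ne_zero.mpr (ne_foot hW n))]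
    abel
  refine Prod.ext hX (funext fun n => ?_)
  simp only [bendPos, hX]
  split_ifs with h1 h2
  · subst h1; exact harm n hi1 hi2
  · subst h2; exact harm n hj1 hj2
  · have : n = k := by have := hall n; tauto
    subst this
    exact elbow_eq hq hb.le

theorem bendPos_spec {i j k : Fin 3} (hij : s.foot j ≠ s.foot i) (hne : i ≠ j)
    (hki : k ≠ i) (hkj : k ≠ j) (hall : ∀ n, n = i ∨ n = j ∨ n = k) (τ b : Bool) {u : Plane}
    (hu : 0 < s.bendDisc i j (cosines u))
    (hk : 0 < s.legDisc k (s.bendCentre i j (sgn τ) (cosines u))) :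
    let q := s.bendPos i j (sgn τ) b u
    q ∈ s.configSpace ∧
    dot (q.2 i - s.foot i) (q.1 - q.2 i) = s.lower i * s.upper i * Real.cos (u 0) ∧
    cross (q.2 i - s.foot i) (q.1 - q.2 i) = s.lower i * s.upper i * Real.sin (u 0) ∧
    dot (q.2 j - s.foot j) (q.1 - q.2 j) = s.lower j * s.upper j * Real.cos (u 1) ∧
    cross (q.2 j - s.foot j) (q.1 - q.2 j) = s.lower j * s.upper j * Real.sin (u 1) ∧
    0 < sgn τ * cross (s.foot j - s.foot i) (q.1 - s.foot i) ∧
    0 < sgn b * cross (q.1 - s.foot k) (q.2 k - s.foot k) := by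
  intro q
  obtain ⟨h1, h2, h3⟩ := bendCentre_spec hij τ hu
  set X := s.bendCentre i j (sgn τ) (cosines u) with hX
  have hq1 : q.1 = X := rfl
  have hne' : ∀ n t, s.sqDist n X = s.reach n (Real.cos t) → X - s.foot n ≠ 0 := by
    intro n t h
    rw [← dot_self_pos]
    exact (reach_pos n t).trans_eq h.symm
  have hi := lowerBar_spec (t := u 0) h1 (hne' i _ h1)
  have hj := lowerBar_spec (t := u 1) h2 (hne' j _ h2)
  have e : ∀ n, X - s.foot n - (q.2 n - s.foot n) = X - q.2 n := fun n => by abel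
  have f1 : lowerBar (s.lower i) (s.upper i) (u 0) (X - s.foot i) = q.2 i - s.foot i := by
    simp [q, bendPos, hX]
  have f2 : lowerBar (s.lower j) (s.upper j) (u 1) (X - s.foot j) = q.2 j - s.foot j := by
    simp [q, bendPos, hX, hne.symm]
  have f3 : q.2 k = s.elbow k b X := by simp [q, bendPos, hX, hki, hkj]
  rw [f1, e] at hi
  rw [f2, e] at hj
  obtain ⟨g1, g2, g3⟩ := elbow_spec hk b
  rw [hq1, f3]
  refine ⟨s.mem_configSpace.mpr fun n => ?_, hi.2.2.1, hi.2.2.2, hj.2.2.1, hj.2.2.2, h3, g3⟩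
  rcases hall n with rfl | rfl | rfl
  · exact ⟨hi.1, hi.2.1⟩
  · exact ⟨hj.1, hj.2.1⟩
  · rw [hq1, f3]; exact ⟨g1, g2⟩

theorem contDiffAt_bendPos {i j k : Fin 3} (hij : s.foot j ≠ s.foot i)
    (hall : ∀ n, n = i ∨ n = j ∨ n = k) (τ b : Bool) {u : Plane}
    (hu : 0 < s.bendDisc i j (cosines u))
    (hk : 0 < s.legDisc k (s.bendCentre i j (sgn τ) (cosines u))) :
    ContDiffAt ℝ ∞ (s.bendPos i j (sgn τ) b) u := by
  have hX : ContDiffAt ℝ ∞ (fun u => s.bendCentre i j (sgn τ) (cosines u)) u :=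
    (contDiffAt_bendCentre hij hu).comp u contDiff_cosines.contDiffAt
  refine hX.prodMk (contDiffAt_pi.mpr fun n => ?_)
  by_cases h1 : n = i
  · simp only [h1, if_true]
    exact contDiffAt_const.add (contDiffAt_lowerBar (contDiff_plane_apply 0).contDiffAt
      (hX.sub contDiffAt_const) (reach_pos i _).ne')
  · by_cases h2 : n = j
    · simp only [h2, if_true]
      rw [h2] at h1
      simp only [h1, if_false]
      exact contDiffAt_const.add (contDiffAt_lowerBar (contDiff_plane_apply 1).contDiffAt
        (hX.sub contDiffAt_const) (reach_pos j _).ne')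
    · simp only [h1, if_false, h2]
      have : n = k := by have := hall n; tauto
      subst this
      exact contDiffAt_elbow hX hk b

theorem continuous_bendCentre {i j : Fin 3} (τ : ℝ) : Continuous (s.bendCentre i j τ) := by
  unfold bendCentre apex disc reach; fun_prop

theorem continuous_bendDisc {i j : Fin 3} : Continuous (s.bendDisc i j) := by
  unfold bendDisc disc reach; fun_prop

/-- Where leg `k` is not aligned and the centre is not on the line through the two other feet, the
bending angles of the two other legs are local coordinates. -/
theorem exists_chart_bend {q : Position} (hq : q ∈ s.configSpace) {i j k : Fin 3}
    (hij : s.foot j ≠ s.foot i) (hne : i ≠ j) (hki : k ≠ i) (hkj : k ≠ j)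
    (hall : ∀ n, n = i ∨ n = j ∨ n = k)
    (hi : 0 < dot (q.2 i - s.foot i) (q.1 - q.2 i)) (hj : 0 < dot (q.2 j - s.foot j) (q.1 - q.2 j))
    (hx : cross (s.foot j - s.foot i) (q.1 - s.foot i) ≠ 0) (hk : s.legDisc k q.1 ≠ 0) :
    ∃ (U : Set Plane) (φ : Plane → Position) (τ : Bool), IsLocalParam s.configSpace U φ ∧
      !₂[Real.arcsin (s.bendSin i q), Real.arcsin (s.bendSin j q)] ∈ U ∧
      φ !₂[Real.arcsin (s.bendSin i q), Real.arcsin (s.bendSin j q)] = q ∧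
      (∀ u ∈ U, 0 < s.bendDisc i j (cosines u)) ∧
      ∀ u, (φ u).1 = s.bendCentre i j (sgn τ) (cosines u) := by
  have hW := s.fst_mem_workspace hq
  obtain ⟨τ, hτ⟩ := exists_sgn_pos hx
  obtain ⟨b, hb⟩ := exists_sgn_pos (cross_ne_zero_of_legDisc hq hk)
  have hφ := bendPos_right hij hall hq hi hj hτ hb
  have hl : ∀ n, 0 < s.lower n * s.upper n := fun n => mul_pos (s.lower_pos n) (s.upper_pos n)
  have habs : ∀ p ∈ s.configSpace, ∀ n, 0 < dot (p.2 n - s.foot n) (p.1 - p.2 n) →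
      |s.bendSin n p| < 1 := fun p hp n h =>
    abs_lt_one_of_sq_add_sq (bend_sq hp n) (div_pos h (hl n))
  have hlt : ∀ p ∈ s.configSpace, ∀ n, 0 < dot (p.2 n - s.foot n) (p.1 - p.2 n) →
      |Real.arcsin (s.bendSin n p)| < Real.pi / 2 := fun p hp n h => by
    have := abs_lt.mp (habs p hp n h)
    rw [abs_lt]
    exact ⟨Real.neg_pi_div_two_lt_arcsin.mpr this.1, Real.arcsin_lt_pi_div_two.mpr this.2⟩
  refine ⟨{u | (|u 0| < Real.pi / 2 ∧ |u 1| < Real.pi / 2) ∧ 0 < s.bendDisc i j (cosines u) ∧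
    0 < s.legDisc k (s.bendCentre i j (sgn τ) (cosines u))}, s.bendPos i j (sgn τ) b, τ, ?_,
    ⟨⟨hlt q hq i hi, hlt q hq j hj⟩, ?_, ?_⟩, hφ, fun u hu => hu.2.1, fun u => rfl⟩
  · refine IsLocalParam.of_leftInverse
      (ψ := fun p => !₂[Real.arcsin (s.bendSin i p), Real.arcsin (s.bendSin j p)])
      (V := {p | ((0 < dot (p.2 i - s.foot i) (p.1 - p.2 i) ∧
        0 < dot (p.2 j - s.foot j) (p.1 - p.2 j)) ∧
        (|s.bendSin i p| < 1 ∧ |s.bendSin j p| < 1)) ∧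
        0 < sgn τ * cross (s.foot j - s.foot i) (p.1 - s.foot i) ∧
        0 < sgn b * cross (p.1 - s.foot k) (p.2 k - s.foot k)}) ?_ ?_ ?_ ?_ ?_ ?_ ?_
    · have o1 : IsOpen {u : Plane | |u 0| < Real.pi / 2} := isOpen_lt (by fun_prop) continuous_const
      have o2 : IsOpen {u : Plane | |u 1| < Real.pi / 2} := isOpen_lt (by fun_prop) continuous_const
      have o3 : IsOpen {u : Plane | 0 < s.bendDisc i j (cosines u)} :=
        isOpen_lt continuous_const (continuous_bendDisc.comp contDiff_cosines.continuous)
      have o4 : IsOpen {u : Plane | 0 < s.legDisc k (s.bendCentre i j (sgn τ) (cosines u))} :=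
        isOpen_lt continuous_const ((continuous_legDisc k).comp
          ((continuous_bendCentre _).comp contDiff_cosines.continuous))
      exact (o1.inter o2).inter (o3.inter o4)
    · have o1 : ∀ n, IsOpen {p : Position | 0 < dot (p.2 n - s.foot n) (p.1 - p.2 n)} :=
        fun n => isOpen_lt continuous_const (by fun_prop)
      have o2 : ∀ n, IsOpen {p : Position | |s.bendSin n p| < 1} :=
        fun n => isOpen_lt (continuous_bendSin n).abs continuous_const
      have o3 : IsOpen {p : Position | 0 < sgn τ * cross (s.foot j - s.foot i) (p.1 - s.foot i)} :=
        isOpen_lt continuous_const (by fun_prop)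
      have o4 : IsOpen {p : Position | 0 < sgn b * cross (p.1 - s.foot k) (p.2 k - s.foot k)} :=
        isOpen_lt continuous_const (by fun_prop)
      exact (((o1 i).inter (o1 j)).inter ((o2 i).inter (o2 j))).inter (o3.inter o4)
    · exact fun u hu => (contDiffAt_bendPos hij hall τ b hu.2.1 hu.2.2).contDiffWithinAt
    · rintro p ⟨⟨-, h1, h2⟩, -⟩
      obtain ⟨h1, h1'⟩ := abs_lt.mp h1
      obtain ⟨h2, h2'⟩ := abs_lt.mp h2
      rw [differentiableAt_euclidean]
      intro n
      fin_cases n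
      · exact (Real.differentiableAt_arcsin.mpr ⟨h1.ne', h1'.ne⟩).comp p
          (differentiableAt_bendSin i p)
      · exact (Real.differentiableAt_arcsin.mpr ⟨h2.ne', h2'.ne⟩).comp p
          (differentiableAt_bendSin j p)
    · rintro u ⟨⟨h1, h2⟩, h3, h4⟩
      obtain ⟨g0, g1, -, g3, -, g5, g6⟩ := bendPos_spec hij hne hki hkj hall τ b h3 h4
      have c1 : 0 < dot ((s.bendPos i j (sgn τ) b u).2 i - s.foot i)
          ((s.bendPos i j (sgn τ) b u).1 - (s.bendPos i j (sgn τ) b u).2 i) := by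
        rw [g1]; exact mul_pos (hl i) (Real.cos_pos_of_mem_Ioo (abs_lt.mp h1))
      have c2 : 0 < dot ((s.bendPos i j (sgn τ) b u).2 j - s.foot j)
          ((s.bendPos i j (sgn τ) b u).1 - (s.bendPos i j (sgn τ) b u).2 j) := by
        rw [g3]; exact mul_pos (hl j) (Real.cos_pos_of_mem_Ioo (abs_lt.mp h2))
      exact ⟨g0, ⟨⟨c1, c2⟩, habs _ g0 i c1, habs _ g0 j c2⟩, g5, g6⟩
    · rintro u ⟨⟨h1, h2⟩, h3, h4⟩
      obtain ⟨g0, -, g2, -, g4, -⟩ := bendPos_spec hij hne hki hkj hall τ b h3 h4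
      obtain ⟨h1, h1'⟩ := abs_lt.mp h1
      obtain ⟨h2, h2'⟩ := abs_lt.mp h2
      refine plane_ext ?_ ?_
      · change Real.arcsin (s.bendSin i _) = _
        rw [bendSin, g2, mul_div_cancel_left₀ _ (hl i).ne',
          Real.arcsin_sin (by linarith) (by linarith)]
      · change Real.arcsin (s.bendSin j _) = _
        rw [bendSin, g4, mul_div_cancel_left₀ _ (hl j).ne',
          Real.arcsin_sin (by linarith) (by linarith)]
    · rintro p ⟨hp, ⟨⟨h1, h2⟩, -⟩, h3, h4⟩ -
      exact bendPos_right hij hall hp h1 h2 h3 h4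
  · obtain ⟨-, hi2⟩ := bend_arcsin hq hi
    obtain ⟨-, hj2⟩ := bend_arcsin hq hj
    have hL : dot (q.1 - s.foot i) (q.1 - s.foot i) =
      s.reach i (Real.cos (Real.arcsin (s.bendSin i q))) := sqDist_eq_reach hq hi2
    have hM : dot (s.foot j - q.1) (s.foot j - q.1) =
        s.reach j (Real.cos (Real.arcsin (s.bendSin j q))) := by
      rw [← sqDist_eq_reach hq hj2, sqDist]
      simp only [dot, PiLp.sub_apply]; ring
    change 0 < disc _ (s.reach i (Real.cos (Real.arcsin (s.bendSin i q))))
      (s.reach j (Real.cos (Real.arcsin (s.bendSin j q))))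
    rw [disc_eq_cross_sq hL hM]
    positivity
  · have : s.bendCentre i j (sgn τ)
        (cosines !₂[Real.arcsin (s.bendSin i q), Real.arcsin (s.bendSin j q)]) = q.1 :=
      congrArg Prod.fst hφ
    rw [this]
    exact legDisc_pos hW hk

/-- A leg at its largest reach is stretched. -/
theorem stretched {q : Position} (hq : q ∈ s.configSpace) {i : Fin 3}
    (h : dist q.1 (s.foot i) = s.outer i) :
    dot (q.2 i - s.foot i) (q.1 - q.2 i) = s.lower i * s.upper i ∧ s.bendSin i q = 0 := by
  have hl := mul_pos (s.lower_pos i) (s.upper_pos i)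
  obtain ⟨h1, h2⟩ := s.mem_configSpace.mp hq i
  rw [dist_eq_iff_dot (s.outer_pos i).le] at h
  have : dot (q.1 - s.foot i) (q.1 - s.foot i) = dot (q.2 i - s.foot i) (q.2 i - s.foot i) +
      dot (q.1 - q.2 i) (q.1 - q.2 i) + 2 * dot (q.2 i - s.foot i) (q.1 - q.2 i) := by
    simp only [dot, PiLp.sub_apply]; ring
  rw [h, h1, h2, outer] at this
  have hd : dot (q.2 i - s.foot i) (q.1 - q.2 i) = s.lower i * s.upper i := by linarith
  refine ⟨hd, ?_⟩
  have hb := bend_sq hq i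
  rw [hd, div_self hl.ne'] at hb
  have : s.bendSin i q ^ 2 = 0 := by rw [bendSin]; linarith
  exact pow_eq_zero_iff two_ne_zero |>.mp this

namespace IsThreeHoledTriangle

variable (hs : s.IsThreeHoledTriangle)

include hs

/-- At most one leg is aligned, or two legs are stretched. -/
theorem aligned_cases (x : Plane) :
    (∃ i, ∀ j, j ≠ i → s.legDisc j x ≠ 0) ∨
    ∃ i j, i ≠ j ∧ dist x (s.foot i) = s.outer i ∧ dist x (s.foot j) = s.outer j := by
  by_contra hcon
  rw [not_or] at hcon
  obtain ⟨h1, h2⟩ := hcon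
  push Not at h1 h2
  -- The index `0` is arbitrary: it yields some aligned leg `i`, and then `h1 i` yields another one.
  -- Two aligned legs can only be stretched, since an inner circle meets no other circle.
  obtain ⟨i, -, hi⟩ := h1 0
  obtain ⟨j, hji, hj⟩ := h1 i
  rw [legDisc_eq_zero] at hi hj
  rcases hi with hi | hi
  · have g1 := hs.inner_lt_of_inner hji.symm hi
    have g2 := hs.lt_outer_of_inner hji.symm hi
    rcases hj with hj | hj <;> linarith
  · rcases hj with hj | hj
    · have g1 := hs.inner_lt_of_outer hji.symm hi
      linarith
    · exact h2 i j hji.symm hi hj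

/-- At a corner, the third leg is not aligned. -/
theorem legDisc_ne_zero_of_corner {i j k : Fin 3} (h : i ≠ j) (hki : k ≠ i) (hkj : k ≠ j)
    {c : Plane} (hc : c ∈ s.workspace) (hi : dist c (s.foot i) = s.outer i)
    (hj : dist c (s.foot j) = s.outer j) : s.legDisc k c ≠ 0 := by
  rw [Ne, legDisc_eq_zero, not_or]
  exact ⟨(hs.inner_lt_of_outer hki.symm hi).ne', (hs.lt_outer_of_corner h hki hkj hc hi hj).ne⟩

/-- At a corner, the bending angles of the two stretched legs are local coordinates. -/
theorem exists_chart_corner {i j : Fin 3} (h : i ≠ j) {q : Position} (hq : q ∈ s.configSpace)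
    (hi : dist q.1 (s.foot i) = s.outer i) (hj : dist q.1 (s.foot j) = s.outer j) :
    ∃ (U : Set Plane) (φ : Plane → Position) (τ : Bool), IsLocalParam s.configSpace U φ ∧
      0 ∈ U ∧ φ 0 = q ∧ (∀ u ∈ U, 0 < s.bendDisc i j (cosines u)) ∧
      ∀ u, (φ u).1 = s.bendCentre i j (sgn τ) (cosines u) := by
  obtain ⟨k, hki, hkj, hall⟩ := exists_third h
  obtain ⟨d1, s1⟩ := stretched hq hi
  obtain ⟨d2, s2⟩ := stretched hq hj
  have h0 : (!₂[Real.arcsin (s.bendSin i q), Real.arcsin (s.bendSin j q)] : Plane) = 0 := by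
    rw [s1, s2, Real.arcsin_zero]
    exact plane_ext rfl rfl
  have := exists_chart_bend hq (hs.foot_ne h.symm) h hki hkj hall
    (d1 ▸ mul_pos (s.lower_pos i) (s.upper_pos i)) (d2 ▸ mul_pos (s.lower_pos j) (s.upper_pos j))
    (hs.cross_ne_zero h hi hj)
    (hs.legDisc_ne_zero_of_corner h hki hkj (s.fst_mem_workspace hq) hi hj)
  rwa [h0] at this

theorem isSmoothSurface : IsSmoothSurface s.configSpace := by
  intro q hq
  rcases hs.aligned_cases q.1 with ⟨i, hi⟩ | ⟨i, j, hij, hi, hj⟩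
  · obtain ⟨U, φ, u, h, hu, hφ, -⟩ := exists_chart_angles hq hi
    exact ⟨U, φ, h, u, hu, hφ⟩
  · obtain ⟨U, φ, τ, h, hu, hφ, -⟩ := hs.exists_chart_corner hij hq hi hj
    exact ⟨U, φ, h, 0, hu, hφ⟩

end IsThreeHoledTriangle

theorem isCompact_configSpace (s : Spider) : IsCompact s.configSpace := by
  refine Metric.isCompact_of_isClosed_isBounded ?_ ?_
  · rw [configSpace, Set.ofPred_forall]
    refine isClosed_iInter fun i => ?_
    exact (isClosed_eq (by fun_prop) continuous_const).inter
      (isClosed_eq (by fun_prop) continuous_const)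
  · refine ((Metric.isBounded_closedBall (x := s.foot 0) (r := s.outer 0)).prod
      (Metric.isBounded_closedBall (x := s.foot) (r := ∑ i, s.lower i))).subset fun q hq => ⟨?_, ?_⟩
    · exact (s.fst_mem_workspace hq 0).2
    · rw [Metric.mem_closedBall, dist_pi_le_iff (Finset.sum_nonneg fun i _ => (s.lower_pos i).le)]
      intro i
      rw [dist_comm, (hq i).1]
      exact Finset.single_le_sum (f := s.lower) (fun i _ => (s.lower_pos i).le) (Finset.mem_univ i)

end Spider


/-! ### Orientability -/

section Wedge

variable {E : Type*} [NormedAddCommGroup E] [NormedSpace ℝ E]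

/-- The exterior product of two linear forms. -/
def wedge (f g : E →L[ℝ] ℝ) : E [⋀^Fin 2]→L[ℝ] ℝ where
  toFun v := f (v 0) * g (v 1) - f (v 1) * g (v 0)
  map_update_add' m i x y := by
    fin_cases i <;> simp [Function.update] <;> ring
  map_update_smul' m i c x := by
    fin_cases i <;> simp [Function.update] <;> ring
  map_eq_zero_of_eq' v i j hij hne := by
    fin_cases i <;> fin_cases j <;> simp_all
  cont := by fun_prop

@[simp] theorem wedge_apply (f g : E →L[ℝ] ℝ) (v : Fin 2 → E) :
    wedge f g v = f (v 0) * g (v 1) - f (v 1) * g (v 0) := rfl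

theorem continuous_wedge [FiniteDimensional ℝ E] {Z : Type*} [TopologicalSpace Z]
    {f g : Z → E →L[ℝ] ℝ} (hf : Continuous f) (hg : Continuous g) :
    Continuous fun z => wedge (f z) (g z) := by
  let W : (E →L[ℝ] ℝ) →ₗ[ℝ] (E →L[ℝ] ℝ) →ₗ[ℝ] E [⋀^Fin 2]→L[ℝ] ℝ :=
    LinearMap.mk₂ ℝ wedge
      (fun a b c => by ext v; simp; ring) (fun r a b => by ext v; simp; ring)
      (fun a b c => by ext v; simp; ring) (fun r a b => by ext v; simp; ring)
  exact (W.toContinuousBilinearMap.continuous.comp hf).clm_apply hg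

end Wedge

theorem smul_eq_cross_smul_rot {b w : Plane} (h : dot b w = 0) :
    dot b b • w = cross b w • rot b := by
  apply plane_ext
  · simp only [PiLp.smul_apply, smul_eq_mul, rot_zero]
    simp only [dot, cross] at h ⊢
    linear_combination b 0 * h
  · simp only [PiLp.smul_apply, smul_eq_mul, rot_one]
    simp only [dot, cross] at h ⊢
    linear_combination b 1 * h

theorem exists_kernel {a b c d : ℝ} (h : a * d - b * c = 0) :
    ∃ x y : ℝ, (x ≠ 0 ∨ y ≠ 0) ∧ x * a + y * b = 0 ∧ x * c + y * d = 0 := by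
  by_cases h0 : a = 0 ∧ b = 0
  · by_cases h1 : c = 0 ∧ d = 0
    · exact ⟨1, 0, Or.inl one_ne_zero, by simp [h0], by simp [h1]⟩
    · refine ⟨d, -c, ?_, by simp [h0], by ring⟩
      by_contra hcon
      push Not at hcon
      exact h1 ⟨by linarith [hcon.2], hcon.1⟩
  · refine ⟨b, -a, ?_, by ring, by linarith⟩
    by_contra hcon
    push Not at hcon
    exact h0 ⟨by linarith [hcon.2], hcon.1⟩

theorem inner_eq_dot (v w : Plane) : inner ℝ v w = dot v w := by
  simp [PiLp.inner_apply, Fin.sum_univ_two, dot]; ring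

theorem _root_.HasFDerivAt.dot_self {F : Type*} [NormedAddCommGroup F] [NormedSpace ℝ F]
    {f : F → Plane} {f' : F →L[ℝ] Plane} {u : F} (hf : HasFDerivAt f f' u) :
    HasFDerivAt (fun x => dot (f x) (f x)) (2 • (innerSL ℝ (f u)).comp f') u := by
  have := hf.norm_sq
  simp only [norm_sq_eq_dot] at this
  exact this

namespace Spider

variable {s : Spider}

/-- The velocities that preserve the lengths of the bars to first order. -/
def IsTangent (s : Spider) (q v : Position) : Prop :=
  ∀ i, dot (q.2 i - s.foot i) (v.2 i) = 0 ∧ dot (q.1 - q.2 i) (v.1 - v.2 i) = 0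

theorem isTangent_fderiv {U : Set Plane} {φ : Plane → Position}
    (h : IsLocalParam s.configSpace U φ) {u : Plane} (hu : u ∈ U) (e : Plane) :
    s.IsTangent (φ u) (fderiv ℝ φ u e) := by
  intro i
  have hφ : HasFDerivAt φ (fderiv ℝ φ u) u :=
    ((h.contDiffAt hu).differentiableAt (by simp)).hasFDerivAt
  have h2 : HasFDerivAt (fun v => (φ v).2 i)
      ((ContinuousLinearMap.proj i).comp ((ContinuousLinearMap.snd ℝ Plane (Fin 3 → Plane)).comp
        (fderiv ℝ φ u))) u :=
    hasFDerivAt_pi'.mp hφ.snd i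
  have h1 : HasFDerivAt (fun v => (φ v).1)
      ((ContinuousLinearMap.fst ℝ Plane (Fin 3 → Plane)).comp (fderiv ℝ φ u)) u :=
    hφ.fst
  have aux : ∀ {f : Plane → Plane} {f' : Plane →L[ℝ] Plane} {r : ℝ}, HasFDerivAt f f' u →
      (∀ v ∈ U, dot (f v) (f v) = r) → dot (f u) (f' e) = 0 := by
    intro f f' r hf hr
    have h3 : HasFDerivAt (fun x => dot (f x) (f x)) (0 : Plane →L[ℝ] ℝ) u :=
      (hasFDerivAt_const r u).congr_of_eventuallyEq <| by
        filter_upwards [h.isOpen.mem_nhds hu] with v hv using hr v hv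
    have h4 := congrArg (fun L => L e) (hf.dot_self.unique h3)
    have h5 : 2 * Inner.inner ℝ (f u) (f' e) = 0 := by simpa using h4
    rw [inner_eq_dot] at h5
    linarith
  exact ⟨aux (h2.sub_const (s.foot i)) fun v hv => (s.mem_configSpace.mp (h.mem hv) i).1,
    aux (h1.sub h2) fun v hv => (s.mem_configSpace.mp (h.mem hv) i).2⟩

/-- The linear form `v ↦ v.1 n`. -/
def centreForm (n : Fin 2) : Position →L[ℝ] ℝ :=
  (EuclideanSpace.proj n : Plane →L[ℝ] ℝ).comp (ContinuousLinearMap.fst ℝ Plane (Fin 3 → Plane))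

/-- The linear form `v ↦ v.2 i n`. -/
def elbowForm (i : Fin 3) (n : Fin 2) : Position →L[ℝ] ℝ :=
  (EuclideanSpace.proj n : Plane →L[ℝ] ℝ).comp ((ContinuousLinearMap.proj i).comp
    (ContinuousLinearMap.snd ℝ Plane (Fin 3 → Plane)))

/-- The angular velocity of the lower bar of leg `i`, as a linear form. -/
def lowerForm (s : Spider) (q : Position) (i : Fin 3) : Position →L[ℝ] ℝ :=
  ((q.2 i - s.foot i) 0 / s.lower i ^ 2) • elbowForm i 1 -
    ((q.2 i - s.foot i) 1 / s.lower i ^ 2) • elbowForm i 0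

/-- The angular velocity of the upper bar of leg `i`, as a linear form. -/
def upperForm (s : Spider) (q : Position) (i : Fin 3) : Position →L[ℝ] ℝ :=
  ((q.1 - q.2 i) 0 / s.upper i ^ 2) • (centreForm 1 - elbowForm i 1) -
    ((q.1 - q.2 i) 1 / s.upper i ^ 2) • (centreForm 0 - elbowForm i 0)

theorem continuous_lowerForm (i : Fin 3) : Continuous fun q => s.lowerForm q i := by
  unfold lowerForm
  simp only [PiLp.sub_apply]
  fun_prop

theorem continuous_upperForm (i : Fin 3) : Continuous fun q => s.upperForm q i := by
  unfold upperForm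
  simp only [PiLp.sub_apply]
  fun_prop

theorem lowerForm_apply {q v : Position} (hq : q ∈ s.configSpace) (hv : s.IsTangent q v)
    (i : Fin 3) : v.2 i = s.lowerForm q i v • rot (q.2 i - s.foot i) := by
  have h := smul_eq_cross_smul_rot (hv i).1
  have hl := s.lower_pos i
  rw [(s.mem_configSpace.mp hq i).1] at h
  have h1 : s.lowerForm q i v = (s.lower i ^ 2)⁻¹ * cross (q.2 i - s.foot i) (v.2 i) := by
    simp only [lowerForm, elbowForm, cross, PiLp.sub_apply]
    simp
    ring
  rw [h1, mul_smul, ← h, inv_smul_smul₀ (by positivity)]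

theorem upperForm_apply {q v : Position} (hq : q ∈ s.configSpace) (hv : s.IsTangent q v)
    (i : Fin 3) : v.1 - v.2 i = s.upperForm q i v • rot (q.1 - q.2 i) := by
  have h := smul_eq_cross_smul_rot (hv i).2
  have hl := s.upper_pos i
  rw [(s.mem_configSpace.mp hq i).2] at h
  have h1 : s.upperForm q i v = (s.upper i ^ 2)⁻¹ * cross (q.1 - q.2 i) (v.1 - v.2 i) := by
    simp only [upperForm, centreForm, elbowForm, cross, PiLp.sub_apply]
    simp
    ring
  rw [h1, mul_smul, ← h, inv_smul_smul₀ (by positivity)]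

/-- Twice the signed area of the triangle formed by leg `i`. -/
def bend (s : Spider) (q : Position) (i : Fin 3) : ℝ := cross (q.2 i - s.foot i) (q.1 - q.2 i)

/-- The form that orients the configuration space where leg `i` only may be aligned. -/
def angleArea (s : Spider) (q : Position) (i : Fin 3) : Position [⋀^Fin 2]→L[ℝ] ℝ :=
  wedge (s.lowerForm q i) (s.upperForm q i)

/-- The form that orients the configuration space where legs `i` and `j` only may be aligned. -/
def bendArea (s : Spider) (q : Position) (i j : Fin 3) : Position [⋀^Fin 2]→L[ℝ] ℝ :=
  wedge (s.upperForm q i - s.lowerForm q i) (s.upperForm q j - s.lowerForm q j)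

/-- A form that orients the configuration space. -/
def orientation (s : Spider) (i j k : Fin 3) (q : Position) : Position [⋀^Fin 2]→L[ℝ] ℝ :=
  (s.bend q j * s.bend q k) • s.angleArea q i + (s.bend q i * s.bend q k) • s.angleArea q j +
  (s.bend q i * s.bend q j) • s.angleArea q k +
  (s.bend q k * cross (q.1 - s.foot i) (q.1 - s.foot j)) • s.bendArea q i j +
  (s.bend q j * cross (q.1 - s.foot i) (q.1 - s.foot k)) • s.bendArea q i k +
  (s.bend q i * cross (q.1 - s.foot j) (q.1 - s.foot k)) • s.bendArea q j k

theorem continuous_orientation (i j k : Fin 3) : Continuous (s.orientation i j k) := by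
  have h1 : ∀ i, Continuous fun q => s.bend q i := fun i => by unfold bend; fun_prop
  have h2 : ∀ i, Continuous fun q => s.angleArea q i := fun i =>
    continuous_wedge (continuous_lowerForm i) (continuous_upperForm i)
  have h3 : ∀ i j, Continuous fun q => s.bendArea q i j := fun i j =>
    continuous_wedge ((continuous_upperForm i).sub (continuous_lowerForm i))
      ((continuous_upperForm j).sub (continuous_lowerForm j))
  unfold orientation
  fun_prop

/-- The determinant and `bendArea` both change sign with the order of the pair of legs, so their
product does not. Thanks to this symmetry the legs that may be aligned can be given any labels. -/
theorem orientation_swap_left (i j k : Fin 3) (q : Position) :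
    s.orientation j i k q = s.orientation i j k q := by
  ext v
  simp only [orientation, angleArea, bendArea, ContinuousAlternatingMap.add_apply,
    ContinuousAlternatingMap.smul_apply, wedge_apply, smul_eq_mul, cross]
  ring

theorem orientation_swap_right (i j k : Fin 3) (q : Position) :
    s.orientation i k j q = s.orientation i j k q := by
  ext v
  simp only [orientation, angleArea, bendArea, ContinuousAlternatingMap.add_apply,
    ContinuousAlternatingMap.smul_apply, wedge_apply, smul_eq_mul, cross]
  ring

theorem orientation_eq {i j k : Fin 3} (hij : i ≠ j) (hki : k ≠ i) (hkj : k ≠ j) (q : Position) :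
    s.orientation i j k q = s.orientation 0 1 2 q := by
  fin_cases i <;> fin_cases j <;> fin_cases k <;> simp at hij hki hkj ⊢
  · exact orientation_swap_right _ _ _ q
  · exact orientation_swap_left _ _ _ q
  · exact (orientation_swap_right _ _ _ q).trans (orientation_swap_left _ _ _ q)
  · exact (orientation_swap_left _ _ _ q).trans (orientation_swap_right _ _ _ q)
  · exact (orientation_swap_left _ _ _ q).trans
      ((orientation_swap_right _ _ _ q).trans (orientation_swap_left _ _ _ q))

section Tangent

variable {q : Position} (hq : q ∈ s.configSpace)

include hq

theorem fst_eq_of_isTangent {v : Position} (hv : s.IsTangent q v) (i : Fin 3) :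
    v.1 = s.lowerForm q i v • rot (q.2 i - s.foot i) + s.upperForm q i v • rot (q.1 - q.2 i) := by
  rw [← lowerForm_apply hq hv, ← upperForm_apply hq hv]; abel

/-- The velocity of the centre is the sum of the velocities of the two bars, each normal to its bar;
the Jacobian of this change of coordinates is the determinant of the bars. -/
theorem bend_mul_angleArea {v w : Position} (hv : s.IsTangent q v) (hw : s.IsTangent q w)
    (i : Fin 3) : s.bend q i * s.angleArea q i ![v, w] = cross v.1 w.1 := by
  conv_rhs => rw [fst_eq_of_isTangent hq hv i, fst_eq_of_isTangent hq hw i]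
  simp only [angleArea, wedge_apply, bend, cross, PiLp.add_apply, PiLp.smul_apply, smul_eq_mul,
    rot_zero, rot_one, Matrix.cons_val_zero, Matrix.cons_val_one]
  ring

/-- Both sides are minus half of the rate of change of the squared distance between centre and foot,
computed from the bending angle and from the motion of the centre. -/
theorem bend_mul_rel {v : Position} (hv : s.IsTangent q v) (i : Fin 3) :
    s.bend q i * (s.upperForm q i v - s.lowerForm q i v) = -dot (q.1 - s.foot i) v.1 := by
  rw [fst_eq_of_isTangent hq hv i]
  simp only [bend, cross, dot, PiLp.add_apply, PiLp.smul_apply, smul_eq_mul, PiLp.sub_apply,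
    rot_zero, rot_one]
  ring

/-- Substitute the rate of bending of leg `j` and express the velocity of the centre by leg `i`.
There is no division by `bend q j`, so the relation remains valid where leg `j` is aligned. -/
theorem bend_mul_bendArea_right {v w : Position} (hv : s.IsTangent q v) (hw : s.IsTangent q w)
    (i j : Fin 3) : s.bend q j * s.bendArea q i j ![v, w] =
      cross (q.1 - s.foot i) (q.1 - s.foot j) * s.angleArea q i ![v, w] := by
  have h1 := bend_mul_rel hq hv j
  have h2 := bend_mul_rel hq hw j
  rw [fst_eq_of_isTangent hq hv i] at h1
  rw [fst_eq_of_isTangent hq hw i] at h2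
  simp only [angleArea, bendArea, wedge_apply, sub_apply,
    Matrix.cons_val_zero, Matrix.cons_val_one]
  have : s.bend q j * ((s.upperForm q i v - s.lowerForm q i v) *
      (s.upperForm q j w - s.lowerForm q j w) - (s.upperForm q i w - s.lowerForm q i w) *
      (s.upperForm q j v - s.lowerForm q j v)) =
      (s.upperForm q i v - s.lowerForm q i v) *
      (s.bend q j * (s.upperForm q j w - s.lowerForm q j w)) -
      (s.upperForm q i w - s.lowerForm q i w) *
      (s.bend q j * (s.upperForm q j v - s.lowerForm q j v)) := by ring
  rw [this, h1, h2]
  simp only [cross, dot, PiLp.add_apply, PiLp.smul_apply, smul_eq_mul, PiLp.sub_apply,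
    rot_zero, rot_one]
  ring

theorem bend_mul_bendArea_left {v w : Position} (hv : s.IsTangent q v) (hw : s.IsTangent q w)
    (i j : Fin 3) : s.bend q i * s.bendArea q i j ![v, w] =
      cross (q.1 - s.foot i) (q.1 - s.foot j) * s.angleArea q j ![v, w] := by
  have h := bend_mul_bendArea_right hq hv hw j i
  have e1 : s.bendArea q j i ![v, w] = -s.bendArea q i j ![v, w] := by
    simp only [bendArea, wedge_apply]; ring
  have e2 : cross (q.1 - s.foot j) (q.1 - s.foot i) = -cross (q.1 - s.foot i) (q.1 - s.foot j) := by
    simp only [cross]; ring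
  rw [e1, e2] at h
  linarith

/-- A leg that is not aligned does not move if the centre does not. -/
theorem snd_eq_zero_of_bend {v : Position} (hv : s.IsTangent q v) {i : Fin 3}
    (hi : s.bend q i ≠ 0) (h : v.1 = 0) : v.2 i = 0 := by
  have h1 := fst_eq_of_isTangent hq hv i
  rw [h] at h1
  have h2 : s.bend q i * s.lowerForm q i v = 0 := by
    have g0 := congrArg (fun x : Plane => x 0) h1
    have g1 := congrArg (fun x : Plane => x 1) h1
    simp only [PiLp.zero_apply, PiLp.add_apply, PiLp.smul_apply, smul_eq_mul, rot_zero,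
      rot_one] at g0 g1
    unfold bend cross
    linear_combination (-(q.1 - q.2 i) 0) * g0 - (q.1 - q.2 i) 1 * g1
  rw [lowerForm_apply hq hv i, (mul_eq_zero.mp h2).resolve_left hi, zero_smul]

end Tangent

theorem bend_eq (q : Position) (i : Fin 3) :
    s.bend q i = -cross (q.1 - s.foot i) (q.2 i - s.foot i) := by
  simp only [bend, cross, PiLp.sub_apply]; ring

theorem bend_ne_zero {q : Position} (hq : q ∈ s.configSpace) {i : Fin 3}
    (h : s.legDisc i q.1 ≠ 0) : s.bend q i ≠ 0 := by
  rw [bend_eq, neg_ne_zero]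
  exact cross_ne_zero_of_legDisc hq h

theorem IsTangent.lincomb {q v w : Position} (hv : s.IsTangent q v) (hw : s.IsTangent q w)
    (a b : ℝ) : s.IsTangent q (a • v + b • w) := by
  intro i
  have hv := hv i
  have hw := hw i
  simp only [dot, Prod.fst_add, Prod.snd_add, Prod.smul_fst, Prod.smul_snd, Pi.add_apply,
    Pi.smul_apply, PiLp.add_apply, PiLp.sub_apply, PiLp.smul_apply, smul_eq_mul] at *
  exact ⟨by linear_combination a * hv.1 + b * hw.1, by linear_combination a * hv.2 + b * hw.2⟩

/-- Write `s_n` for `bend q n`. Multiplied by `s_j s_k`, the form becomes `angleArea q i` times the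
sum of the squares of its six coefficients, and the square of `s_j s_k` is positive. Moreover
`angleArea q i` does not vanish: a tangent vector that turns neither bar of leg `i` fixes the
centre, and with it the elbows of the two legs that are not aligned. -/
theorem orientation_ne_zero_of_angles {q v w : Position} (hq : q ∈ s.configSpace)
    (hv : s.IsTangent q v) (hw : s.IsTangent q w)
    (hind : ∀ a b : ℝ, a • v + b • w = 0 → a = 0 ∧ b = 0) {i j k : Fin 3}
    (hall : ∀ n, n = i ∨ n = j ∨ n = k) (hj : s.bend q j ≠ 0) (hk : s.bend q k ≠ 0) :
    s.orientation i j k q ![v, w] ≠ 0 := by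
  have hΘ : s.angleArea q i ![v, w] ≠ 0 := by
    intro h0
    simp only [angleArea, wedge_apply, Matrix.cons_val_zero, Matrix.cons_val_one] at h0
    obtain ⟨a, b, hab, h1, h2⟩ := exists_kernel (a := s.lowerForm q i v) (b := s.lowerForm q i w)
      (c := s.upperForm q i v) (d := s.upperForm q i w) (by linarith)
    have hu := hv.lincomb hw a b
    have h1' : s.lowerForm q i (a • v + b • w) = 0 := by simpa using h1
    have h2' : s.upperForm q i (a • v + b • w) = 0 := by simpa using h2
    have hx : (a • v + b • w).1 = 0 := by
      rw [fst_eq_of_isTangent hq hu i, h1', h2']; simp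
    have h0 := hind a b (Prod.ext hx (funext fun n => by
      rcases hall n with rfl | rfl | rfl
      · rw [lowerForm_apply hq hu, h1']; simp
      · exact snd_eq_zero_of_bend hq hu hj hx
      · exact snd_eq_zero_of_bend hq hu hk hx))
    tauto
  have e1 := bend_mul_angleArea hq hv hw i
  have e2 := bend_mul_angleArea hq hv hw j
  have e3 := bend_mul_angleArea hq hv hw k
  have e4 := bend_mul_bendArea_right hq hv hw i j
  have e5 := bend_mul_bendArea_right hq hv hw i k
  have e6 := bend_mul_bendArea_left hq hv hw j k
  have e7 := bend_mul_bendArea_right hq hv hw j k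
  intro h0
  simp only [orientation, ContinuousAlternatingMap.add_apply, ContinuousAlternatingMap.smul_apply,
    smul_eq_mul] at h0
  rw [← e1] at e2 e3
  generalize s.bend q i = si at *
  generalize s.bend q j = sj at *
  generalize s.bend q k = sk at *
  generalize cross (q.1 - s.foot i) (q.1 - s.foot j) = kij at *
  generalize cross (q.1 - s.foot i) (q.1 - s.foot k) = kik at *
  generalize cross (q.1 - s.foot j) (q.1 - s.foot k) = kjk at *
  have : s.angleArea q i ![v, w] * ((sj * sk) ^ 2 + (si * sk) ^ 2 + (si * sj) ^ 2 +
      (sk * kij) ^ 2 + (sj * kik) ^ 2 + (si * kjk) ^ 2) = 0 := by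
    linear_combination (sj * sk) * h0 - (si * sk ^ 2) * e2 - (si * sj ^ 2) * e3 -
      sk ^ 2 * kij * e4 - sj ^ 2 * kik * e5 - si * sj * kjk * e7 - si * kjk ^ 2 * e2
  have hpos : 0 < (sj * sk) ^ 2 + (si * sk) ^ 2 + (si * sj) ^ 2 +
      (sk * kij) ^ 2 + (sj * kik) ^ 2 + (si * kjk) ^ 2 := by positivity
  exact (mul_ne_zero hΘ hpos.ne') this

/-- Only the summand with `bendArea q i j` survives. A tangent vector in its kernel turns the
straight legs `i` and `j` rigidly, so it moves the centre normally to two independent directions.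
Hence the centre rests, and so does everything else. -/
theorem orientation_ne_zero_of_bends {q v w : Position} (hq : q ∈ s.configSpace)
    (hv : s.IsTangent q v) (hw : s.IsTangent q w)
    (hind : ∀ a b : ℝ, a • v + b • w = 0 → a = 0 ∧ b = 0) {i j k : Fin 3}
    (hall : ∀ n, n = i ∨ n = j ∨ n = k) (hi : s.bend q i = 0) (hj : s.bend q j = 0)
    (hk : s.bend q k ≠ 0) (hx : cross (q.1 - s.foot i) (q.1 - s.foot j) ≠ 0) :
    s.orientation i j k q ![v, w] ≠ 0 := by
  simp only [orientation, ContinuousAlternatingMap.add_apply, ContinuousAlternatingMap.smul_apply,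
    smul_eq_mul, hi, hj, zero_mul, mul_zero, zero_add, add_zero]
  refine mul_ne_zero (mul_ne_zero hk hx) fun h0 => ?_
  simp only [bendArea, wedge_apply, Matrix.cons_val_zero, Matrix.cons_val_one] at h0
  obtain ⟨a, b, hab, h1, h2⟩ := exists_kernel
    (a := (s.upperForm q i - s.lowerForm q i) v) (b := (s.upperForm q i - s.lowerForm q i) w)
    (c := (s.upperForm q j - s.lowerForm q j) v) (d := (s.upperForm q j - s.lowerForm q j) w)
    (by linarith)
  have hu := hv.lincomb hw a b
  set u := a • v + b • w with hudef
  have key : ∀ n, a * (s.upperForm q n - s.lowerForm q n) v +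
      b * (s.upperForm q n - s.lowerForm q n) w = 0 →
      u.1 = s.lowerForm q n u • rot (q.1 - s.foot n) := by
    intro n hn
    have h1' : s.upperForm q n u = s.lowerForm q n u := by
      rw [← sub_eq_zero, ← sub_apply, hudef, map_add, map_smul, map_smul]
      exact hn
    conv_lhs => rw [fst_eq_of_isTangent hq hu n, h1', ← smul_add, ← map_add]
    congr 2
    abel
  have k1 := key i h1
  have k2 := key j h2
  have hzero : ∀ {y y' : Plane} {t t' : ℝ}, cross y y' ≠ 0 → t • rot y = t' • rot y' →
      t = 0 ∧ t' = 0 := by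
    intro y y' t t' hyy h
    have g0 := congrArg (fun x : Plane => x 0) h
    have g1 := congrArg (fun x : Plane => x 1) h
    simp only [PiLp.smul_apply, smul_eq_mul, rot_zero, rot_one] at g0 g1
    have e1 : cross y y' * t = 0 := by unfold cross; linear_combination y' 1 * g1 + y' 0 * g0
    have e2 : cross y y' * t' = 0 := by unfold cross; linear_combination y 1 * g1 + y 0 * g0
    exact ⟨(mul_eq_zero.mp e1).resolve_left hyy, (mul_eq_zero.mp e2).resolve_left hyy⟩
  obtain ⟨t1, t2⟩ := hzero hx (k1.symm.trans k2)
  have hx0 : u.1 = 0 := by rw [k1, t1, zero_smul]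
  have := hind a b (Prod.ext hx0 (funext fun n => by
      rcases hall n with rfl | rfl | rfl
      · rw [lowerForm_apply hq hu, t1]; simp
      · rw [lowerForm_apply hq hu, t2]; simp
      · exact snd_eq_zero_of_bend hq hu hk hx0))
  tauto

theorem IsThreeHoledTriangle.isOrientable (hs : s.IsThreeHoledTriangle) :
    IsOrientable s.configSpace := by
  refine ⟨s.orientation 0 1 2, (continuous_orientation 0 1 2).continuousOn,
    fun U φ hφ u hu h0 => ?_⟩
  have hq := hφ.mem hu
  set e₀ : Plane := !₂[1, 0]
  set e₁ : Plane := !₂[0, 1]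
  have hv := isTangent_fderiv hφ hu e₀
  have hw := isTangent_fderiv hφ hu e₁
  have hind : ∀ a b : ℝ, a • fderiv ℝ φ u e₀ + b • fderiv ℝ φ u e₁ = 0 → a = 0 ∧ b = 0 := by
    intro a b h
    rw [← map_smul, ← map_smul, ← map_add] at h
    have h1 : a • e₀ + b • e₁ = 0 := hφ.immersion u hu (h.trans (map_zero _).symm)
    have g0 := congrArg (fun x : Plane => x 0) h1
    have g1 := congrArg (fun x : Plane => x 1) h1
    simp [e₀, e₁] at g0 g1
    exact ⟨g0, g1⟩
  have h1 : s.orientation 0 1 2 (φ u) ![fderiv ℝ φ u e₀, fderiv ℝ φ u e₁] = 0 := by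
    refine Eq.trans (congrArg _ ?_) (DFunLike.congr_fun h0 ![e₀, e₁])
    ext n : 1
    fin_cases n <;> rfl
  rcases hs.aligned_cases (φ u).1 with ⟨i, hi⟩ | ⟨i, j, hij, hi, hj⟩
  · obtain ⟨j, hij⟩ : ∃ j, i ≠ j := ⟨i + 1, by clear hi; revert i; decide⟩
    obtain ⟨k, hki, hkj, hall⟩ := exists_third hij
    rw [← orientation_eq hij hki hkj] at h1
    exact orientation_ne_zero_of_angles hq hv hw hind hall (bend_ne_zero hq (hi j hij.symm))
      (bend_ne_zero hq (hi k hki)) h1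
  · obtain ⟨k, hki, hkj, hall⟩ := exists_third hij
    rw [← orientation_eq hij hki hkj] at h1
    have hb : ∀ n, dist (φ u).1 (s.foot n) = s.outer n → s.bend (φ u) n = 0 := by
      intro n hn
      have h2 := legDisc_eq_zero.mpr (Or.inr hn)
      rw [legDisc_eq_cross_sq hq] at h2
      rw [bend_eq, (pow_eq_zero_iff two_ne_zero).mp h2, neg_zero]
    refine orientation_ne_zero_of_bends hq hv hw hind hall (hb i hi) (hb j hj)
      (bend_ne_zero hq (hs.legDisc_ne_zero_of_corner hij hki hkj
        (s.fst_mem_workspace hq) hi hj)) (fun h2 => hs.cross_ne_zero hij hi hj ?_) h1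
    rw [← h2]
    simp only [cross, PiLp.sub_apply]
    ring

end Spider


/-! ### Indices of binary quadratic forms -/

theorem hasIndex_zero {B : Plane →L[ℝ] Plane →L[ℝ] ℝ} (h : ∀ v, v ≠ 0 → 0 < B v v) :
    HasIndex B 0 :=
  ⟨⊥, ⊤, isCompl_bot_top, finrank_bot ℝ Plane,
    fun _ hv h0 => absurd ((Submodule.mem_bot ℝ).mp hv) h0, fun v _ h0 => h v h0⟩

theorem hasIndex_two {B : Plane →L[ℝ] Plane →L[ℝ] ℝ} (h : ∀ v, v ≠ 0 → B v v < 0) :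
    HasIndex B 2 :=
  ⟨⊤, ⊥, isCompl_top_bot, by simp, fun v _ h0 => h v h0,
    fun _ hv h0 => absurd ((Submodule.mem_bot ℝ).mp hv) h0⟩

/-- The form keeps its sign on each of the two lines, so they meet only in zero and, in the plane,
are complementary. -/
theorem hasIndex_one_of_pos_neg {B : Plane →L[ℝ] Plane →L[ℝ] ℝ} {v w : Plane} (hv : B v v < 0)
    (hw : 0 < B w w) : HasIndex B 1 := by
  have hv0 : v ≠ 0 := by rintro rfl; simp at hv
  have hw0 : w ≠ 0 := by rintro rfl; simp at hw
  have hN : ∀ x ∈ ℝ ∙ v, x ≠ 0 → B x x < 0 := by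
    intro x hx h0
    obtain ⟨c, rfl⟩ := Submodule.mem_span_singleton.mp hx
    have hc : c ≠ 0 := by rintro rfl; simp at h0
    have : B (c • v) (c • v) = c ^ 2 * B v v := by simp; ring
    rw [this]
    have : 0 < c ^ 2 := by positivity
    nlinarith
  have hP : ∀ x ∈ ℝ ∙ w, x ≠ 0 → 0 < B x x := by
    intro x hx h0
    obtain ⟨c, rfl⟩ := Submodule.mem_span_singleton.mp hx
    have hc : c ≠ 0 := by rintro rfl; simp at h0
    have : B (c • w) (c • w) = c ^ 2 * B w w := by simp; ring
    rw [this]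
    positivity
  have hd : Disjoint (ℝ ∙ v) (ℝ ∙ w) := by
    rw [Submodule.disjoint_def]
    intro x hx hx'
    by_contra h0
    exact lt_asymm (hN x hx h0) (hP x hx' h0)
  refine ⟨ℝ ∙ v, ℝ ∙ w, ⟨hd, ?_⟩, finrank_span_singleton hv0, hN, hP⟩
  rw [codisjoint_iff]
  apply Submodule.eq_top_of_finrank_eq
  have := Submodule.finrank_sup_add_finrank_inf_eq (ℝ ∙ v) (ℝ ∙ w)
  rw [hd.eq_bot, finrank_bot, finrank_span_singleton hv0, finrank_span_singleton hw0] at this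
  rw [finrank_euclideanSpace_fin]
  omega

theorem hasIndex_one {B : Plane →L[ℝ] Plane →L[ℝ] ℝ} {a b c : ℝ}
    (hB : ∀ v, B v v = a * v 0 ^ 2 + 2 * b * v 0 * v 1 + c * v 1 ^ 2) (h : a * c - b ^ 2 < 0) :
    HasIndex B 1 := by
  have h1 : ∀ x y : ℝ, B !₂[x, y] !₂[x, y] = a * x ^ 2 + 2 * b * x * y + c * y ^ 2 :=
    fun x y => hB _
  -- For `a ≠ 0` the vector `(-b, a)` is orthogonal to `(1, 0)` with respect to the form and has the
  -- value `a (a c - b ^ 2)`. For `a = 0` the form is `2 b x y + c y ^ 2`, and `x` is chosen so that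
  -- the values at `y = 1` are `-1` and `1`.
  rcases lt_trichotomy a 0 with ha | ha | ha
  · refine hasIndex_one_of_pos_neg (v := !₂[1, 0]) (w := !₂[-b, a]) ?_ ?_
    · rw [h1]; linarith
    · rw [h1]; nlinarith [mul_pos_of_neg_of_neg ha h]
  · subst ha
    have hb : b ≠ 0 := by rintro rfl; simp at h
    refine hasIndex_one_of_pos_neg (v := !₂[(-1 - c) / (2 * b), 1]) (w := !₂[(1 - c) / (2 * b), 1])
      ?_ ?_
    · rw [h1, show 0 * ((-1 - c) / (2 * b)) ^ 2 + 2 * b * ((-1 - c) / (2 * b)) * 1 + c * 1 ^ 2 = -1 by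
        field_simp; ring]
      norm_num
    · rw [h1, show 0 * ((1 - c) / (2 * b)) ^ 2 + 2 * b * ((1 - c) / (2 * b)) * 1 + c * 1 ^ 2 = 1 by
        field_simp; ring]
      norm_num
  · refine hasIndex_one_of_pos_neg (v := !₂[-b, a]) (w := !₂[1, 0]) ?_ ?_
    · rw [h1]; nlinarith [mul_neg_of_pos_of_neg ha h]
    · rw [h1]; linarith

/-! ### Derivatives in the charts -/

/-- The coordinate forms of the plane. -/
abbrev planeForm (n : Fin 2) : Plane →L[ℝ] ℝ := EuclideanSpace.proj n

theorem hasFDerivAt_planeForm (n : Fin 2) (u : Plane) :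
    HasFDerivAt (fun v : Plane => v n) (planeForm n) u :=
  (planeForm n).hasFDerivAt

theorem hasFDerivAt_dot_dir (n : Fin 2) (D : Plane) (u : Plane) :
    HasFDerivAt (fun v : Plane => dot (dir (v n)) D) (cross (dir (u n)) D • planeForm n) u := by
  have h := (((hasFDerivAt_planeForm n u).cos.mul_const (D 0)).add
    ((hasFDerivAt_planeForm n u).sin.mul_const (D 1)))
  refine h.congr_fderiv ?_
  ext w
  simp [cross]
  ring

theorem hasFDerivAt_cross_dir (n : Fin 2) (D : Plane) (u : Plane) :
    HasFDerivAt (fun v : Plane => cross (dir (v n)) D) (-dot (dir (u n)) D • planeForm n) u := by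
  have h := (((hasFDerivAt_planeForm n u).cos.mul_const (D 1)).sub
    ((hasFDerivAt_planeForm n u).sin.mul_const (D 0)))
  refine h.congr_fderiv ?_
  ext w
  simp [dot]
  ring

/-- The energy in terms of the angles of the bars of one leg. -/
def angleEnergy (K α β γ : ℝ) (D : Plane) (v : Plane) : ℝ :=
  K + α * Real.cos (v 1 - v 0) - β * dot (dir (v 0)) D - γ * dot (dir (v 1)) D

/-- The derivative of the energy in terms of the angles of the bars of one leg. -/
def angleForce (α β γ : ℝ) (D : Plane) (v : Plane) : Plane →L[ℝ] ℝ :=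
  (α * Real.sin (v 1 - v 0) - β * cross (dir (v 0)) D) • planeForm 0 +
    (-(α * Real.sin (v 1 - v 0)) - γ * cross (dir (v 1)) D) • planeForm 1

theorem fderiv_angleEnergy (K α β γ : ℝ) (D : Plane) :
    fderiv ℝ (angleEnergy K α β γ D) = angleForce α β γ D := by
  ext1 u
  have h := (((((hasFDerivAt_planeForm 1 u).sub (hasFDerivAt_planeForm 0 u)).cos.const_mul α).const_add
    K).sub ((hasFDerivAt_dot_dir 0 D u).const_mul β)).sub ((hasFDerivAt_dot_dir 1 D u).const_mul γ)
  refine (h.congr_fderiv ?_).fderiv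
  ext w
  simp [angleForce]
  ring

theorem fderiv_angleForce (α β γ : ℝ) (D u v : Plane) :
    fderiv ℝ (angleForce α β γ D) u v v =
      (-(α * Real.cos (u 1 - u 0)) + β * dot (dir (u 0)) D) * v 0 ^ 2 +
      2 * (α * Real.cos (u 1 - u 0)) * v 0 * v 1 +
      (-(α * Real.cos (u 1 - u 0)) + γ * dot (dir (u 1)) D) * v 1 ^ 2 := by
  have hs := ((hasFDerivAt_planeForm 1 u).sub (hasFDerivAt_planeForm 0 u)).sin.const_mul α
  have h := ((hs.sub ((hasFDerivAt_cross_dir 0 D u).const_mul β)).smul_const (planeForm 0)).add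
    ((hs.neg.sub ((hasFDerivAt_cross_dir 1 D u).const_mul γ)).smul_const (planeForm 1))
  have h' : fderiv ℝ (angleForce α β γ D) u = _ := h.fderiv
  rw [h']
  simp
  ring

namespace Spider

variable {s : Spider}

/-- The derivative of the cosines of the coordinates. -/
def cosinesDeriv (v : Plane) : Plane →L[ℝ] Plane :=
  (-Real.sin (v 0)) • (planeForm 0).smulRight !₂[1, 0] +
    (-Real.sin (v 1)) • (planeForm 1).smulRight !₂[0, 1]

theorem hasFDerivAt_cosines (u : Plane) : HasFDerivAt cosines (cosinesDeriv u) u := by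
  rw [← hasFDerivWithinAt_univ, hasFDerivWithinAt_euclidean]
  intro n
  rw [hasFDerivWithinAt_univ]
  fin_cases n
  · refine (hasFDerivAt_planeForm 0 u).cos.congr_fderiv ?_
    ext w
    simp [cosinesDeriv]
  · refine (hasFDerivAt_planeForm 1 u).cos.congr_fderiv ?_
    ext w
    simp [cosinesDeriv]

/-- The first derivative of the cosines vanishes at the origin, so only the first derivative of `G`,
applied to the second derivative of the cosines, is left in the Hessian. It is diagonal, with the
partial derivatives of `G` and a minus sign. -/
theorem fderiv_fderiv_comp_cosines {G : Plane → ℝ} (hG : ContDiffAt ℝ ∞ G (cosines 0))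
    {g₀ g₁ : ℝ} (hg : ∀ w, fderiv ℝ G (cosines 0) w = g₀ * w 0 + g₁ * w 1) :
    fderiv ℝ (G ∘ cosines) 0 = 0 ∧
    ∀ v, fderiv ℝ (fderiv ℝ (G ∘ cosines)) 0 v v = -(g₀ * v 0 ^ 2 + g₁ * v 1 ^ 2) := by
  have hc0 : cosinesDeriv 0 = 0 := by ext w : 1; simp [cosinesDeriv]
  have h1 : fderiv ℝ (G ∘ cosines) =ᶠ[𝓝 0] fun v => (fderiv ℝ G (cosines v)).comp (cosinesDeriv v) := by
    have e2 : ∀ᶠ x in 𝓝 (0 : Plane), DifferentiableAt ℝ G (cosines x) :=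
      contDiff_cosines.continuous.continuousAt.eventually
        (((hG.of_le (m := 1) (by simp)).eventually (by simp)).mono
          fun x hx => hx.differentiableAt (by simp))
    filter_upwards [e2] with x hx using (hx.hasFDerivAt.comp x (hasFDerivAt_cosines x)).fderiv
  have h2 : HasFDerivAt cosinesDeriv
      (((-planeForm 0).smulRight ((planeForm 0).smulRight (!₂[1, 0] : Plane))) +
        ((-planeForm 1).smulRight ((planeForm 1).smulRight (!₂[0, 1] : Plane)))) 0 := by
    have h := ((hasFDerivAt_planeForm 0 0).sin.neg.smul_const
        ((planeForm 0).smulRight (!₂[1, 0] : Plane))).add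
      ((hasFDerivAt_planeForm 1 0).sin.neg.smul_const
        ((planeForm 1).smulRight (!₂[0, 1] : Plane)))
    refine h.congr_fderiv ?_
    simp
  have h3 : HasFDerivAt (fderiv ℝ G) (fderiv ℝ (fderiv ℝ G) (cosines 0)) (cosines 0) :=
    ((hG.fderiv_right (m := ∞) (by simp)).differentiableAt (by simp)).hasFDerivAt
  have h4 := (h3.comp 0 (hasFDerivAt_cosines 0)).clm_comp h2
  refine ⟨by rw [h1.eq_of_nhds, hc0, ContinuousLinearMap.comp_zero], fun v => ?_⟩
  have h5 : fderiv ℝ (fderiv ℝ (G ∘ cosines)) 0 = _ := h1.fderiv_eq.trans h4.fderiv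
  rw [h5]
  simp [hc0, hg]
  ring

/-! ### Critical positions of the energy and their indices -/

theorem contDiff_hooke : ContDiff ℝ ∞ s.hooke := by
  unfold hooke
  exact ContDiff.sum fun i _ => (contDiff_id.sub contDiff_const).norm_sq ℝ

theorem contDiff_energy : ContDiff ℝ ∞ s.energy := contDiff_hooke.comp contDiff_fst

/-- Leibniz's formula: the vectors from the feet to the centre of gravity add up to zero, so the
linear term disappears. Up to constants the energy is the squared distance from the centre of
gravity. -/
theorem hooke_eq (x : Plane) :
    s.hooke x = 3 * dot (x - s.centroid) (x - s.centroid) + s.hooke s.centroid := by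
  have e0 := three_mul_centroid (s := s) (i := 0) (j := 1) (k := 2) (by decide) (by decide)
    (by decide) 0
  have e1 := three_mul_centroid (s := s) (i := 0) (j := 1) (k := 2) (by decide) (by decide)
    (by decide) 1
  simp only [hooke, Fin.sum_univ_three, norm_sq_eq_dot, dot, PiLp.sub_apply]
  linear_combination (2 * (x 0 - s.centroid 0)) * e0 + (2 * (x 1 - s.centroid 1)) * e1

theorem hasFDerivAt_hooke (x : Plane) :
    HasFDerivAt s.hooke ((6 : ℝ) • innerSL ℝ (x - s.centroid)) x := by
  have h := (((hasFDerivAt_id x).sub_const s.centroid).dot_self.const_mul 3).add_const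
    (s.hooke s.centroid)
  have h2 : s.hooke = fun x => 3 * dot (x - s.centroid) (x - s.centroid) + s.hooke s.centroid :=
    funext hooke_eq
  rw [h2]
  refine h.congr_fderiv ?_
  ext w
  simp
  ring

theorem fderiv_hooke (x v : Plane) : fderiv ℝ s.hooke x v = 6 * dot (x - s.centroid) v := by
  rw [(hasFDerivAt_hooke x).fderiv, ← inner_eq_dot]
  rfl

theorem fderiv_fderiv_hooke (x v : Plane) :
    fderiv ℝ (fderiv ℝ s.hooke) x v v = 6 * dot v v := by
  have h1 : fderiv ℝ s.hooke = fun x => (6 : ℝ) • innerSL ℝ (x - s.centroid) :=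
    funext fun x => (hasFDerivAt_hooke x).fderiv
  have h2 : HasFDerivAt (fun x : Plane => (6 : ℝ) • innerSL ℝ (x - s.centroid))
      ((6 : ℝ) • (innerSL ℝ : Plane →L[ℝ] Plane →L[ℝ] ℝ)) x := by
    have h3 := ((6 : ℝ) • (innerSL ℝ : Plane →L[ℝ] Plane →L[ℝ] ℝ)).hasFDerivAt.comp x
      ((hasFDerivAt_id x).sub_const s.centroid)
    exact h3
  rw [h1, h2.fderiv, ← inner_eq_dot]
  rfl

/-- A position over the centre of gravity is a minimum. -/
theorem isMorsePointOn_zero {q : Position} (hq : q ∈ s.configSpace)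
    (h : ∀ i, s.legDisc i q.1 ≠ 0) (hz : q.1 = s.centroid) :
    IsMorsePointOn s.energy s.configSpace 0 q := by
  obtain ⟨U, φ, hφ, hu, hφq, hφ1⟩ := exists_chart_centre hq h
  have he : s.energy ∘ φ = s.hooke := funext fun v => congrArg s.hooke (hφ1 v)
  refine ⟨U, φ, q.1, hφ, hu, hφq, ?_, ?_⟩
  · rw [he]
    ext v
    rw [fderiv_hooke, hz, sub_self]
    simp [dot]
  · rw [he]
    refine hasIndex_zero fun v hv => ?_
    rw [fderiv_fderiv_hooke]
    have := dot_self_pos.mpr hv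
    linarith

/-- A critical position at which no leg is aligned lies over the centre of gravity. -/
theorem eq_centroid_of_isCriticalPointOn {q : Position} (hq : q ∈ s.configSpace)
    (h : ∀ i, s.legDisc i q.1 ≠ 0) (hc : IsCriticalPointOn s.energy s.configSpace q) :
    q.1 = s.centroid := by
  obtain ⟨U, φ, hφ, hu, hφq, hφ1⟩ := exists_chart_centre hq h
  have he : s.energy ∘ φ = s.hooke := funext fun v => congrArg s.hooke (hφ1 v)
  have h0 := hφ.fderiv_eq_zero_of_isCriticalPointOn contDiff_energy hu (hφq.symm ▸ hc)
  rw [he] at h0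
  have := fderiv_hooke (s := s) q.1 (q.1 - s.centroid)
  rw [h0, zero_apply] at this
  exact sub_eq_zero.mp (dot_self_eq_zero.mp (by linarith))

/-- The energy in terms of the angles of the bars of leg `i`. -/
theorem hooke_angles (i : Fin 3) (v : Plane) :
    s.hooke (s.foot i + s.lower i • dir (v 0) + s.upper i • dir (v 1)) =
      angleEnergy (3 * (s.lower i ^ 2 + s.upper i ^ 2 +
        dot (s.centroid - s.foot i) (s.centroid - s.foot i)) + s.hooke s.centroid)
        (6 * s.lower i * s.upper i) (6 * s.lower i) (6 * s.upper i) (s.centroid - s.foot i) v := by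
  have h0 := dot_dir_self (v 0)
  have h1 := dot_dir_self (v 1)
  rw [hooke_eq, angleEnergy, ← dot_dir]
  simp only [dot, PiLp.sub_apply, PiLp.add_apply, PiLp.smul_apply, smul_eq_mul] at *
  linear_combination (3 * s.lower i ^ 2) * h0 + (3 * s.upper i ^ 2) * h1

/-- The point at signed distance `t` from foot `i` on the line through the centre of gravity. -/
def ray (s : Spider) (i : Fin 3) (t : ℝ) : Plane :=
  s.foot i + (t / dist s.centroid (s.foot i)) • (s.centroid - s.foot i)

theorem cross_dir_eq_zero {v w : Plane} (hv : dot v v = 1) (hw : dot w w = 1)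
    (h : cross v w = 0) : w = v ∨ w = -v := by
  have h1 : dot v w ^ 2 = 1 := by
    have : dot v w ^ 2 + cross v w ^ 2 = dot v v * dot w w := by simp only [dot, cross]; ring
    rw [h, hv, hw] at this
    linarith
  have h2 : w = dot v w • v := by
    apply plane_ext <;> simp only [PiLp.smul_apply, smul_eq_mul] <;>
      simp only [dot, cross] at hv h ⊢
    · linear_combination (-w 0) * hv - v 1 * h
    · linear_combination (-w 1) * hv + v 0 * h
  rcases (sq_eq_sq_iff_eq_or_eq_neg.mp (h1.trans (one_pow 2).symm)) with h3 | h3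
  · left; rw [h2, h3, one_smul]
  · right; rw [h2, h3, neg_one_smul]

end Spider


theorem eq_smul_of_dot_eq {v w : Plane} {σ : ℝ} (hσ : σ ^ 2 = 1) (hv : dot v v = 1)
    (hw : dot w w = 1) (h : dot v w = σ) : w = σ • v := by
  rw [← sub_eq_zero, ← dot_self_eq_zero]
  simp only [dot, PiLp.sub_apply, PiLp.smul_apply, smul_eq_mul] at *
  linear_combination hw - 2 * σ * h + σ ^ 2 * hv - hσ

namespace Spider

variable {s : Spider}

/-- The signed distances from foot `i` of the critical positions of leg `i`. -/
def saddleRadius (s : Spider) (i : Fin 3) : Fin 3 → ℝ := ![s.outer i, s.inner i, -s.inner i]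

/-- An extreme reach is the equality case of the triangle inequality. The hypothesis is on squares,
so that folded legs need no distinction according to which bar is longer; `σ` is `1` for stretched
and `-1` for folded legs. -/
theorem dir_of_aligned {i : Fin 3} {α β σ : ℝ} (hσ : σ ^ 2 = 1) {x : Plane}
    (hx : x = s.foot i + s.lower i • dir α + s.upper i • dir β)
    (h : dist x (s.foot i) ^ 2 = (s.lower i + σ * s.upper i) ^ 2) :
    dir β = σ • dir α ∧ x - s.foot i = (s.lower i + σ * s.upper i) • dir α := by
  have hl := s.lower_pos i
  have hm := s.upper_pos i
  have hα := dot_dir_self α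
  have hβ := dot_dir_self β
  have e : x - s.foot i = s.lower i • dir α + s.upper i • dir β := by rw [hx]; abel
  rw [dist_sq_eq_dot, e] at h
  have h2 : dot (dir α) (dir β) = σ := by
    have : s.lower i * s.upper i * (dot (dir α) (dir β) - σ) = 0 := by
      simp only [dot, PiLp.add_apply, PiLp.smul_apply, smul_eq_mul] at *
      linear_combination (1 / 2) * h - (1 / 2) * s.lower i ^ 2 * hα -
        (1 / 2) * s.upper i ^ 2 * hβ + (1 / 2) * s.upper i ^ 2 * hσ
    have hlm := mul_pos hl hm
    exact sub_eq_zero.mp ((mul_eq_zero.mp this).resolve_left hlm.ne')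
  have h3 := eq_smul_of_dot_eq hσ hα hβ h2
  refine ⟨h3, ?_⟩
  rw [e, h3, smul_smul, ← add_smul, mul_comm]

/-- The derivative of the energy at an aligned critical position has index one. -/
theorem hasIndex_one_of_aligned {i : Fin 3} {u : Plane} {σ t : ℝ}
    (hd : 0 < dist s.centroid (s.foot i)) (ht : t ≠ 0)
    (hβ : dir (u 1) = σ • dir (u 0))
    (hy : (t / dist s.centroid (s.foot i)) • (s.centroid - s.foot i) =
      (s.lower i + σ * s.upper i) • dir (u 0))
    (h : σ * (dist s.centroid (s.foot i) - t) < 0) :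
    angleForce (6 * s.lower i * s.upper i) (6 * s.lower i) (6 * s.upper i) (s.centroid - s.foot i)
      u = 0 ∧
    HasIndex (fderiv ℝ (angleForce (6 * s.lower i * s.upper i) (6 * s.lower i) (6 * s.upper i)
      (s.centroid - s.foot i)) u) 1 := by
  have hl := s.lower_pos i
  have hm := s.upper_pos i
  have hα := dot_dir_self (u 0)
  have hD := dist_sq_eq_dot s.centroid (s.foot i)
  generalize dist s.centroid (s.foot i) = d at *
  generalize s.centroid - s.foot i = D at *
  have hc : cross (dir (u 0)) D = 0 := by
    have h1 := congrArg (cross (dir (u 0))) hy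
    rw [cross_smul_right, cross_smul_right] at h1
    have h2 : cross (dir (u 0)) (dir (u 0)) = 0 := by simp only [cross]; ring
    rw [h2, mul_zero] at h1
    exact (mul_eq_zero.mp h1).resolve_left (div_ne_zero ht hd.ne')
  have hw : dot (dir (u 0)) D ^ 2 = d ^ 2 := by
    have : dot (dir (u 0)) D ^ 2 + cross (dir (u 0)) D ^ 2 =
        dot (dir (u 0)) (dir (u 0)) * dot D D := by simp only [dot, cross]; ring
    rw [hc, hα, ← hD] at this
    linarith
  have htd : (s.lower i + σ * s.upper i) * dot (dir (u 0)) D = t * d := by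
    have h1 := congrArg (dot D) hy
    rw [dot_smul_right, dot_smul_right, ← hD] at h1
    have h2 : dot D (dir (u 0)) = dot (dir (u 0)) D := by simp only [dot]; ring
    rw [h2] at h1
    rw [← h1]
    field_simp
  have hw1 : dot (dir (u 1)) D = σ * dot (dir (u 0)) D := by
    rw [hβ]; simp only [dot, PiLp.smul_apply, smul_eq_mul]; ring
  have hc1 : cross (dir (u 1)) D = 0 := by
    have : cross (dir (u 1)) D = σ * cross (dir (u 0)) D := by
      rw [hβ]; simp only [cross, PiLp.smul_apply, smul_eq_mul]; ring
    rw [this, hc, mul_zero]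
  have hcos : Real.cos (u 1 - u 0) = σ := by
    rw [← dot_dir, hβ, dot_smul_right, hα, mul_one]
  have hsin : Real.sin (u 1 - u 0) = 0 := by
    rw [← cross_dir, hβ, cross_smul_right]
    simp only [cross]; ring
  refine ⟨?_, hasIndex_one (fun v => fderiv_angleForce _ _ _ D u v) ?_⟩
  · simp [angleForce, hc, hc1, hsin]
  · rw [hcos, hw1]
    generalize dot (dir (u 0)) D = w at *
    -- The determinant of the Hessian. With `w ^ 2 = d ^ 2` and `(l + σ m) w = t d` it collapses to
    -- a positive factor times `σ (d - t)`, negative by hypothesis.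
    have : (-(6 * s.lower i * s.upper i * σ) + 6 * s.lower i * w) *
        (-(6 * s.lower i * s.upper i * σ) + 6 * s.upper i * (σ * w)) -
        (6 * s.lower i * s.upper i * σ) ^ 2 =
        36 * s.lower i * s.upper i * d * (σ * (d - t)) := by
      linear_combination (36 * s.lower i * s.upper i * σ) * hw -
        (36 * s.lower i * s.upper i * σ) * htd
    rw [this]
    have : 0 < 36 * s.lower i * s.upper i * d := by positivity
    exact mul_neg_of_pos_of_neg this h

/-- The sign condition for a saddle: if the leg is stretched, the centre of gravity is nearer to the
foot than the critical point; if it is folded, the centre of gravity lies beyond both critical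
points on the inner circle. -/
theorem sign_cases {i : Fin 3} (κ : Fin 3) :
    ∃ σ : ℝ, σ ^ 2 = 1 ∧ s.saddleRadius i κ ^ 2 = (s.lower i + σ * s.upper i) ^ 2 ∧
      ∀ d, s.inner i < d → d < s.outer i → σ * (d - s.saddleRadius i κ) < 0 := by
  have hr := s.inner_sq i
  have := s.inner_pos i
  fin_cases κ
  · refine ⟨1, by norm_num, by simp [saddleRadius, outer], fun d _ hd => ?_⟩
    simp [saddleRadius]; linarith
  · refine ⟨-1, by norm_num, by simp [saddleRadius, hr, sub_eq_add_neg], fun d hd _ => ?_⟩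
    simp [saddleRadius]; linarith
  · refine ⟨-1, by norm_num, by simp [saddleRadius, hr, sub_eq_add_neg], fun d hd _ => ?_⟩
    simp [saddleRadius]; linarith

theorem saddleRadius_ne_zero (i κ : Fin 3) : s.saddleRadius i κ ≠ 0 := by
  have h1 := s.inner_pos i
  have h2 := s.outer_pos i
  fin_cases κ <;> simp [saddleRadius, h1.ne', h2.ne']

theorem saddleRadius_injective (i : Fin 3) : Function.Injective (s.saddleRadius i) := by
  have h1 := s.inner_pos i
  have h2 := s.inner_lt_outer i
  intro κ κ' h
  fin_cases κ <;> fin_cases κ' <;> simp [saddleRadius] at h ⊢ <;> linarith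

theorem ray_sub (i : Fin 3) (t : ℝ) : s.ray i t - s.foot i =
    (t / dist s.centroid (s.foot i)) • (s.centroid - s.foot i) := by
  rw [ray, add_sub_cancel_left]

/-- The energy in the chart at a corner. -/
theorem energy_bend {i j : Fin 3} {τ : Bool} {φ : Plane → Position}
    (h : ∀ u, (φ u).1 = s.bendCentre i j (sgn τ) (cosines u)) :
    s.energy ∘ φ = (s.hooke ∘ s.bendCentre i j (sgn τ)) ∘ cosines :=
  funext fun u => congrArg s.hooke (h u)

/-- The derivative of the squared distances in terms of the bending cosines. -/
theorem dot_fderiv_bendCentre {i j : Fin 3} (h : s.foot j ≠ s.foot i) (b : Bool) {c : Plane}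
    (hc : 0 < s.bendDisc i j c) (w : Plane) :
    dot (s.bendCentre i j (sgn b) c - s.foot i) (fderiv ℝ (s.bendCentre i j (sgn b)) c w) =
      s.lower i * s.upper i * w 0 ∧
    dot (s.bendCentre i j (sgn b) c - s.foot j) (fderiv ℝ (s.bendCentre i j (sgn b)) c w) =
      s.lower j * s.upper j * w 1 := by
  have hX : HasFDerivAt (s.bendCentre i j (sgn b)) (fderiv ℝ (s.bendCentre i j (sgn b)) c) c :=
    ((contDiffAt_bendCentre h hc).differentiableAt (by simp)).hasFDerivAt
  have hev : ∀ᶠ c' in 𝓝 c, 0 < s.bendDisc i j c' :=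
    continuous_bendDisc.continuousAt.eventually (lt_mem_nhds hc)
  have aux : ∀ (n : Fin 3) (k : Fin 2),
      (∀ c', 0 < s.bendDisc i j c' → s.sqDist n (s.bendCentre i j (sgn b) c') = s.reach n (c' k)) →
      dot (s.bendCentre i j (sgn b) c - s.foot n) (fderiv ℝ (s.bendCentre i j (sgn b)) c w) =
        s.lower n * s.upper n * w k := by
    intro n k hn
    have h1 := (hX.sub_const (s.foot n)).dot_self
    have h2 : HasFDerivAt (fun c' : Plane => s.reach n (c' k))
        ((2 * s.lower n * s.upper n) • planeForm k) c :=
      ((hasFDerivAt_planeForm k c).const_mul (2 * s.lower n * s.upper n)).const_add _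
    have h3 := h1.unique (h2.congr_of_eventuallyEq (hev.mono fun c' hc' => hn c' hc'))
    have h4 := congrArg (fun L => L w) h3
    have h5 : 2 * Inner.inner ℝ (s.bendCentre i j (sgn b) c - s.foot n)
        (fderiv ℝ (s.bendCentre i j (sgn b)) c w) = 2 * s.lower n * s.upper n * w k := by
      simpa [inner_sub_left] using h4
    rw [inner_eq_dot] at h5
    linarith
  exact ⟨aux i 0 fun c' hc' => (bendCentre_spec h b hc').1,
    aux j 1 fun c' hc' => (bendCentre_spec h b hc').2.1⟩

theorem IsMorsePointOn_unique {q : Position} {k k' : ℕ}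
    (h : IsMorsePointOn s.energy s.configSpace k q)
    (h' : IsMorsePointOn s.energy s.configSpace k' q) : k = k' := by
  obtain ⟨U, φ, u, hφ, hu, rfl, -, hk⟩ := h
  exact hk.unique (hφ.hasIndex_of_isMorsePointOn contDiff_energy hu h').2

theorem mem_of_isMorsePointOn {q : Position} {k : ℕ}
    (h : IsMorsePointOn s.energy s.configSpace k q) : q ∈ s.configSpace := by
  obtain ⟨U, φ, u, hφ, hu, rfl, -⟩ := h
  exact hφ.mem hu

theorem mem_of_isCriticalPointOn {q : Position}
    (h : IsCriticalPointOn s.energy s.configSpace q) : q ∈ s.configSpace := by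
  obtain ⟨U, φ, u, hφ, hu, rfl, -⟩ := h
  exact hφ.mem hu

/-- The number of positions over finitely many points with fibres of the same size. -/
theorem ncard_fibres {T : Finset Plane} {A : ℕ} (hT : ∀ x ∈ T, x ∈ s.workspace)
    (hA : ∀ x ∈ T, (s.aligned x).card = A) :
    {q | q ∈ s.configSpace ∧ q.1 ∈ T}.ncard = T.card * 2 ^ (3 - A) := by
  classical
  induction T using Finset.induction_on with
  | empty => simp
  | insert x T hx ih =>
    have e : {q | q ∈ s.configSpace ∧ q.1 ∈ insert x T} =
        {q | q ∈ s.configSpace ∧ q.1 = x} ∪ {q | q ∈ s.configSpace ∧ q.1 ∈ T} := by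
      ext q
      simp only [Finset.mem_insert, Set.mem_ofPred_eq, Set.mem_union]
      tauto
    have hfib : ∀ y ∈ s.workspace, {q | q ∈ s.configSpace ∧ q.1 = y}.Finite := fun y hy =>
      Set.finite_of_ncard_ne_zero (by rw [ncard_fibre hy]; positivity)
    have hfin : {q | q ∈ s.configSpace ∧ q.1 ∈ T}.Finite := by
      have : {q | q ∈ s.configSpace ∧ q.1 ∈ T} ⊆
          ⋃ y ∈ T, {q | q ∈ s.configSpace ∧ q.1 = y} := by
        rintro q ⟨h1, h2⟩
        simp only [Set.mem_iUnion]
        exact ⟨q.1, h2, h1, rfl⟩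
      exact (T.finite_toSet.biUnion fun y hy =>
        hfib y (hT y (Finset.mem_insert_of_mem hy))).subset this
    have hxW := hT x (Finset.mem_insert_self x T)
    rw [e, Set.ncard_union_eq ?_ (hfib x hxW) hfin, ncard_fibre hxW,
      hA x (Finset.mem_insert_self x T), ih (fun y hy => hT y (Finset.mem_insert_of_mem hy))
        (fun y hy => hA y (Finset.mem_insert_of_mem hy)), Finset.card_insert_of_notMem hx]
    · ring
    · rw [Set.disjoint_left]
      rintro q ⟨-, rfl⟩ ⟨-, h⟩
      exact hx h

namespace IsThreeHoledTriangle

variable (hs : s.IsThreeHoledTriangle)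

include hs

theorem dist_ray (i : Fin 3) (t : ℝ) : dist (s.ray i t) (s.foot i) = |t| := by
  have h := hs.dist_centroid_pos i
  rw [dist_eq_norm, ray_sub, norm_smul, ← dist_eq_norm, norm_div, Real.norm_eq_abs,
    Real.norm_of_nonneg h.le, div_mul_cancel₀ _ h.ne']

theorem dist_saddle (i κ : Fin 3) :
    dist (s.ray i (s.saddleRadius i κ)) (s.foot i) = s.outer i ∧ κ = 0 ∨
    dist (s.ray i (s.saddleRadius i κ)) (s.foot i) = s.inner i := by
  rw [hs.dist_ray]
  fin_cases κ
  · left; exact ⟨abs_of_pos (s.outer_pos i), rfl⟩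
  · right; exact abs_of_pos (s.inner_pos i)
  · right; exact (abs_neg _).trans (abs_of_pos (s.inner_pos i))

theorem saddle_strict {i j : Fin 3} (h : i ≠ j) (κ : Fin 3) :
    s.inner j < dist (s.ray i (s.saddleRadius i κ)) (s.foot j) ∧
    dist (s.ray i (s.saddleRadius i κ)) (s.foot j) < s.outer j := by
  rcases hs.dist_saddle i κ with ⟨h1, rfl⟩ | h1
  · exact ⟨hs.inner_lt_of_outer h h1, hs.exits i j h⟩
  · exact ⟨hs.inner_lt_of_inner h h1, hs.lt_outer_of_inner h h1⟩

theorem saddle_mem (i κ : Fin 3) : s.ray i (s.saddleRadius i κ) ∈ s.workspace := by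
  intro j
  by_cases hj : i = j
  · subst hj
    have := s.inner_lt_outer i
    rcases hs.dist_saddle i κ with ⟨h1, -⟩ | h1 <;> rw [h1] <;> constructor <;> linarith
  · have := hs.saddle_strict hj κ
    exact ⟨this.1.le, this.2.le⟩

theorem aligned_saddle (i κ : Fin 3) : s.aligned (s.ray i (s.saddleRadius i κ)) = {i} := by
  refine card_aligned_eq fun j => ?_
  rw [Finset.mem_singleton, legDisc_eq_zero]
  by_cases hj : i = j
  · subst hj
    have := hs.dist_saddle i κ
    tauto
  · have := hs.saddle_strict hj κ
    constructor
    · rintro (h | h) <;> linarith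
    · exact fun h => absurd h.symm hj

theorem legDisc_saddle_ne_zero {i j : Fin 3} (h : j ≠ i) (κ : Fin 3) :
    s.legDisc j (s.ray i (s.saddleRadius i κ)) ≠ 0 := by
  rw [Ne, ← mem_aligned, hs.aligned_saddle, Finset.mem_singleton]
  exact h

/-- The positions over the saddle points of the workspace are saddles. -/
theorem isMorsePointOn_one {q : Position} (hq : q ∈ s.configSpace) {i κ : Fin 3}
    (h : q.1 = s.ray i (s.saddleRadius i κ)) : IsMorsePointOn s.energy s.configSpace 1 q := by
  obtain ⟨U, φ, u, hφ, hu, hφq, hφ1⟩ := exists_chart_angles hq (i := i)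
    fun j hj => h ▸ hs.legDisc_saddle_ne_zero hj κ
  obtain ⟨σ, hσ, hr, hneg⟩ := s.sign_cases (i := i) κ
  have he : s.energy ∘ φ = _ := funext fun v => (congrArg s.hooke (hφ1 v)).trans (hooke_angles i v)
  have h1 : dist q.1 (s.foot i) ^ 2 = (s.lower i + σ * s.upper i) ^ 2 := by
    rw [h, hs.dist_ray, sq_abs, hr]
  obtain ⟨h2, h3⟩ := dir_of_aligned hσ ((congrArg Prod.fst hφq).symm.trans (hφ1 u)) h1
  rw [h, ray_sub] at h3
  obtain ⟨h4, h5⟩ := hasIndex_one_of_aligned (hs.dist_centroid_pos i)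
    (saddleRadius_ne_zero i κ) h2 h3 (hneg _ (hs.inner_lt_centroid i) (hs.centroid_lt_outer i))
  refine ⟨U, φ, u, hφ, hu, hφq, ?_, ?_⟩
  · rw [he, fderiv_angleEnergy, h4]
  · rw [he, fderiv_angleEnergy]
    exact h5

/-- Critical positions at which exactly leg `i` is aligned. -/
theorem exists_saddle_of_isCriticalPointOn {q : Position} (hq : q ∈ s.configSpace) {i : Fin 3}
    (h : ∀ j, j ≠ i → s.legDisc j q.1 ≠ 0) (hi : s.legDisc i q.1 = 0)
    (hc : IsCriticalPointOn s.energy s.configSpace q) :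
    ∃ κ, q.1 = s.ray i (s.saddleRadius i κ) := by
  obtain ⟨U, φ, u, hφ, hu, hφq, hφ1⟩ := exists_chart_angles hq h
  have he : s.energy ∘ φ = _ := funext fun v => (congrArg s.hooke (hφ1 v)).trans (hooke_angles i v)
  have h0 := hφ.fderiv_eq_zero_of_isCriticalPointOn contDiff_energy hu (hφq.symm ▸ hc)
  rw [he, fderiv_angleEnergy] at h0
  have hW := s.fst_mem_workspace hq
  have hd := hs.dist_centroid_pos i
  have hl := s.lower_pos i
  have key : ∀ σ : ℝ, σ ^ 2 = 1 → dist q.1 (s.foot i) ^ 2 = (s.lower i + σ * s.upper i) ^ 2 →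
      q.1 = s.ray i (s.lower i + σ * s.upper i) ∨
      q.1 = s.ray i (-(s.lower i + σ * s.upper i)) := by
    intro σ hσ h1
    obtain ⟨h2, h3⟩ := dir_of_aligned hσ ((congrArg Prod.fst hφq).symm.trans (hφ1 u)) h1
    have hsin : Real.sin (u 1 - u 0) = 0 := by
      rw [← cross_dir, h2, cross_smul_right]
      simp only [cross]; ring
    -- The bars are parallel, so the sine of their angle vanishes. The derivative in the angle of
    -- the lower bar then says that this bar lies on the line to the centre of gravity.
    have h4 := congrArg (fun L => L (!₂[1, 0] : Plane)) h0
    have h5 : cross (dir (u 0)) (s.centroid - s.foot i) = 0 := by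
      simpa [angleForce, hsin, hl.ne'] using h4
    have h6 := cross_dir_eq_zero (w := (dist s.centroid (s.foot i))⁻¹ • (s.centroid - s.foot i))
      (dot_dir_self (u 0)) (by
        have := dist_sq_eq_dot s.centroid (s.foot i)
        rw [dot_smul_right]
        have e : ∀ (r : ℝ) (v : Plane), dot (r • v) v = r * dot v v := by
          intro r v; simp only [dot, PiLp.smul_apply, smul_eq_mul]; ring
        rw [e, ← this]
        field_simp) (by rw [cross_smul_right, h5, mul_zero])
    have e : q.1 = s.foot i + (s.lower i + σ * s.upper i) • dir (u 0) := by rw [← h3]; abel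
    rcases h6 with h6 | h6
    · left
      rw [e, ← h6, ray, smul_smul, div_eq_mul_inv]
    · right
      rw [e, ← neg_eq_iff_eq_neg.mpr h6, ray, ← smul_neg, smul_neg, smul_neg, smul_smul,
        neg_div, neg_smul, div_eq_mul_inv]
  rw [legDisc_eq_zero] at hi
  rcases hi with hi | hi
  · have h1 := key (-1) (by norm_num) (by rw [hi, s.inner_sq]; ring)
    rw [neg_one_mul, ← sub_eq_add_neg] at h1
    have h2 : s.inner i = s.lower i - s.upper i ∨ s.inner i = -(s.lower i - s.upper i) :=
      abs_choice _
    rcases h2 with h2 | h2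
    · rw [← h2] at h1
      rcases h1 with h1 | h1
      · exact ⟨1, h1⟩
      · exact ⟨2, h1⟩
    · rw [← h2, show s.lower i - s.upper i = -s.inner i by rw [h2, neg_neg]] at h1
      rcases h1 with h1 | h1
      · exact ⟨2, h1⟩
      · exact ⟨1, h1⟩
  · have h1 := key 1 (by norm_num) (by rw [hi, outer]; ring)
    rw [one_mul] at h1
    rcases h1 with h1 | h1
    · exact ⟨0, h1⟩
    -- The fourth candidate, the leg stretched away from the centre of gravity, is outside the
    -- workspace; this is why `saddleRadius` has only three values.
    · refine absurd (hs.antipode_notMem hW hi ?_) id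
      rw [h1, ray_sub, exitPoint_sub, neg_div, neg_smul]
      rfl

/-- The positions over the corners of the workspace are maxima. -/
theorem isMorsePointOn_two {q : Position} (hq : q ∈ s.configSpace) {i j : Fin 3} (hij : i ≠ j)
    (hi : dist q.1 (s.foot i) = s.outer i) (hj : dist q.1 (s.foot j) = s.outer j) :
    IsMorsePointOn s.energy s.configSpace 2 q := by
  obtain ⟨U, φ, τ, hφ, hu, hφq, hdisc, hφ1⟩ := hs.exists_chart_corner hij hq hi hj
  have hW := s.fst_mem_workspace hq
  have hne := hs.foot_ne hij.symm
  have hd := hdisc 0 hu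
  have hX : s.bendCentre i j (sgn τ) (cosines 0) = q.1 := by rw [← hφ1, hφq]
  have hXs := contDiffAt_bendCentre (τ := sgn τ) hne hd
  have hl : ∀ n, 0 < s.lower n * s.upper n := fun n => mul_pos (s.lower_pos n) (s.upper_pos n)
  have c1 := hs.corner_cone hij hW hi hj
  have c2 := hs.corner_cone hij.symm hW hj hi
  -- The coefficients come from Cramer's rule; the cone conditions at feet `i` and `j` are their
  -- positivity.
  obtain ⟨lam, mu, hlam, hmu, hcone⟩ : ∃ lam mu : ℝ, 0 < lam ∧ 0 < mu ∧
      q.1 - s.centroid = lam • (q.1 - s.foot i) + mu • (q.1 - s.foot j) := by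
    have hi0 : cross (q.1 - s.foot i) (s.foot j - s.foot i) ≠ 0 := fun h => by simp [h] at c1
    have hj0 : cross (q.1 - s.foot j) (s.foot i - s.foot j) ≠ 0 := fun h => by simp [h] at c2
    refine ⟨cross (q.1 - s.foot j) (s.centroid - s.foot j) /
        cross (q.1 - s.foot j) (s.foot i - s.foot j),
      cross (q.1 - s.foot i) (s.centroid - s.foot i) /
        cross (q.1 - s.foot i) (s.foot j - s.foot i), ?_, ?_, ?_⟩
    · exact div_pos_iff.mpr (mul_pos_iff.mp c2)
    · exact div_pos_iff.mpr (mul_pos_iff.mp c1)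
    · have e : cross (q.1 - s.foot j) (s.foot i - s.foot j) =
        -cross (q.1 - s.foot i) (s.foot j - s.foot i) := by
        simp only [cross, PiLp.sub_apply]; ring
      rw [e]
      apply plane_ext <;>
      · simp only [PiLp.add_apply, PiLp.smul_apply, smul_eq_mul]
        field_simp
        simp only [cross, PiLp.sub_apply]
        ring
  have hG : ContDiffAt ℝ ∞ (s.hooke ∘ s.bendCentre i j (sgn τ)) (cosines 0) :=
    contDiff_hooke.contDiffAt.comp _ hXs
  -- The gradient of the energy is `6 (x - z)`. By the cone decomposition its product with the
  -- velocity of the centre is a positive combination of the rates of the two bending cosines.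
  obtain ⟨h1, h2⟩ := fderiv_fderiv_comp_cosines hG (g₀ := 6 * lam * (s.lower i * s.upper i))
    (g₁ := 6 * mu * (s.lower j * s.upper j)) (fun w => by
      obtain ⟨g1, g2⟩ := dot_fderiv_bendCentre hne τ hd w
      rw [fderiv_comp _ (contDiff_hooke.contDiffAt.differentiableAt (by simp))
        (hXs.differentiableAt (by simp)), ContinuousLinearMap.comp_apply, fderiv_hooke]
      rw [hX] at g1 g2 ⊢
      rw [hcone]
      generalize fderiv ℝ (s.bendCentre i j (sgn τ)) (cosines 0) w = Y at *
      have : dot (lam • (q.1 - s.foot i) + mu • (q.1 - s.foot j)) Y =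
          lam * dot (q.1 - s.foot i) Y + mu * dot (q.1 - s.foot j) Y := by
        simp only [dot, PiLp.add_apply, PiLp.smul_apply, smul_eq_mul]; ring
      rw [this, g1, g2]
      ring)
  refine ⟨U, φ, 0, hφ, hu, hφq, ?_, ?_⟩
  · rw [energy_bend hφ1, h1]
  · rw [energy_bend hφ1]
    refine hasIndex_two fun v hv => ?_
    rw [h2]
    have p1 := mul_pos (mul_pos (by norm_num : (0 : ℝ) < 6) hlam) (hl i)
    have p2 := mul_pos (mul_pos (by norm_num : (0 : ℝ) < 6) hmu) (hl j)
    have hv' := dot_self_pos.mpr hv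
    rw [dot] at hv'
    rw [neg_lt_zero]
    by_cases h0 : v 0 = 0
    · have : v 1 ≠ 0 := by rintro h; simp [h0, h] at hv'
      positivity
    · positivity

theorem legDisc_centroid_ne_zero (i : Fin 3) : s.legDisc i s.centroid ≠ 0 := by
  rw [Ne, legDisc_eq_zero, not_or]
  exact ⟨(hs.inner_lt_centroid i).ne', (hs.centroid_lt_outer i).ne⟩

/-- The critical positions of the energy. -/
theorem critical_cases {q : Position} (hc : IsCriticalPointOn s.energy s.configSpace q) :
    q.1 = s.centroid ∨ (∃ i κ, q.1 = s.ray i (s.saddleRadius i κ)) ∨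
    ∃ i j, i ≠ j ∧ dist q.1 (s.foot i) = s.outer i ∧ dist q.1 (s.foot j) = s.outer j := by
  have hq := mem_of_isCriticalPointOn hc
  rcases hs.aligned_cases q.1 with ⟨i, hi⟩ | h
  · by_cases h0 : s.legDisc i q.1 = 0
    · obtain ⟨κ, h⟩ := hs.exists_saddle_of_isCriticalPointOn hq hi h0 hc
      exact Or.inr (Or.inl ⟨i, κ, h⟩)
    · refine Or.inl (eq_centroid_of_isCriticalPointOn hq (fun j => ?_) hc)
      by_cases hj : j = i
      · rwa [hj]
      · exact hi j hj
  · exact Or.inr (Or.inr h)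

theorem isMorsePointOn_centroid {q : Position} (hq : q ∈ s.configSpace)
    (h : q.1 = s.centroid) : IsMorsePointOn s.energy s.configSpace 0 q :=
  isMorsePointOn_zero hq (fun i => h ▸ hs.legDisc_centroid_ne_zero i) h

theorem isMorseOn : IsMorseOn s.energy s.configSpace := by
  refine ⟨fun U φ hφ => contDiff_energy.comp_contDiffOn hφ.contDiffOn, fun q hc => ?_⟩
  have hq := mem_of_isCriticalPointOn hc
  rcases hs.critical_cases hc with h | ⟨i, κ, h⟩ | ⟨i, j, hij, hi, hj⟩
  · exact ⟨0, hs.isMorsePointOn_centroid hq h⟩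
  · exact ⟨1, hs.isMorsePointOn_one hq h⟩
  · exact ⟨2, hs.isMorsePointOn_two hq hij hi hj⟩

theorem minima_eq : minima s.energy s.configSpace =
    {q | q ∈ s.configSpace ∧ q.1 = s.centroid} := by
  ext q
  refine ⟨fun h => ?_, fun h => hs.isMorsePointOn_centroid h.1 h.2⟩
  have hq := mem_of_isMorsePointOn h
  rcases hs.critical_cases h.isCriticalPointOn with h1 | ⟨i, κ, h1⟩ | ⟨i, j, hij, hi, hj⟩
  · exact ⟨hq, h1⟩
  · exact absurd (IsMorsePointOn_unique h (hs.isMorsePointOn_one hq h1)) (by norm_num)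
  · exact absurd (IsMorsePointOn_unique h (hs.isMorsePointOn_two hq hij hi hj)) (by norm_num)

theorem saddles_eq : saddles s.energy s.configSpace =
    {q | q ∈ s.configSpace ∧ ∃ i κ, q.1 = s.ray i (s.saddleRadius i κ)} := by
  ext q
  refine ⟨fun h => ?_, fun ⟨hq, i, κ, h⟩ => hs.isMorsePointOn_one hq h⟩
  have hq := mem_of_isMorsePointOn h
  rcases hs.critical_cases h.isCriticalPointOn with h1 | h1 | ⟨i, j, hij, hi, hj⟩
  · exact absurd (IsMorsePointOn_unique h (hs.isMorsePointOn_centroid hq h1)) (by norm_num)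
  · exact ⟨hq, h1⟩
  · exact absurd (IsMorsePointOn_unique h (hs.isMorsePointOn_two hq hij hi hj)) (by norm_num)

theorem maxima_eq : maxima s.energy s.configSpace =
    {q | q ∈ s.configSpace ∧
      ∃ i j, i ≠ j ∧ dist q.1 (s.foot i) = s.outer i ∧ dist q.1 (s.foot j) = s.outer j} := by
  ext q
  refine ⟨fun h => ?_, fun ⟨hq, i, j, hij, hi, hj⟩ => hs.isMorsePointOn_two hq hij hi hj⟩
  have hq := mem_of_isMorsePointOn h
  rcases hs.critical_cases h.isCriticalPointOn with h1 | ⟨i, κ, h1⟩ | h1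
  · exact absurd (IsMorsePointOn_unique h (hs.isMorsePointOn_centroid hq h1)) (by norm_num)
  · exact absurd (IsMorsePointOn_unique h (hs.isMorsePointOn_one hq h1)) (by norm_num)
  · exact ⟨hq, h1⟩

theorem ncard_minima : (minima s.energy s.configSpace).ncard = 8 := by
  rw [hs.minima_eq, ncard_fibre hs.centroid_mem_workspace,
    card_aligned_eq (A := ∅) fun i => by simp [hs.legDisc_centroid_ne_zero i]]
  norm_num

/-- The only aligned leg reveals `i`, and then the signed distance from foot `i` reveals `κ`. -/
theorem saddle_injective :
    Function.Injective fun p : Fin 3 × Fin 3 => s.ray p.1 (s.saddleRadius p.1 p.2) := by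
  rintro ⟨i, κ⟩ ⟨j, κ'⟩ h
  dsimp only at h
  have h1 := hs.aligned_saddle i κ
  rw [h, hs.aligned_saddle j κ', Finset.singleton_inj] at h1
  subst h1
  have hd := hs.dist_centroid_pos j
  have h2 := congrArg (· - s.foot j) h
  simp only [ray_sub] at h2
  have h3 : s.centroid - s.foot j ≠ 0 := sub_ne_zero.mpr (dist_pos.mp hd)
  have h4 := smul_left_injective ℝ h3 h2
  rw [saddleRadius_injective j ((div_left_inj' hd.ne').mp h4)]

theorem ncard_saddles : (saddles s.energy s.configSpace).ncard = 36 := by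
  classical
  have e : saddles s.energy s.configSpace = {q | q ∈ s.configSpace ∧ q.1 ∈ (Finset.univ.image
      fun p : Fin 3 × Fin 3 => s.ray p.1 (s.saddleRadius p.1 p.2))} := by
    rw [hs.saddles_eq]
    ext q
    simp only [Set.mem_ofPred_eq, Finset.mem_image, Finset.mem_univ, true_and, Prod.exists]
    simp only [eq_comm]
  rw [e, ncard_fibres (A := 1), Finset.card_image_of_injective _ hs.saddle_injective]
  · rfl
  · intro x hx
    obtain ⟨⟨i, κ⟩, -, rfl⟩ := Finset.mem_image.mp hx
    exact hs.saddle_mem i κ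
  · intro x hx
    obtain ⟨⟨i, κ⟩, -, rfl⟩ := Finset.mem_image.mp hx
    rw [hs.aligned_saddle, Finset.card_singleton]

/-- The corners of the workspace, numbered by the legs that are not stretched. -/
theorem exists_corners : ∃ c : Fin 3 → Plane, (∀ k, c k ∈ s.workspace ∧
    ∀ i, i ≠ k ↔ dist (c k) (s.foot i) = s.outer i) ∧ Function.Injective c ∧
    ∀ i j k x, i ≠ j → k ≠ i → k ≠ j → x ∈ s.workspace → dist x (s.foot i) = s.outer i →
      dist x (s.foot j) = s.outer j → x = c k := by
  have h12 : ∀ k : Fin 3, k + 1 ≠ k + 2 := by decide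
  have h01 : ∀ k : Fin 3, k ≠ k + 1 := by decide
  have h02 : ∀ k : Fin 3, k ≠ k + 2 := by decide
  choose c hc hu using fun k : Fin 3 => hs.corners (k + 1) (k + 2) (h12 k)
  have hiff : ∀ k i, i ≠ k ↔ dist (c k) (s.foot i) = s.outer i := by
    intro k i
    obtain ⟨hW, h1, h2⟩ := hc k
    have h3 := hs.lt_outer_of_corner (h12 k) (h01 k) (h02 k) hW h1 h2
    constructor
    · intro hik
      have : i = k + 1 ∨ i = k + 2 := by clear h1 h2 h3 hW; revert i k; decide
      rcases this with rfl | rfl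
      · exact h1
      · exact h2
    · rintro h rfl
      linarith
  refine ⟨c, fun k => ⟨(hc k).1, hiff k⟩, fun k k' h => ?_, ?_⟩
  · by_contra hne
    have h1 := (hiff k k').mp (Ne.symm hne)
    rw [h] at h1
    exact (hiff k' k').mpr h1 rfl
  · intro i j k x hij hki hkj hx hi hj
    have : i = k + 1 ∧ j = k + 2 ∨ i = k + 2 ∧ j = k + 1 := by
      clear hi hj hx; revert i j k; decide
    rcases this with ⟨rfl, rfl⟩ | ⟨rfl, rfl⟩
    · exact hu k x ⟨hx, hi, hj⟩
    · exact hu k x ⟨hx, hj, hi⟩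

theorem aligned_corner {i j k : Fin 3} (hij : i ≠ j) (hki : k ≠ i) (hkj : k ≠ j) {x : Plane}
    (hx : x ∈ s.workspace) (hi : dist x (s.foot i) = s.outer i)
    (hj : dist x (s.foot j) = s.outer j) : s.aligned x = {i, j} := by
  refine card_aligned_eq fun n => ?_
  have h0 := hs.legDisc_ne_zero_of_corner hij hki hkj hx hi hj
  rw [Finset.mem_insert, Finset.mem_singleton]
  constructor
  · intro hn
    by_contra hcon
    have : n = k := by
      rw [not_or] at hcon
      omega
    exact h0 (this ▸ hn)
  · rintro (rfl | rfl)
    · exact legDisc_eq_zero.mpr (Or.inr hi)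
    · exact legDisc_eq_zero.mpr (Or.inr hj)

theorem ncard_maxima : (maxima s.energy s.configSpace).ncard = 6 := by
  classical
  obtain ⟨c, hc, hinj, hu⟩ := hs.exists_corners
  have e : maxima s.energy s.configSpace =
      {q | q ∈ s.configSpace ∧ q.1 ∈ (Finset.univ.image c)} := by
    rw [hs.maxima_eq]
    ext q
    simp only [Set.mem_ofPred_eq, Finset.mem_image, Finset.mem_univ, true_and]
    refine and_congr_right fun hq => ⟨?_, ?_⟩
    · rintro ⟨i, j, hij, hi, hj⟩
      obtain ⟨k, hki, hkj, -⟩ := exists_third hij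
      exact ⟨k, (hu i j k _ hij hki hkj (s.fst_mem_workspace hq) hi hj).symm⟩
    · rintro ⟨k, hk⟩
      rw [← hk]
      exact ⟨k + 1, k + 2, by clear hk; revert k; decide,
        ((hc k).2 _).mp (by clear hk; revert k; decide),
        ((hc k).2 _).mp (by clear hk; revert k; decide)⟩
  rw [e, ncard_fibres (A := 2), Finset.card_image_of_injective _ hinj]
  · rfl
  · intro x hx
    obtain ⟨k, -, rfl⟩ := Finset.mem_image.mp hx
    exact (hc k).1
  · intro x hx
    obtain ⟨k, -, rfl⟩ := Finset.mem_image.mp hx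
    have h1 : k + 1 ≠ k := by clear hx; revert k; decide
    have h2 : k + 2 ≠ k := by clear hx; revert k; decide
    have h3 : k + 1 ≠ k + 2 := by clear hx h1 h2; revert k; decide
    rw [hs.aligned_corner h3 h1.symm h2.symm (hc k).1 (((hc k).2 _).mp h1) (((hc k).2 _).mp h2),
      Finset.card_pair h3]

end IsThreeHoledTriangle

end Spider


/-! ### Connectedness -/

/-- Every closed convex neighbourhood of a point is a retract of the space, by a retraction under
which the interior points have no further preimages. -/
theorem exists_retraction {E : Type*} [NormedAddCommGroup E] [NormedSpace ℝ E] {T : Set E} {z : E}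
    (hT : Convex ℝ T) (hcl : IsClosed T) (hz : z ∈ interior T) :
    ∃ r : E → E, Continuous r ∧ (∀ x, r x ∈ T) ∧ (∀ x ∈ T, r x = x) ∧
      ∀ x, r x ∈ interior T → r x = x := by
  set K : Set E := (fun w => z + w) ⁻¹' T with hK
  have hKc : Convex ℝ K := hT.translate_preimage_right z
  have hKcl : IsClosed K := hcl.preimage (by fun_prop)
  have hint : interior K = (fun w => z + w) ⁻¹' interior T :=
    ((Homeomorph.addLeft z).preimage_interior T).symm
  have hK0 : K ∈ 𝓝 (0 : E) := by
    rw [← mem_interior_iff_mem_nhds, hint]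
    simpa using hz
  have hcont : Continuous (gauge K) := continuous_gauge hKc hK0
  have hle : ∀ w, gauge K w ≤ 1 ↔ z + w ∈ T := by
    intro w
    rw [gauge_le_one_iff_mem_closure hKc hK0, hKcl.closure_eq]
    rfl
  have hlt : ∀ w, gauge K w < 1 ↔ z + w ∈ interior T := by
    intro w
    rw [gauge_lt_one_iff_mem_interior hKc hK0, hint]
    rfl
  have hpos : ∀ x, 0 < max 1 (gauge K (x - z)) := fun x => lt_max_of_lt_left one_pos
  have hfix : ∀ x, gauge K (x - z) ≤ 1 → z + (max 1 (gauge K (x - z)))⁻¹ • (x - z) = x := by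
    intro x hx
    rw [max_eq_left hx]
    simp
  have hg : ∀ x, gauge K ((max 1 (gauge K (x - z)))⁻¹ • (x - z)) =
      (max 1 (gauge K (x - z)))⁻¹ * gauge K (x - z) := fun x => by
    rw [gauge_smul_of_nonneg (inv_nonneg.mpr (hpos x).le), smul_eq_mul]
  -- Radial retraction: points of gauge above one, measured from `z`, are pulled back to gauge one,
  -- hence to the boundary and not to interior points.
  refine ⟨fun x => z + (max 1 (gauge K (x - z)))⁻¹ • (x - z), ?_, fun x => ?_, fun x hx => ?_,
    fun x hx => ?_⟩
  · have h1 : Continuous fun x => gauge K (x - z) := hcont.comp (by fun_prop)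
    have h2 : Continuous fun x => (max 1 (gauge K (x - z)))⁻¹ :=
      (continuous_const.max h1).inv₀ fun x => (hpos x).ne'
    exact continuous_const.add (h2.smul (by fun_prop))
  · rw [← hle, hg, inv_mul_le_one₀ (hpos x)]
    exact le_max_right _ _
  · exact hfix x ((hle _).mpr (by simpa using hx))
  · refine hfix x (le_of_not_gt fun h => ?_)
    rw [← hlt, hg, max_eq_right h.le, inv_mul_cancel₀ (one_pos.trans h).ne'] at hx
    exact lt_irrefl _ hx

namespace Spider

variable {s : Spider}

/-- Push the points of the inner discs to the inner circles. -/
def pushOut (s : Spider) (x : Plane) : Plane :=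
  x + ∑ i, (max (s.inner i / dist x (s.foot i)) 1 - 1) • (x - s.foot i)

theorem pushOut_eq_self {x : Plane} (hx : ∀ i, s.inner i ≤ dist x (s.foot i)) :
    s.pushOut x = x := by
  rw [pushOut, Finset.sum_eq_zero fun i _ => ?_, add_zero]
  rw [max_eq_right (div_le_one_of_le₀ (hx i) dist_nonneg), sub_self, zero_smul]

theorem continuousAt_pushOut {x : Plane} (hx : ∀ i, x ≠ s.foot i) : ContinuousAt s.pushOut x := by
  refine continuousAt_id.add (tendsto_finsetSum _ fun i _ => ?_)
  have h : ContinuousAt (fun x => s.inner i / dist x (s.foot i)) x :=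
    continuousAt_const.div (by fun_prop) (dist_pos.mpr (hx i)).ne'
  exact ((h.max continuousAt_const).sub continuousAt_const).smul
    (continuousAt_id.sub continuousAt_const)

namespace IsThreeHoledTriangle

variable (hs : s.IsThreeHoledTriangle)

include hs

/-- The inner discs are disjoint, so at most one summand of `pushOut` is active. It moves the point
radially to an inner circle, which lies in the workspace. -/
theorem pushOut_mem {x : Plane} (hx : ∀ i, dist x (s.foot i) ≤ s.outer i)
    (hne : ∀ i, x ≠ s.foot i) : s.pushOut x ∈ s.workspace := by
  by_cases h : ∃ i, dist x (s.foot i) < s.inner i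
  · obtain ⟨i, hi⟩ := h
    have hd := dist_pos.mpr (hne i)
    have hj : ∀ j, j ≠ i → s.inner j < dist x (s.foot j) := by
      intro j hj
      have h1 := hs.holes_disjoint i j hj.symm
      have h2 := dist_triangle_left (s.foot i) (s.foot j) x
      linarith
    have e : s.pushOut x - s.foot i = (s.inner i / dist x (s.foot i)) • (x - s.foot i) := by
      rw [pushOut, Finset.sum_eq_single i (fun j _ hji => ?_) (fun h => absurd (Finset.mem_univ i) h),
        max_eq_left ((one_le_div hd).mpr hi.le), sub_smul, one_smul]
      · abel
      · rw [max_eq_right (div_le_one_of_le₀ (hj j hji).le dist_nonneg), sub_self, zero_smul]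
    have e2 : dist (s.pushOut x) (s.foot i) = s.inner i := by
      rw [dist_eq_norm, e, norm_smul, ← dist_eq_norm,
        Real.norm_of_nonneg (div_pos (s.inner_pos i) hd).le]
      field_simp
    intro j
    by_cases hji : j = i
    · subst hji
      exact ⟨e2.ge, e2.le.trans (s.inner_lt_outer j).le⟩
    · exact ⟨(hs.inner_lt_of_inner (Ne.symm hji) e2).le,
        (hs.lt_outer_of_inner (Ne.symm hji) e2).le⟩
  · push Not at h
    rw [pushOut_eq_self h]
    exact fun i => ⟨h i, hx i⟩

/-- The workspace is a continuous image of the plane without the three feet: retract onto the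
intersection of the outer discs, then push out of the holes. The feet are interior points of the
intersection, so no other point is retracted to them, and the complement of a countable set in the
plane is connected. -/
theorem isConnected_workspace : IsConnected s.workspace := by
  set T : Set Plane := ⋂ i, Metric.closedBall (s.foot i) (s.outer i) with hT
  have hint : interior T = ⋂ i, Metric.ball (s.foot i) (s.outer i) := by
    rw [hT, interior_iInter_of_finite]
    exact Set.iInter_congr fun i => interior_closedBall _ (s.outer_pos i).ne'
  obtain ⟨r, hr, hrT, hfix, hrint⟩ := exists_retraction (T := T) (z := s.centroid)
    (convex_iInter fun i => convex_closedBall _ _)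
    (isClosed_iInter fun i => Metric.isClosed_closedBall)
    (by rw [hint]; exact Set.mem_iInter.mpr fun i => hs.centroid_lt_outer i)
  have hfoot : ∀ i, s.foot i ∈ interior T := by
    intro i
    rw [hint]
    refine Set.mem_iInter.mpr fun j => ?_
    by_cases h : i = j
    · subst h; exact Metric.mem_ball_self (s.outer_pos i)
    · have := hs.holes_inside i j h
      have := s.inner_pos i
      rw [Metric.mem_ball]
      linarith
  have hne : ∀ x ∈ (Set.range s.foot)ᶜ, ∀ i, r x ≠ s.foot i := by
    intro x hx i h
    have := hrint x (h ▸ hfoot i)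
    exact hx ⟨i, by rw [← h, this]⟩
  have hrank : 1 < Module.rank ℝ Plane := by
    rw [← Module.finrank_eq_rank, finrank_euclideanSpace_fin]
    norm_num
  have himage : s.workspace = (s.pushOut ∘ r) '' (Set.range s.foot)ᶜ := by
    ext x
    constructor
    · intro hx
      refine ⟨x, ?_, ?_⟩
      · rintro ⟨i, hi⟩
        exact ne_foot hx i hi.symm
      · rw [Function.comp_apply, hfix x (Set.mem_iInter.mpr fun i => (hx i).2),
          pushOut_eq_self fun i => (hx i).1]
    · rintro ⟨x, hx, rfl⟩
      exact hs.pushOut_mem (fun i => Set.mem_iInter.mp (hrT x) i) (hne x hx)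
  rw [himage]
  refine ((Set.finite_range s.foot).countable.isConnected_compl_of_one_lt_rank hrank).image _ ?_
  intro x hx
  exact (ContinuousAt.comp (continuousAt_pushOut (hne x hx)) hr.continuousAt).continuousWithinAt

/-- Each sheet is a continuous image of the workspace. Sheets differing in the sign of leg `i` only
meet over a point of the inner circle of that leg, and any two patterns are joined by changing the
three signs in turn. -/
theorem isConnected_configSpace : IsConnected s.configSpace := by
  have himage : s.configSpace = ⋃ ε : Fin 3 → Bool, s.sheet ε '' s.workspace := by
    ext q
    simp only [Set.mem_iUnion]
    constructor
    · intro hq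
      obtain ⟨ε, hε⟩ := exists_sheet hq
      exact ⟨ε, q.1, s.fst_mem_workspace hq, hε⟩
    · rintro ⟨ε, x, hx, rfl⟩
      exact sheet_mem hx ε
  rw [himage]
  refine IsConnected.iUnion_of_reflTransGen
    (fun ε => hs.isConnected_workspace.image _ (continuousOn_sheet ε)) fun ε ε' => ?_
  have step : ∀ (ε : Fin 3 → Bool) (i : Fin 3) (b : Bool),
      (s.sheet ε '' s.workspace ∩ s.sheet (Function.update ε i b) '' s.workspace).Nonempty := by
    intro ε i b
    refine ⟨s.sheet ε (s.ray i (s.saddleRadius i 1)), ⟨_, hs.saddle_mem i 1, rfl⟩,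
      ⟨_, hs.saddle_mem i 1, ?_⟩⟩
    rw [sheet_eq_sheet (hs.saddle_mem i 1)]
    intro j hj
    have : j ≠ i := by
      rintro rfl
      exact hj (mem_aligned.mp (by rw [hs.aligned_saddle]; exact Finset.mem_singleton_self j))
    simp [this]
  have e : ε' = Function.update (Function.update (Function.update ε 0 (ε' 0)) 1 (ε' 1)) 2
      (ε' 2) := by
    ext i
    fin_cases i <;> simp [Function.update]
  rw [e]
  exact ((Relation.ReflTransGen.single (step _ 0 _)).tail (step _ 1 _)).tail (step _ 2 _)

end IsThreeHoledTriangle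

end Spider


/-! ### Lifting cell decompositions of the workspace -/

namespace Spider

variable {s : Spider}

/-- The spider with renumbered legs. -/
def permute (s : Spider) (e : Equiv.Perm (Fin 3)) : Spider where
  foot i := s.foot (e i)
  lower i := s.lower (e i)
  upper i := s.upper (e i)
  lower_pos i := s.lower_pos (e i)
  upper_pos i := s.upper_pos (e i)
  lower_ne_upper i := s.lower_ne_upper (e i)

theorem workspace_permute (s : Spider) (e : Equiv.Perm (Fin 3)) :
    (s.permute e).workspace = s.workspace := by
  ext x
  exact e.forall_congr fun _ => Iff.rfl

theorem centroid_permute (s : Spider) (e : Equiv.Perm (Fin 3)) :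
    (s.permute e).centroid = s.centroid :=
  congrArg ((3 : ℝ)⁻¹ • ·) (Equiv.sum_comp e s.foot)

theorem exitPoint_permute (s : Spider) (e : Equiv.Perm (Fin 3)) (i : Fin 3) :
    (s.permute e).exitPoint i = s.exitPoint (e i) := by
  rw [exitPoint, centroid_permute]
  rfl

theorem IsThreeHoledTriangle.permute (hs : s.IsThreeHoledTriangle) (e : Equiv.Perm (Fin 3)) :
    (s.permute e).IsThreeHoledTriangle where
  holes_disjoint i j h := hs.holes_disjoint (e i) (e j) (e.injective.ne h)
  holes_inside i j h := hs.holes_inside (e i) (e j) (e.injective.ne h)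
  centroid_mem := by
    rw [centroid_permute, workspace_permute]
    exact hs.centroid_mem
  corners i j h := by
    rw [workspace_permute]
    exact hs.corners (e i) (e j) (e.injective.ne h)
  exits i j h := by
    rw [exitPoint_permute]
    exact hs.exits (e i) (e j) (e.injective.ne h)

/-- A finite cell decomposition of the workspace, such that on each open cell the same legs are
aligned, lifts to a cell decomposition of the configuration space. -/
theorem hasEulerCharacteristic_of_planar_cells {K : Type} [Fintype K] (d : K → ℕ)
    (hd : ∀ k, d k ≤ 2) (f : K → ℝ → ℝ → Plane)
    (hcont : ∀ k, Continuous fun p : ℝ × ℝ => f k p.1 p.2)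
    (hmem : ∀ k a b, |a| ≤ 1 → |b| ≤ 1 → f k a b ∈ s.workspace)
    (hinj : ∀ k a b k' a' b', InOpenCube (d k) a b → InOpenCube (d k') a' b' →
      f k a b = f k' a' b' → k = k' ∧ a = a' ∧ b = b')
    (hcover : ∀ x ∈ s.workspace, ∃ k a b, InOpenCube (d k) a b ∧ f k a b = x)
    (hbdry : ∀ k a b, InClosedCube (d k) a b → ¬ InOpenCube (d k) a b →
      ∃ k' a' b', d k' < d k ∧ InOpenCube (d k') a' b' ∧ f k' a' b' = f k a b)
    (e : Equiv.Perm (Fin 3)) (A : K → Finset (Fin 3))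
    (hA : ∀ k a b, InOpenCube (d k) a b → ∀ i, s.legDisc (e i) (f k a b) = 0 ↔ i ∈ A k) :
    HasEulerCharacteristic s.configSpace (∑ k, (-1 : ℤ) ^ d k * 2 ^ (3 - (A k).card)) := by
  have hal : ∀ k a b, InOpenCube (d k) a b →
      s.aligned (f k a b) = (A k).map e.toEmbedding := fun k a b h =>
    card_aligned_eq fun i => by
      obtain ⟨i, rfl⟩ := e.surjective i
      rw [hA k a b h]
      simp
  have hopen : ∀ {k a b}, InOpenCube (d k) a b → f k a b ∈ s.workspace :=
    fun h => hmem _ _ _ h.1.le h.2.1.le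
  -- A cell is lifted once for each choice of signs of the legs not aligned on it, the other signs
  -- being reset to `true`. More legs may be aligned on a boundary cell, so the signs are reset
  -- again there.
  have h := hasEulerCharacteristic_of_cells (S := s.configSpace)
    (K := Σ k, Signs ((A k).map e.toEmbedding)) (fun k => d k.1) (fun k => hd k.1)
    (fun k a b => s.sheet k.2.1 (f k.1 a b))
    (fun k => (continuousOn_sheet k.2.1).comp (hcont k.1).continuousOn
      fun p hp => hmem _ _ _ hp.1 hp.2)
    (fun k a b h => sheet_mem (hopen h) _) ?_ ?_ ?_
  · have hsum : ∑ k : (Σ k, Signs ((A k).map e.toEmbedding)), (-1 : ℤ) ^ d k.1 =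
        ∑ k, (-1 : ℤ) ^ d k * 2 ^ (3 - (A k).card) := by
      rw [Fintype.sum_sigma]
      refine Finset.sum_congr rfl fun k _ => ?_
      change ∑ _ε : Signs ((A k).map e.toEmbedding), (-1 : ℤ) ^ d k = _
      rw [Finset.sum_const, Finset.card_univ, card_signs, Finset.card_map, nsmul_eq_mul, mul_comm]
      push_cast
      rfl
    rwa [hsum] at h
  · rintro ⟨k, ε⟩ a b ⟨k', ε'⟩ a' b' ho ho' heq
    obtain ⟨rfl, rfl, rfl⟩ := hinj _ _ _ _ _ _ ho ho' (congrArg Prod.fst heq)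
    obtain rfl := sheet_injective (hopen ho) (hal k a b ho).le heq
    exact ⟨rfl, rfl, rfl⟩
  · intro q hq
    obtain ⟨k, a, b, ho, hx⟩ := hcover q.1 (s.fst_mem_workspace hq)
    obtain ⟨ε, hε⟩ := exists_sheet hq
    refine ⟨⟨k, Signs.reset _ ε⟩, a, b, ho, ?_⟩
    change s.sheet _ (f k a b) = q
    rw [sheet_reset (hopen ho) (hal k a b ho).ge, hx, hε]
  · rintro ⟨k, ε⟩ a b hc hno
    obtain ⟨k', a', b', hlt, ho, hx⟩ := hbdry k a b hc hno
    refine ⟨⟨k', Signs.reset _ ε.1⟩, a', b', hlt, ho, ?_⟩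
    change s.sheet _ (f k' a' b') = s.sheet _ (f k a b)
    rw [sheet_reset (hopen ho) (hal k' a' b' ho).ge, hx]

end Spider


/-! ### An interval with two holes -/

/-- The data of an interval `[lo 0, hi 0]` from which the disjoint intervals `(hi j, lo j)`,
`j = 1, 2`, as far as they are present (`on j`), are taken out. -/
structure IsFibre (lo hi : Fin 3 → ℝ) (on : Fin 3 → Prop) : Prop where
  base : on 0
  lt : lo 0 < hi 0
  hole : ∀ j, j ≠ 0 → on j → lo 0 < hi j ∧ hi j ≤ lo j ∧ lo j < hi 0
  chain : on 1 → on 2 → lo 1 < hi 2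

/-- The upper end of the component with lower end `lo κ`. -/
def upperEnd (hi : Fin 3 → ℝ) (on : Fin 3 → Prop) (κ : Fin 3) : ℝ :=
  open Classical in
  if κ = 0 ∧ on 1 then hi 1 else if κ ≠ 2 ∧ on 2 then hi 2 else hi 0

/-- The points of the open cells of a fibre: the upper and lower ends of the components, and
the points between them. -/
def level (lo hi : Fin 3 → ℝ) (on : Fin 3 → Prop) (κ : Fin 3) : Option Bool → ℝ → ℝ
  | none, w => lo κ + (upperEnd hi on κ - lo κ) * ((1 + w) / 2)
  | some true, _ => hi κ
  | some false, _ => lo κ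

/-- The cells of a fibre; the two ends of a hole of length zero are only counted once. -/
def IsLevel (lo hi : Fin 3 → ℝ) (on : Fin 3 → Prop) (κ : Fin 3) (l : Option Bool) : Prop :=
  on κ ∧ (l = some false → κ ≠ 0 → hi κ ≠ lo κ)

/-- The points of a fibre. -/
def InFibre (lo hi : Fin 3 → ℝ) (on : Fin 3 → Prop) (ρ : ℝ) : Prop :=
  lo 0 ≤ ρ ∧ ρ ≤ hi 0 ∧ ∀ j, j ≠ 0 → on j → ρ ≤ hi j ∨ lo j ≤ ρ

theorem fin_three_cases (κ : Fin 3) : κ = 0 ∨ κ = 1 ∨ κ = 2 := by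
  revert κ; decide

open Classical in
theorem upperEnd_zero (hi : Fin 3 → ℝ) (on : Fin 3 → Prop) :
    upperEnd hi on 0 = if on 1 then hi 1 else if on 2 then hi 2 else hi 0 := by
  simp [upperEnd]

open Classical in
theorem upperEnd_one (hi : Fin 3 → ℝ) (on : Fin 3 → Prop) :
    upperEnd hi on 1 = if on 2 then hi 2 else hi 0 := by
  simp [upperEnd]

theorem upperEnd_two (hi : Fin 3 → ℝ) (on : Fin 3 → Prop) : upperEnd hi on 2 = hi 0 := by
  simp [upperEnd]

namespace IsFibre

variable {lo hi : Fin 3 → ℝ} {on : Fin 3 → Prop}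

theorem upperEnd_mem (h : IsFibre lo hi on) (κ : Fin 3) : ∃ j, on j ∧ upperEnd hi on κ = hi j := by
  have := h.base
  unfold upperEnd
  split_ifs with h1 h2
  · exact ⟨1, h1.2, rfl⟩
  · exact ⟨2, h2.2, rfl⟩
  · exact ⟨0, this, rfl⟩

/-- With both holes present the components are `[lo 0, hi 1]`, `[lo 1, hi 2]` and `[lo 2, hi 0]`,
`chain` placing hole `1` below hole `2`; an absent hole merges its neighbours. This and the next
lemmas check the possible combinations. -/
theorem lt_upperEnd (h : IsFibre lo hi on) {κ : Fin 3} (hκ : on κ) : lo κ < upperEnd hi on κ := by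
  have h0 := h.lt
  have h1 := h.hole 1 (by decide)
  have h2 := h.hole 2 (by decide)
  have h3 := h.chain
  rcases fin_three_cases κ with rfl | rfl | rfl
  · rw [upperEnd_zero]; grind
  · rw [upperEnd_one]; grind
  · rw [upperEnd_two]; grind

theorem between (h : IsFibre lo hi on) {κ : Fin 3} (hκ : on κ) {ρ : ℝ} (h1 : lo κ ≤ ρ)
    (h2 : ρ ≤ upperEnd hi on κ) : InFibre lo hi on ρ := by
  have h0 := h.lt
  have h3 := h.hole 1 (by decide)
  have h4 := h.hole 2 (by decide)
  have h5 := h.chain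
  suffices lo 0 ≤ ρ ∧ ρ ≤ hi 0 ∧ (on 1 → ρ ≤ hi 1 ∨ lo 1 ≤ ρ) ∧ (on 2 → ρ ≤ hi 2 ∨ lo 2 ≤ ρ) by
    refine ⟨this.1, this.2.1, fun j hj => ?_⟩
    rcases fin_three_cases j with rfl | rfl | rfl
    · exact absurd rfl hj
    · exact this.2.2.1
    · exact this.2.2.2
  rcases fin_three_cases κ with rfl | rfl | rfl
  · rw [upperEnd_zero] at h2; grind
  · rw [upperEnd_one] at h2; grind
  · rw [upperEnd_two] at h2; grind

/-- A point between the ends of a component is not an end, and lies in no other component. -/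
theorem strictly_between (h : IsFibre lo hi on) {κ : Fin 3} (hκ : on κ) {ρ : ℝ} (h1 : lo κ < ρ)
    (h2 : ρ < upperEnd hi on κ) {κ' : Fin 3} (hκ' : on κ') :
    ρ ≠ lo κ' ∧ ρ ≠ hi κ' ∧ (lo κ' < ρ → ρ < upperEnd hi on κ' → κ' = κ) := by
  have h0 := h.lt
  have h3 := h.hole 1 (by decide)
  have h4 := h.hole 2 (by decide)
  have h5 := h.chain
  rcases fin_three_cases κ with rfl | rfl | rfl <;>
  rcases fin_three_cases κ' with rfl | rfl | rfl <;>
  simp only [upperEnd_zero, upperEnd_one, upperEnd_two] at * <;> grind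

theorem exists_between (h : IsFibre lo hi on) {ρ : ℝ} (hρ : InFibre lo hi on ρ) :
    (∃ κ, on κ ∧ (ρ = lo κ ∨ ρ = hi κ)) ∨ ∃ κ, on κ ∧ lo κ < ρ ∧ ρ < upperEnd hi on κ := by
  obtain ⟨h1, h2, h3⟩ := hρ
  have h4 := h3 1 (by decide)
  have h5 := h3 2 (by decide)
  have hb := h.base
  by_contra hcon
  rw [not_or] at hcon
  obtain ⟨c1, c2⟩ := hcon
  push Not at c1 c2
  have d0 := c1 0
  have d1 := c1 1
  have d2 := c1 2
  have e0 := c2 0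
  have e1 := c2 1
  have e2 := c2 2
  rw [upperEnd_zero] at e0
  rw [upperEnd_one] at e1
  rw [upperEnd_two] at e2
  have := h.chain
  have := h.hole 1 (by decide)
  have := h.hole 2 (by decide)
  clear h3 c1 c2
  grind

theorem end_injective (h : IsFibre lo hi on) {κ κ' : Fin 3} {b b' : Bool}
    (hκ : IsLevel lo hi on κ (some b)) (hκ' : IsLevel lo hi on κ' (some b'))
    (heq : level lo hi on κ (some b) 0 = level lo hi on κ' (some b') 0) : κ = κ' ∧ b = b' := by
  have h0 := h.lt
  have h3 := h.hole 1 (by decide)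
  have h4 := h.hole 2 (by decide)
  have h5 := h.chain
  obtain ⟨h6, h7⟩ := hκ
  obtain ⟨h8, h9⟩ := hκ'
  clear h
  cases b <;> cases b' <;> simp only [level] at heq <;>
  rcases fin_three_cases κ with rfl | rfl | rfl <;>
  rcases fin_three_cases κ' with rfl | rfl | rfl <;> grind

/-- Every end of a component belongs to a cell. -/
theorem exists_end {κ : Fin 3} (hκ : on κ) (b : Bool) :
    ∃ b', IsLevel lo hi on κ (some b') ∧ level lo hi on κ (some b') 0 =
      level lo hi on κ (some b) 0 := by
  by_cases hb : b = false ∧ κ ≠ 0 ∧ hi κ = lo κ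
  · obtain ⟨rfl, -, h⟩ := hb
    exact ⟨true, ⟨hκ, fun h => by simp at h⟩, h⟩
  · exact ⟨b, ⟨hκ, fun h1 h2 h3 => hb ⟨by simpa using h1, h2, h3⟩⟩, rfl⟩

theorem level_none_bounds (h : IsFibre lo hi on) {κ : Fin 3} (hκ : on κ) {w : ℝ} (hw : |w| < 1) :
    lo κ < level lo hi on κ none w ∧ level lo hi on κ none w < upperEnd hi on κ := by
  have h1 := sub_pos.mpr (h.lt_upperEnd hκ)
  obtain ⟨h2, h3⟩ := abs_lt.mp hw
  simp only [level]
  constructor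
  · nlinarith [mul_pos h1 (by linarith : 0 < 1 + w)]
  · nlinarith [mul_pos h1 (by linarith : 0 < 1 - w)]

theorem inFibre_level (h : IsFibre lo hi on) {κ : Fin 3} (hκ : on κ) (l : Option Bool) {w : ℝ}
    (hw : |w| ≤ 1) : InFibre lo hi on (level lo hi on κ l w) := by
  have h1 := sub_pos.mpr (h.lt_upperEnd hκ)
  obtain ⟨h2, h3⟩ := abs_le.mp hw
  match l with
  | none =>
    refine h.between hκ ?_ ?_ <;> simp only [level]
    · nlinarith [mul_nonneg h1.le (by linarith : 0 ≤ 1 + w)]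
    · nlinarith [mul_nonneg h1.le (by linarith : 0 ≤ 1 - w)]
  | some false => exact h.between hκ le_rfl (sub_nonneg.mp h1.le)
  | some true =>
    have h0 := h.lt
    have h3 := h.hole 1 (by decide)
    have h4 := h.hole 2 (by decide)
    have h5 := h.chain
    simp only [level]
    suffices lo 0 ≤ hi κ ∧ hi κ ≤ hi 0 ∧ (on 1 → hi κ ≤ hi 1 ∨ lo 1 ≤ hi κ) ∧
        (on 2 → hi κ ≤ hi 2 ∨ lo 2 ≤ hi κ) by
      refine ⟨this.1, this.2.1, fun j hj => ?_⟩
      rcases fin_three_cases j with rfl | rfl | rfl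
      · exact absurd rfl hj
      · exact this.2.2.1
      · exact this.2.2.2
    clear h
    rcases fin_three_cases κ with rfl | rfl | rfl <;> grind

/-- The ends of the closed cells. -/
theorem exists_end_of_abs_eq (h : IsFibre lo hi on) {κ : Fin 3} (hκ : on κ) {w : ℝ} (hw : |w| = 1) :
    ∃ κ' b, IsLevel lo hi on κ' (some b) ∧
      level lo hi on κ' (some b) 0 = level lo hi on κ none w := by
  rcases eq_or_eq_neg_of_abs_eq hw with rfl | rfl
  · obtain ⟨j, hj, he⟩ := h.upperEnd_mem κ
    obtain ⟨b, hb, hb'⟩ := exists_end (lo := lo) (hi := hi) hj true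
    refine ⟨j, b, hb, hb'.trans ?_⟩
    simp only [level]
    rw [he]
    ring
  · obtain ⟨b, hb, hb'⟩ := exists_end (lo := lo) (hi := hi) hκ false
    refine ⟨κ, b, hb, hb'.trans ?_⟩
    simp only [level]
    ring

theorem exists_level (h : IsFibre lo hi on) {ρ : ℝ} (hρ : InFibre lo hi on ρ) :
    ∃ κ l w, IsLevel lo hi on κ l ∧ |w| < 1 ∧ (l ≠ none → w = 0) ∧ level lo hi on κ l w = ρ := by
  rcases h.exists_between hρ with ⟨κ, hκ, h1⟩ | ⟨κ, hκ, h1, h2⟩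
  · obtain ⟨b, hb⟩ : ∃ b, level lo hi on κ (some b) 0 = ρ := by
      rcases h1 with rfl | rfl
      · exact ⟨false, rfl⟩
      · exact ⟨true, rfl⟩
    obtain ⟨b', h3, h4⟩ := exists_end (lo := lo) (hi := hi) hκ b
    exact ⟨κ, some b', 0, h3, by simp, fun _ => rfl, h4.trans hb⟩
  · have h3 : 0 < upperEnd hi on κ - lo κ := by linarith
    refine ⟨κ, none, 2 * ((ρ - lo κ) / (upperEnd hi on κ - lo κ)) - 1,
      ⟨hκ, fun h => by simp at h⟩, ?_, fun h => absurd rfl h, ?_⟩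
    · have h4 : 0 < (ρ - lo κ) / (upperEnd hi on κ - lo κ) := div_pos (by linarith) h3
      have h5 : (ρ - lo κ) / (upperEnd hi on κ - lo κ) < 1 := by rw [div_lt_one h3]; linarith
      rw [abs_lt]
      constructor <;> linarith
    · simp only [level]
      field_simp
      ring

theorem level_injective (h : IsFibre lo hi on) {κ κ' : Fin 3} {l l' : Option Bool} {w w' : ℝ}
    (hκ : IsLevel lo hi on κ l) (hκ' : IsLevel lo hi on κ' l') (hw : |w| < 1) (hw' : |w'| < 1)
    (heq : level lo hi on κ l w = level lo hi on κ' l' w') :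
    κ = κ' ∧ l = l' ∧ (l = none → w = w') := by
  have aux : ∀ {κ κ' : Fin 3} {b : Bool} {w w' : ℝ}, on κ → on κ' → |w| < 1 →
      level lo hi on κ none w ≠ level lo hi on κ' (some b) w' := by
    intro κ κ' b w w' hκ hκ' hw heq
    have h1 := h.level_none_bounds hκ hw
    have h2 := h.strictly_between hκ h1.1 h1.2 hκ'
    cases b
    · exact h2.1 heq
    · exact h2.2.1 heq
  match l, l' with
  | none, none =>
    have h1 := h.level_none_bounds hκ.1 hw
    have h2 := h.level_none_bounds hκ'.1 hw'
    rw [← heq] at h2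
    obtain rfl := (h.strictly_between hκ.1 h1.1 h1.2 hκ'.1).2.2 h2.1 h2.2
    refine ⟨rfl, rfl, fun _ => ?_⟩
    have h3 := (sub_pos.mpr (h.lt_upperEnd hκ.1)).ne'
    simp only [level] at heq
    have := mul_left_cancel₀ h3 (add_left_cancel heq)
    linarith
  | none, some b => exact absurd heq (aux hκ.1 hκ'.1 hw)
  | some b, none => exact absurd heq.symm (aux hκ'.1 hκ.1 hw')
  | some b, some b' =>
    obtain ⟨rfl, rfl⟩ := h.end_injective hκ hκ' (by cases b <;> cases b' <;> exact heq)
    exact ⟨rfl, rfl, fun h => by simp at h⟩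

end IsFibre


/-! ### Polar coordinates around a foot -/

/-- The roots have opposite signs, so for `ρ ≥ 0` the factor of the negative root is positive. For
an outer circle, which has foot `0` in its interior, this means that a ray leaves it exactly once.
-/
theorem quadratic_outer {ρ c S : ℝ} (hρ : 0 ≤ ρ) (hS : 0 < S) :
    ∃ q, 0 < q ∧ ρ ^ 2 - 2 * ρ * c - S = (ρ - (c + √(c ^ 2 + S))) * q := by
  have h := Real.sq_sqrt (by positivity : 0 ≤ c ^ 2 + S)
  have h0 := Real.sqrt_nonneg (c ^ 2 + S)
  refine ⟨ρ - c + √(c ^ 2 + S), ?_, by linear_combination h⟩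
  nlinarith [abs_lt_of_sq_lt_sq (by linarith : c ^ 2 < √(c ^ 2 + S) ^ 2) h0,
    (abs_lt.mp (abs_lt_of_sq_lt_sq (by linarith : c ^ 2 < √(c ^ 2 + S) ^ 2) h0)).2]

namespace Spider

/-- The point with polar coordinates `ρ`, `θ` around foot `0`. -/
def polar (s : Spider) (θ ρ : ℝ) : Plane := s.foot 0 + ρ • dir θ

/-- The component of the vector from foot `0` to foot `i` in the direction `θ`. -/
def lead (s : Spider) (i : Fin 3) (θ : ℝ) : ℝ := dot (s.foot i - s.foot 0) (dir θ)

/-- The length of the tangents from foot `0` to the inner circle of leg `i`. -/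
def tangent (s : Spider) (i : Fin 3) : ℝ := √(s.sqDist i (s.foot 0) - s.inner i ^ 2)

/-- The distance from foot `0` to the outer circle of leg `i` in the direction `θ`. -/
def outerDist (s : Spider) (i : Fin 3) (θ : ℝ) : ℝ :=
  s.lead i θ + √(s.lead i θ ^ 2 + (s.outer i ^ 2 - s.sqDist i (s.foot 0)))

/-- The lower ends of the components of the workspace in the direction `θ`. -/
def lo (s : Spider) (θ : ℝ) (κ : Fin 3) : ℝ :=
  if κ = 0 then s.inner 0 else s.lead κ θ + √(s.lead κ θ ^ 2 - s.tangent κ ^ 2)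

/-- The upper ends of the components of the workspace in the direction `θ`. -/
def hi (s : Spider) (θ : ℝ) (κ : Fin 3) : ℝ :=
  if κ = 0 then min (s.outerDist 0 θ) (min (s.outerDist 1 θ) (s.outerDist 2 θ))
  else s.lead κ θ - √(s.lead κ θ ^ 2 - s.tangent κ ^ 2)

/-- `act` tells which inner discs meet the ray in the direction `θ`, except that it may be wrong if
the ray is a tangent. -/
structure Describes (s : Spider) (act : Fin 3 → Prop) (θ : ℝ) : Prop where
  zero : act 0
  of_mem : ∀ j, j ≠ 0 → act j → s.tangent j ≤ s.lead j θ
  of_notMem : ∀ j, j ≠ 0 → ¬ act j → s.lead j θ ≤ s.tangent j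

variable {s : Spider}

theorem lo_of_ne (θ : ℝ) {κ : Fin 3} (h : κ ≠ 0) :
    s.lo θ κ = s.lead κ θ + √(s.lead κ θ ^ 2 - s.tangent κ ^ 2) := if_neg h

theorem hi_of_ne (θ : ℝ) {κ : Fin 3} (h : κ ≠ 0) :
    s.hi θ κ = s.lead κ θ - √(s.lead κ θ ^ 2 - s.tangent κ ^ 2) := if_neg h

theorem lo_zero (θ : ℝ) : s.lo θ 0 = s.inner 0 := rfl

theorem hi_zero (θ : ℝ) :
    s.hi θ 0 = min (s.outerDist 0 θ) (min (s.outerDist 1 θ) (s.outerDist 2 θ)) := rfl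

@[fun_prop] theorem continuous_lead (i : Fin 3) : Continuous (s.lead i) := by
  unfold lead
  have := continuous_dir
  fun_prop

@[fun_prop] theorem continuous_outerDist (i : Fin 3) : Continuous (s.outerDist i) := by
  unfold outerDist; fun_prop

theorem continuous_lo (κ : Fin 3) : Continuous fun θ => s.lo θ κ := by
  unfold lo; split_ifs <;> fun_prop

theorem continuous_hi (κ : Fin 3) : Continuous fun θ => s.hi θ κ := by
  unfold hi; split_ifs <;> fun_prop

theorem continuous_polar {Z : Type*} [TopologicalSpace Z] {f g : Z → ℝ} (hf : Continuous f)
    (hg : Continuous g) : Continuous fun x => s.polar (f x) (g x) := by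
  unfold polar
  have := continuous_dir.comp hf
  exact continuous_const.add (hg.smul this)

theorem sqDist_polar (i : Fin 3) (θ ρ : ℝ) : s.sqDist i (s.polar θ ρ) =
    ρ ^ 2 - 2 * ρ * s.lead i θ + s.sqDist i (s.foot 0) := by
  have h := dot_dir_self θ
  simp only [sqDist, polar, lead, dot, PiLp.sub_apply, PiLp.add_apply, PiLp.smul_apply,
    smul_eq_mul] at *
  linear_combination ρ ^ 2 * h

theorem dist_polar (θ ρ : ℝ) (hρ : 0 ≤ ρ) : dist (s.polar θ ρ) (s.foot 0) = ρ := by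
  rw [dist_eq_iff_dot hρ, polar, add_sub_cancel_left]
  have h := dot_dir_self θ
  simp only [dot, PiLp.smul_apply, smul_eq_mul] at *
  linear_combination ρ ^ 2 * h

theorem hi_zero_le (i : Fin 3) (θ : ℝ) : s.hi θ 0 ≤ s.outerDist i θ := by
  rw [hi_zero]
  rcases fin_three_cases i with rfl | rfl | rfl <;> simp

theorem le_hi_zero {ρ θ : ℝ} : ρ ≤ s.hi θ 0 ↔ ∀ i, ρ ≤ s.outerDist i θ := by
  rw [hi_zero, le_min_iff, le_min_iff, Fin.forall_fin_succ, Fin.forall_fin_two]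
  rfl

theorem exists_eq_hi_zero (θ : ℝ) : ∃ i, s.outerDist i θ = s.hi θ 0 := by
  rw [hi_zero]
  rcases min_choice (s.outerDist 1 θ) (s.outerDist 2 θ) with h | h <;>
  rcases min_choice (s.outerDist 0 θ) (min (s.outerDist 1 θ) (s.outerDist 2 θ)) with h' | h'
  · exact ⟨0, h'.symm⟩
  · exact ⟨1, by rw [h', h]⟩
  · exact ⟨0, h'.symm⟩
  · exact ⟨2, by rw [h', h]⟩

/-- A hole that is met by the ray. -/
theorem sqDist_sub_inner {i : Fin 3} (h : i ≠ 0) (ht : s.inner i ^ 2 ≤ s.sqDist i (s.foot 0))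
    {θ : ℝ} (hon : s.tangent i ≤ s.lead i θ) (ρ : ℝ) :
    s.sqDist i (s.polar θ ρ) - s.inner i ^ 2 = (ρ - s.hi θ i) * (ρ - s.lo θ i) := by
  have h1 : s.tangent i ^ 2 = s.sqDist i (s.foot 0) - s.inner i ^ 2 :=
    Real.sq_sqrt (sub_nonneg.mpr ht)
  have h0 : 0 ≤ s.tangent i := Real.sqrt_nonneg _
  have h2 := Real.sq_sqrt (by nlinarith : 0 ≤ s.lead i θ ^ 2 - s.tangent i ^ 2)
  rw [sqDist_polar, hi_of_ne _ h, lo_of_ne _ h]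
  linear_combination h2 - h1

/-- The square is completed at the length of the tangent, which shows that a ray with `lead <
tangent` misses the disc. -/
theorem sqDist_sub_inner' {i : Fin 3} (ht : s.inner i ^ 2 ≤ s.sqDist i (s.foot 0)) (θ ρ : ℝ) :
    s.sqDist i (s.polar θ ρ) - s.inner i ^ 2 =
      (ρ - s.tangent i) ^ 2 + 2 * ρ * (s.tangent i - s.lead i θ) := by
  have h1 : s.tangent i ^ 2 = s.sqDist i (s.foot 0) - s.inner i ^ 2 :=
    Real.sq_sqrt (sub_nonneg.mpr ht)
  rw [sqDist_polar]
  linear_combination -h1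

theorem hi_le_lo {i : Fin 3} (h : i ≠ 0) (θ : ℝ) : s.hi θ i ≤ s.lo θ i := by
  rw [hi_of_ne _ h, lo_of_ne _ h]
  linarith [Real.sqrt_nonneg (s.lead i θ ^ 2 - s.tangent i ^ 2)]

namespace IsThreeHoledTriangle

variable (hs : s.IsThreeHoledTriangle)

include hs

theorem inner_lt_sqDist {i : Fin 3} (h : i ≠ 0) : s.inner i ^ 2 < s.sqDist i (s.foot 0) := by
  have h1 := hs.holes_disjoint 0 i h.symm
  have := s.inner_pos 0
  have := s.inner_pos i
  rw [← dist_sq_eq_sqDist]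
  nlinarith

theorem sqDist_lt_outer (i : Fin 3) : s.sqDist i (s.foot 0) < s.outer i ^ 2 := by
  have h2 := s.outer_pos i
  rw [← dist_sq_eq_sqDist]
  by_cases h : i = 0
  · subst h
    rw [dist_self, zero_pow two_ne_zero]
    exact pow_pos h2 2
  · have h1 := hs.holes_inside 0 i (Ne.symm h)
    have := s.inner_pos 0
    have : 0 ≤ dist (s.foot 0) (s.foot i) := dist_nonneg
    nlinarith

theorem tangent_pos {i : Fin 3} (h : i ≠ 0) : 0 < s.tangent i :=
  Real.sqrt_pos.mpr (sub_pos.mpr (hs.inner_lt_sqDist h))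

theorem tangent_sq {i : Fin 3} (h : i ≠ 0) :
    s.tangent i ^ 2 = s.sqDist i (s.foot 0) - s.inner i ^ 2 :=
  Real.sq_sqrt (sub_pos.mpr (hs.inner_lt_sqDist h)).le

theorem exists_factor (i : Fin 3) (θ : ℝ) {ρ : ℝ} (hρ : 0 ≤ ρ) :
    ∃ q, 0 < q ∧ s.sqDist i (s.polar θ ρ) - s.outer i ^ 2 = (ρ - s.outerDist i θ) * q := by
  obtain ⟨q, hq, h⟩ := quadratic_outer (c := s.lead i θ) hρ (sub_pos.mpr (hs.sqDist_lt_outer i))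
  refine ⟨q, hq, ?_⟩
  rw [sqDist_polar, outerDist, ← h]
  ring

theorem le_outer_iff (i : Fin 3) (θ : ℝ) {ρ : ℝ} (hρ : 0 ≤ ρ) :
    dist (s.polar θ ρ) (s.foot i) ≤ s.outer i ↔ ρ ≤ s.outerDist i θ := by
  obtain ⟨q, hq, h⟩ := hs.exists_factor i θ hρ
  rw [dist_le_iff_dot (s.outer_pos i).le]
  change s.sqDist i _ ≤ _ ↔ _
  rw [← sub_nonpos, h, ← sub_nonpos (a := ρ)]
  simpa only [zero_mul] using mul_le_mul_iff_left₀ (b := ρ - s.outerDist i θ) (c := 0) hq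

theorem lt_outer_iff (i : Fin 3) (θ : ℝ) {ρ : ℝ} (hρ : 0 ≤ ρ) :
    dist (s.polar θ ρ) (s.foot i) < s.outer i ↔ ρ < s.outerDist i θ := by
  obtain ⟨q, hq, h⟩ := hs.exists_factor i θ hρ
  rw [dist_lt_iff_dot (s.outer_pos i).le]
  change s.sqDist i _ < _ ↔ _
  rw [← sub_neg, h, ← sub_neg (a := ρ)]
  simpa only [zero_mul] using mul_lt_mul_iff_left₀ (b := ρ - s.outerDist i θ) (c := 0) hq

theorem eq_outer_iff (i : Fin 3) (θ : ℝ) {ρ : ℝ} (hρ : 0 ≤ ρ) :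
    dist (s.polar θ ρ) (s.foot i) = s.outer i ↔ ρ = s.outerDist i θ := by
  rw [le_antisymm_iff, le_antisymm_iff, hs.le_outer_iff i θ hρ, ← not_lt (b := s.outer i),
    hs.lt_outer_iff i θ hρ, not_lt]

theorem le_inner_iff {i : Fin 3} (h : i ≠ 0) {θ : ℝ} (hon : s.tangent i ≤ s.lead i θ) (ρ : ℝ) :
    s.inner i ≤ dist (s.polar θ ρ) (s.foot i) ↔ ρ ≤ s.hi θ i ∨ s.lo θ i ≤ ρ := by
  have h1 := sqDist_sub_inner h (hs.inner_lt_sqDist h).le hon ρ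
  have h2 := s.hi_le_lo h θ
  rw [le_dist_iff_dot (s.inner_pos i).le]
  change _ ≤ s.sqDist i _ ↔ _
  rw [← sub_nonneg, h1, mul_nonneg_iff]
  constructor
  · rintro (h | h)
    · right; linarith
    · left; linarith
  · rintro (h | h)
    · right; constructor <;> linarith
    · left; constructor <;> linarith

theorem eq_inner_iff {i : Fin 3} (h : i ≠ 0) {θ : ℝ} (hon : s.tangent i ≤ s.lead i θ) (ρ : ℝ) :
    dist (s.polar θ ρ) (s.foot i) = s.inner i ↔ ρ = s.hi θ i ∨ ρ = s.lo θ i := by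
  have h1 := sqDist_sub_inner h (hs.inner_lt_sqDist h).le hon ρ
  rw [dist_eq_iff_dot (s.inner_pos i).le]
  change s.sqDist i _ = _ ↔ _
  rw [← sub_eq_zero, h1, mul_eq_zero, sub_eq_zero, sub_eq_zero]

theorem le_inner_of_le {i : Fin 3} (h : i ≠ 0) {θ ρ : ℝ} (hρ : 0 ≤ ρ)
    (hon : s.lead i θ ≤ s.tangent i) : s.inner i ≤ dist (s.polar θ ρ) (s.foot i) := by
  have h1 := sqDist_sub_inner' (hs.inner_lt_sqDist h).le θ ρ
  rw [le_dist_iff_dot (s.inner_pos i).le]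
  change _ ≤ s.sqDist i _
  nlinarith [sq_nonneg (ρ - s.tangent i), mul_nonneg hρ (sub_nonneg.mpr hon)]

theorem lt_inner_of_lt {i : Fin 3} (h : i ≠ 0) {θ ρ : ℝ} (hρ : 0 < ρ)
    (hon : s.lead i θ < s.tangent i) : s.inner i < dist (s.polar θ ρ) (s.foot i) := by
  have h1 := sqDist_sub_inner' (hs.inner_lt_sqDist h).le θ ρ
  rw [lt_dist_iff_dot (s.inner_pos i).le]
  change _ < s.sqDist i _
  nlinarith [sq_nonneg (ρ - s.tangent i), mul_pos hρ (sub_pos.mpr hon)]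

theorem hi_pos {i : Fin 3} (h : i ≠ 0) {θ : ℝ} (hon : s.tangent i ≤ s.lead i θ) : 0 < s.hi θ i := by
  have h0 := hs.tangent_pos h
  rw [hi_of_ne _ h, sub_pos, Real.sqrt_lt' (by linarith)]
  nlinarith

/-- On an inner circle, only this leg is aligned. -/
theorem legDisc_of_inner {x : Plane} {κ : Fin 3} (h : dist x (s.foot κ) = s.inner κ) (i : Fin 3) :
    s.legDisc i x = 0 ↔ i = κ := by
  rw [legDisc_eq_zero]
  constructor
  · intro hi
    by_contra hne
    have h1 := hs.inner_lt_of_inner (Ne.symm hne) h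
    have h2 := hs.lt_outer_of_inner (Ne.symm hne) h
    rcases hi with hi | hi <;> linarith
  · rintro rfl
    exact Or.inl h

/-- An inner circle lies inside of all outer circles. -/
theorem lt_hi_zero_of_inner {κ : Fin 3} {θ ρ : ℝ} (hρ : 0 ≤ ρ)
    (h : dist (s.polar θ ρ) (s.foot κ) = s.inner κ) : ρ < s.hi θ 0 := by
  obtain ⟨i, hi⟩ := s.exists_eq_hi_zero θ
  rw [← hi, ← hs.lt_outer_iff i θ hρ]
  by_cases hne : κ = i
  · rw [← hne, h]
    exact s.inner_lt_outer κ
  · exact hs.lt_outer_of_inner hne h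

theorem dist_lo {θ : ℝ} {κ : Fin 3} (hon : κ ≠ 0 → s.tangent κ ≤ s.lead κ θ) :
    0 < s.lo θ κ ∧ dist (s.polar θ (s.lo θ κ)) (s.foot κ) = s.inner κ := by
  by_cases h : κ = 0
  · subst h
    rw [lo_zero]
    exact ⟨s.inner_pos 0, dist_polar _ _ (s.inner_pos 0).le⟩
  · exact ⟨(hs.hi_pos h (hon h)).trans_le (hi_le_lo h θ),
      (hs.eq_inner_iff h (hon h) _).mpr (Or.inr rfl)⟩

theorem dist_hi {θ : ℝ} {κ : Fin 3} (h : κ ≠ 0) (hon : s.tangent κ ≤ s.lead κ θ) :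
    dist (s.polar θ (s.hi θ κ)) (s.foot κ) = s.inner κ :=
  (hs.eq_inner_iff h hon _).mpr (Or.inl rfl)

/-- The inner disc with the shorter tangents is met first. -/
theorem lo_one_lt_hi_two (ht : s.tangent 1 ≤ s.tangent 2) {θ : ℝ}
    (h1 : s.tangent 1 ≤ s.lead 1 θ) (h2 : s.tangent 2 ≤ s.lead 2 θ) : s.lo θ 1 < s.hi θ 2 := by
  have n1 : (1 : Fin 3) ≠ 0 := by decide
  have n2 : (2 : Fin 3) ≠ 0 := by decide
  have n12 : (1 : Fin 3) ≠ 2 := by decide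
  -- The holes are disjoint, so an end of the chord cut out by one of them is strictly outside the
  -- chord of the other.
  have key : ∀ i j ρ, i ≠ 0 → j ≠ 0 → i ≠ j → s.tangent i ≤ s.lead i θ →
      s.tangent j ≤ s.lead j θ → (ρ = s.hi θ i ∨ ρ = s.lo θ i) → ρ < s.hi θ j ∨ s.lo θ j < ρ := by
    intro i j ρ hi hj hij hoi hoj hρ
    have g1 := hs.inner_lt_of_inner hij ((hs.eq_inner_iff hi hoi ρ).mpr hρ)
    rcases (hs.le_inner_iff hj hoj ρ).mp g1.le with h | h <;> rcases h.lt_or_eq with h | h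
    · exact Or.inl h
    · exact absurd ((hs.eq_inner_iff hj hoj ρ).mpr (Or.inl h)) g1.ne'
    · exact Or.inr h
    · exact absurd ((hs.eq_inner_iff hj hoj ρ).mpr (Or.inr h.symm)) g1.ne'
  have a1 := key 1 2 _ n1 n2 n12 h1 h2 (Or.inr rfl)
  have a2 := key 1 2 _ n1 n2 n12 h1 h2 (Or.inl rfl)
  have a3 := key 2 1 _ n2 n1 n12.symm h2 h1 (Or.inr rfl)
  have a4 := key 2 1 _ n2 n1 n12.symm h2 h1 (Or.inl rfl)
  have b1 := s.hi_le_lo n1 θ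
  have b2 := s.hi_le_lo n2 θ
  by_contra hcon
  have hlt : s.lo θ 2 < s.hi θ 1 := by grind
  -- The power of foot `0`: the two ends of a chord multiply to the squared tangent. In the wrong
  -- order `tangent 2 ^ 2 ≤ lo 2 ^ 2 < hi 1 ^ 2 ≤ tangent 1 ^ 2` would follow.
  have prod : ∀ i, i ≠ 0 → s.tangent i ≤ s.lead i θ → s.hi θ i * s.lo θ i = s.tangent i ^ 2 := by
    intro i hi hoi
    have h0 := hs.tangent_pos hi
    have h2 := Real.sq_sqrt (by nlinarith : 0 ≤ s.lead i θ ^ 2 - s.tangent i ^ 2)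
    rw [hi_of_ne _ hi, lo_of_ne _ hi]
    linear_combination -h2
  have p1 := prod 1 n1 h1
  have p2 := prod 2 n2 h2
  have c1 := hs.hi_pos n1 h1
  have c2 := hs.hi_pos n2 h2
  have t1 := hs.tangent_pos n1
  nlinarith [mul_lt_mul'' hlt hlt (c2.trans_le b2).le (c2.trans_le b2).le]

theorem isFibre (ht : s.tangent 1 ≤ s.tangent 2) {act : Fin 3 → Prop} {θ : ℝ}
    (h : s.Describes act θ) : IsFibre (s.lo θ) (s.hi θ) act where
  base := h.zero
  lt := hs.lt_hi_zero_of_inner (hs.dist_lo fun h => absurd rfl h).1.le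
    (hs.dist_lo fun h => absurd rfl h).2
  hole j hj hact := by
    have hon := h.of_mem j hj hact
    have h1 := hs.dist_lo fun _ => hon
    refine ⟨?_, hi_le_lo hj θ, hs.lt_hi_zero_of_inner h1.1.le h1.2⟩
    have h2 := hs.inner_lt_of_inner hj (hs.dist_hi hj hon)
    rwa [dist_polar _ _ (hs.hi_pos hj hon).le] at h2
  chain h1 h2 := hs.lo_one_lt_hi_two ht (h.of_mem 1 (by decide) h1) (h.of_mem 2 (by decide) h2)

/-- It does not matter whether a hole that is only touched by the ray counts as met: it removes an
open interval of length zero. So one set of holes serves a closed arc of directions up to its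
tangent ends. -/
theorem polar_mem_workspace {act : Fin 3 → Prop} {θ : ℝ} (h : s.Describes act θ) {ρ : ℝ}
    (hρ : 0 < ρ) : s.polar θ ρ ∈ s.workspace ↔ InFibre (s.lo θ) (s.hi θ) act ρ := by
  constructor
  · intro hW
    have h0 := (hW 0).1
    rw [dist_polar _ _ hρ.le] at h0
    exact ⟨h0, le_hi_zero.mpr fun i => (hs.le_outer_iff i θ hρ.le).mp (hW i).2,
      fun j hj hact => (hs.le_inner_iff hj (h.of_mem j hj hact) ρ).mp (hW j).1⟩
  · rintro ⟨h1, h2, h3⟩ i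
    refine ⟨?_, (hs.le_outer_iff i θ hρ.le).mpr (le_hi_zero.mp h2 i)⟩
    by_cases hi : i = 0
    · subst hi
      rwa [dist_polar _ _ hρ.le]
    · by_cases hact : act i
      · exact (hs.le_inner_iff hi (h.of_mem i hi hact) ρ).mpr (h3 i hi hact)
      · exact hs.le_inner_of_le hi hρ.le (h.of_notMem i hi hact)

end IsThreeHoledTriangle

end Spider


/-! ### The directions of the corners and of the tangents -/

theorem exists_dir_Ico {w : Plane} (hw : dot w w = 1) :
    ∃ θ ∈ Set.Ico 0 (2 * Real.pi), dir θ = w := by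
  obtain ⟨θ, rfl⟩ := exists_dir hw
  refine ⟨toIcoMod Real.two_pi_pos 0 θ, by simpa using toIcoMod_mem_Ico Real.two_pi_pos 0 θ, ?_⟩
  have h : toIcoMod Real.two_pi_pos 0 θ = θ - toIcoDiv Real.two_pi_pos 0 θ * (2 * Real.pi) := by
    rw [toIcoMod, zsmul_eq_mul]
  rw [h]
  exact plane_ext (Real.cos_sub_int_mul_two_pi _ _) (Real.sin_sub_int_mul_two_pi _ _)

theorem dir_injOn : Set.InjOn dir (Set.Ico 0 (2 * Real.pi)) := by
  intro α hα β hβ h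
  have h1 := dot_dir α β
  rw [h, dot_dir_self] at h1
  have := (Real.cos_eq_one_iff_of_lt_of_lt (by linarith [hα.2, hβ.1]) (by linarith [hα.1, hβ.2])).mp
    h1.symm
  linarith

theorem dir_two_pi : dir (2 * Real.pi) = dir 0 := plane_ext (by simp) (by simp)

/-- The unit vectors with a given scalar product with `v`. -/
theorem dot_eq_iff {v w : Plane} {t r : ℝ} (hv : dot v v = t ^ 2 + r ^ 2) (hv0 : 0 < dot v v)
    (hw : dot w w = 1) : dot v w = t ↔
      w = (dot v v)⁻¹ • (t • v + r • rot v) ∨ w = (dot v v)⁻¹ • (t • v + (-r) • rot v) := by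
  constructor
  · intro h
    have h1 : cross v w ^ 2 = r ^ 2 := by
      have : dot v w ^ 2 + cross v w ^ 2 = dot v v * dot w w := by
        simp only [dot, cross]; ring
      rw [h, hw, hv] at this
      linarith
    have h2 : w = (dot v v)⁻¹ • (dot v w • v + cross v w • rot v) := by
      rw [eq_inv_smul_iff₀ hv0.ne']
      apply plane_ext <;>
      · simp only [dot, cross, PiLp.smul_apply, PiLp.add_apply, rot_zero, rot_one, smul_eq_mul]
        ring
    rw [h] at h2
    rcases sq_eq_sq_iff_eq_or_eq_neg.mp h1 with h3 | h3 <;> rw [h3] at h2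
    · exact Or.inl h2
    · exact Or.inr h2
  · have : ∀ r' : ℝ, dot v ((dot v v)⁻¹ • (t • v + r' • rot v)) = t := by
      intro r'
      rw [dot_smul_right, inv_mul_eq_iff_eq_mul₀ hv0.ne']
      simp only [dot, PiLp.smul_apply, PiLp.add_apply, rot_zero, rot_one, smul_eq_mul]
      ring
    rintro (rfl | rfl) <;> exact this _

/-- The solutions are mirror images of each other in the line of `v` and differ because `r > 0`. For
the tangents to a hole, `t` is their length and `r` the radius of the hole. -/
theorem ncard_directions {v : Plane} {t r : ℝ} (hv : dot v v = t ^ 2 + r ^ 2) (hr : 0 < r) :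
    {θ | θ ∈ Set.Ico 0 (2 * Real.pi) ∧ dot v (dir θ) = t}.ncard = 2 := by
  have hv0 : 0 < dot v v := by rw [hv]; positivity
  have hunit : ∀ r' : ℝ, r' ^ 2 = r ^ 2 → dot ((dot v v)⁻¹ • (t • v + r' • rot v))
      ((dot v v)⁻¹ • (t • v + r' • rot v)) = 1 := by
    intro r' hr'
    have e : ∀ (c : ℝ) (u : Plane), dot (c • u) (c • u) = c ^ 2 * dot u u := by
      intro c u; simp only [dot, PiLp.smul_apply, smul_eq_mul]; ring
    have e' : dot (t • v + r' • rot v) (t • v + r' • rot v) = (t ^ 2 + r' ^ 2) * dot v v := by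
      simp only [dot, PiLp.smul_apply, PiLp.add_apply, rot_zero, rot_one, smul_eq_mul]
      ring
    rw [e, e', hr', ← hv]
    field_simp
  obtain ⟨α, hα, hα'⟩ := exists_dir_Ico (hunit r rfl)
  obtain ⟨β, hβ, hβ'⟩ := exists_dir_Ico (hunit (-r) (neg_sq r))
  have hne : α ≠ β := by
    rintro rfl
    have h1 := smul_right_injective Plane (inv_ne_zero hv0.ne') (hα'.symm.trans hβ')
    have h2 := smul_left_injective ℝ (m := rot v) ?_ (add_left_cancel h1)
    · linarith
    · intro h0
      have : dot (rot v) (rot v) = dot v v := by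
        simp only [dot, rot_zero, rot_one]; ring
      rw [h0] at this
      simp only [dot, PiLp.zero_apply, mul_zero, add_zero] at this hv0
      linarith
  have : {θ | θ ∈ Set.Ico 0 (2 * Real.pi) ∧ dot v (dir θ) = t} = {α, β} := by
    ext θ
    simp only [Set.mem_ofPred_eq, Set.mem_insert_iff, Set.mem_singleton_iff]
    constructor
    · rintro ⟨hθ, h⟩
      rcases (dot_eq_iff hv hv0 (dot_dir_self θ)).mp h with h | h
      · exact Or.inl (dir_injOn hθ hα (h.trans hα'.symm))
      · exact Or.inr (dir_injOn hθ hβ (h.trans hβ'.symm))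
    · rintro (rfl | rfl)
      · exact ⟨hα, (dot_eq_iff hv hv0 (dot_dir_self _)).mpr (Or.inl hα')⟩
      · exact ⟨hβ, (dot_eq_iff hv hv0 (dot_dir_self _)).mpr (Or.inr hβ')⟩
  rw [this, Set.ncard_pair hne]

theorem pos_of_ne_zero {f : ℝ → ℝ} (hf : Continuous f) {a b m : ℝ}
    (h0 : ∀ x ∈ Set.Ioo a b, f x ≠ 0) (hm : m ∈ Set.Ioo a b) (h : 0 < f m) :
    ∀ x ∈ Set.Ioo a b, 0 < f x := by
  intro x hx
  by_contra hle
  rw [not_lt] at hle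
  obtain ⟨y, hy, hy0⟩ := intermediate_value_uIcc hf.continuousOn
    (show (0 : ℝ) ∈ Set.uIcc (f x) (f m) from Set.mem_uIcc.mpr (Or.inl ⟨hle, h.le⟩))
  exact h0 y (Set.ordConnected_Ioo.uIcc_subset hx hm hy) hy0

theorem nonneg_of_ne_zero {f : ℝ → ℝ} (hf : Continuous f) {a b m : ℝ}
    (h0 : ∀ x ∈ Set.Ioo a b, f x ≠ 0) (hm : m ∈ Set.Ioo a b) (h : 0 < f m) :
    ∀ x ∈ Set.Icc a b, 0 ≤ f x := by
  have h1 : closure (Set.Ioo a b) ⊆ {x | 0 ≤ f x} :=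
    (isClosed_le continuous_const hf).closure_subset_iff.mpr
      fun x hx => (pos_of_ne_zero hf h0 hm h x hx).le
  rwa [closure_Ioo (hm.1.trans hm.2).ne] at h1

namespace Spider

variable {s : Spider}

theorem exists_polar {x : Plane} (hx : x ≠ s.foot 0) :
    ∃ θ ∈ Set.Ico 0 (2 * Real.pi), ∃ ρ, 0 < ρ ∧ s.polar θ ρ = x := by
  have hd := dist_pos.mpr hx
  obtain ⟨θ, hθ, h⟩ := exists_dir_Ico (w := (dist x (s.foot 0))⁻¹ • (x - s.foot 0)) (by
    rw [← norm_sq_eq_dot, norm_smul, ← dist_eq_norm, Real.norm_of_nonneg (inv_pos.mpr hd).le,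
      inv_mul_cancel₀ hd.ne', one_pow])
  refine ⟨θ, hθ, _, hd, ?_⟩
  rw [polar, h, smul_inv_smul₀ hd.ne', add_sub_cancel]

theorem polar_injective {θ θ' ρ ρ' : ℝ} (hθ : θ ∈ Set.Ico 0 (2 * Real.pi))
    (hθ' : θ' ∈ Set.Ico 0 (2 * Real.pi)) (hρ : 0 < ρ) (hρ' : 0 < ρ')
    (h : s.polar θ ρ = s.polar θ' ρ') : θ = θ' ∧ ρ = ρ' := by
  have h1 := s.dist_polar θ ρ hρ.le
  rw [h, dist_polar _ _ hρ'.le] at h1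
  subst h1
  exact ⟨dir_injOn hθ hθ' (smul_right_injective _ hρ.ne' (add_left_cancel h)), rfl⟩

/-- The inner discs met by a ray. -/
def meets (s : Spider) (θ : ℝ) (j : Fin 3) : Prop := j = 0 ∨ s.tangent j ≤ s.lead j θ

theorem describes_meets (θ : ℝ) : s.Describes (s.meets θ) θ where
  zero := Or.inl rfl
  of_mem _ hj h := h.resolve_left hj
  of_notMem _ _ h := (not_le.mp (not_or.mp h).2).le

namespace IsThreeHoledTriangle

variable (hs : s.IsThreeHoledTriangle)

include hs

theorem outerDist_pos (i : Fin 3) (θ : ℝ) : 0 < s.outerDist i θ := by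
  have h := sub_pos.mpr (hs.sqDist_lt_outer i)
  obtain ⟨q, hq, h1⟩ := quadratic_outer (c := s.lead i θ) le_rfl h
  rw [outerDist]
  nlinarith

theorem hi_zero_pos (θ : ℝ) : 0 < s.hi θ 0 := by
  obtain ⟨i, hi⟩ := s.exists_eq_hi_zero θ
  rw [← hi]
  exact hs.outerDist_pos i θ

theorem legDisc_hi_zero (θ : ℝ) (i : Fin 3) :
    s.legDisc i (s.polar θ (s.hi θ 0)) = 0 ↔ s.outerDist i θ = s.hi θ 0 := by
  have h0 := (hs.hi_zero_pos θ).le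
  rw [legDisc_eq_zero, hs.eq_outer_iff i θ h0, eq_comm (a := s.outerDist i θ), or_iff_right]
  exact fun h => lt_irrefl _ (hs.lt_hi_zero_of_inner h0 h)

theorem legDisc_between (ht : s.tangent 1 ≤ s.tangent 2) {θ ρ : ℝ} {κ : Fin 3}
    (hκ : s.meets θ κ) (h1 : s.lo θ κ < ρ) (h2 : ρ < upperEnd (s.hi θ) (s.meets θ) κ) (i : Fin 3) :
    s.legDisc i (s.polar θ ρ) ≠ 0 := by
  have hd := s.describes_meets θ
  have hF := hs.isFibre ht hd
  have hρ : 0 < ρ := (hs.dist_lo fun h => hd.of_mem κ h hκ).1.trans h1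
  have h3 := hF.between hκ h1.le h2.le
  have h4 : ρ < s.hi θ 0 := lt_of_le_of_ne h3.2.1 (hF.strictly_between hκ h1 h2 hF.base).2.1
  rw [Ne, legDisc_eq_zero, not_or, hs.eq_outer_iff i θ hρ.le]
  refine ⟨fun h => ?_, (h4.trans_le (hi_zero_le i θ)).ne⟩
  by_cases hi : i = 0
  · subst hi
    rw [dist_polar _ _ hρ.le] at h
    exact (hF.strictly_between hκ h1 h2 hF.base).1 h
  · by_cases hon : s.tangent i ≤ s.lead i θ
    · have h5 := hF.strictly_between hκ h1 h2 (κ' := i) (Or.inr hon)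
      rcases (hs.eq_inner_iff hi hon ρ).mp h with h | h
      · exact h5.2.1 h
      · exact h5.1 h
    · exact (hs.lt_inner_of_lt hi hρ (not_le.mp hon)).ne' h

theorem polar_hi_zero_mem (ht : s.tangent 1 ≤ s.tangent 2) (θ : ℝ) :
    s.polar θ (s.hi θ 0) ∈ s.workspace := by
  have hF := hs.isFibre ht (s.describes_meets θ)
  exact (hs.polar_mem_workspace (s.describes_meets θ) (hs.hi_zero_pos θ)).mpr
    (hF.inFibre_level hF.base (some true) (w := 0) (by simp))

/-- The directions of the corners. -/
theorem exists_corner_directions (ht : s.tangent 1 ≤ s.tangent 2) :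
    ∃ C : Finset ℝ, C.card = 3 ∧ (∀ θ ∈ C, θ ∈ Set.Ico 0 (2 * Real.pi)) ∧
      ∀ θ ∈ Set.Ico 0 (2 * Real.pi),
      (s.aligned (s.polar θ (s.hi θ 0))).card = if θ ∈ C then 2 else 1 := by
  classical
  obtain ⟨c, hc, hinj, hu⟩ := hs.exists_corners
  choose α hα ρ hρ h using fun k => exists_polar (ne_foot (hc k).1 0)
  -- A corner is on an outer circle and outside of none, so it is the far end of the workspace in
  -- its direction.
  have hhi : ∀ k, ρ k = s.hi (α k) 0 := by
    intro k
    obtain ⟨i, hik⟩ : ∃ i, i ≠ k := ⟨k + 1, by revert k; decide⟩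
    have h1 := ((hc k).2 i).mp hik
    rw [← h k, hs.eq_outer_iff i _ (hρ k).le] at h1
    refine le_antisymm (le_hi_zero.mpr fun j => ?_) (h1.symm ▸ hi_zero_le i (α k))
    have h2 := ((hc k).1 j).2
    rwa [← h k, hs.le_outer_iff j _ (hρ k).le] at h2
  have hpt : ∀ k, s.polar (α k) (s.hi (α k) 0) = c k := fun k => by rw [← hhi k, h k]
  refine ⟨Finset.univ.image α, ?_, ?_, fun θ hθ => ?_⟩
  · rw [Finset.card_image_of_injective, Finset.card_univ, Fintype.card_fin]
    intro k k' hkk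
    apply hinj
    rw [← hpt, ← hpt, hkk]
  · intro θ hθ
    obtain ⟨k, -, rfl⟩ := Finset.mem_image.mp hθ
    exact hα k
  · have hmem := hs.polar_hi_zero_mem ht θ
    have hmem_iff : ∀ i, i ∈ s.aligned (s.polar θ (s.hi θ 0)) ↔
        dist (s.polar θ (s.hi θ 0)) (s.foot i) = s.outer i := by
      intro i
      rw [mem_aligned, hs.legDisc_hi_zero, hs.eq_outer_iff i θ (hs.hi_zero_pos θ).le, eq_comm]
    split_ifs with hC
    · obtain ⟨k, -, rfl⟩ := Finset.mem_image.mp hC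
      obtain ⟨h1, h2, h3⟩ : k + 1 ≠ k + 2 ∧ k ≠ k + 1 ∧ k ≠ k + 2 := by
        clear hC hmem_iff hmem hθ
        revert k
        decide
      rw [hpt, hs.aligned_corner h1 h2 h3 (hc k).1 (((hc k).2 _).mp h2.symm)
        (((hc k).2 _).mp h3.symm), Finset.card_pair h1]
    · obtain ⟨i, hi⟩ := s.exists_eq_hi_zero θ
      have hi' : i ∈ s.aligned (s.polar θ (s.hi θ 0)) :=
        mem_aligned.mpr ((hs.legDisc_hi_zero θ i).mpr hi)
      rw [Finset.card_eq_one]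
      refine ⟨i, Finset.eq_singleton_iff_unique_mem.mpr ⟨hi', fun j hj => ?_⟩⟩
      by_contra hne
      obtain ⟨k, hki, hkj, -⟩ := exists_third (Ne.symm hne)
      have h1 := hu i j k _ (Ne.symm hne) hki hkj hmem ((hmem_iff i).mp hi') ((hmem_iff j).mp hj)
      rw [← h k] at h1
      exact hC (Finset.mem_image.mpr
        ⟨k, Finset.mem_univ k, (polar_injective hθ (hα k) (hs.hi_zero_pos θ) (hρ k) h1).1.symm⟩)

/-- The directions of the tangents to an inner disc. -/
theorem ncard_tangents {j : Fin 3} (hj : j ≠ 0) :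
    {θ | θ ∈ Set.Ico 0 (2 * Real.pi) ∧ s.lead j θ = s.tangent j}.ncard = 2 := by
  refine ncard_directions (r := s.inner j) ?_ (s.inner_pos j)
  rw [hs.tangent_sq hj]
  simp only [sqDist, dot, PiLp.sub_apply]
  ring

/-- Between the directions of the corners, the same leg is stretched at the upper end. -/
theorem aligned_hi_zero_eq {a b : ℝ}
    (h : ∀ θ ∈ Set.Ioo a b, (s.aligned (s.polar θ (s.hi θ 0))).card = 1) {θ θ' : ℝ}
    (hθ : θ ∈ Set.Ioo a b) (hθ' : θ' ∈ Set.Ioo a b) :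
    s.aligned (s.polar θ (s.hi θ 0)) = s.aligned (s.polar θ' (s.hi θ' 0)) := by
  have hmem : ∀ i θ, i ∈ s.aligned (s.polar θ (s.hi θ 0)) ↔ s.outerDist i θ = s.hi θ 0 :=
    fun i θ => by rw [mem_aligned, hs.legDisc_hi_zero]
  have key : ∀ i, ∀ θ ∈ Set.Ioo a b, ∀ θ' ∈ Set.Ioo a b,
      s.outerDist i θ = s.hi θ 0 → s.outerDist i θ' = s.hi θ' 0 := by
    intro i θ hθ θ' hθ' heq
    by_contra hne
    have hcases : ∀ j, j = i ∨ j = i + 1 ∨ j = i + 2 := by clear heq hne; revert i; decide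
    have h1 : i ≠ i + 1 := by clear heq hne hcases; revert i; decide
    have h2 : i ≠ i + 2 := by clear heq hne hcases h1; revert i; decide
    -- The gap between outer circle `i` and the nearest other one along the ray. It cannot vanish
    -- while circle `i` is the nearest without two legs being stretched at the far end, so it keeps
    -- its sign on the interval.
    have hcont : Continuous fun θ => min (s.outerDist (i + 1) θ) (s.outerDist (i + 2) θ) -
        s.outerDist i θ := by fun_prop
    have hno : ∀ ξ ∈ Set.Ioo a b,
        min (s.outerDist (i + 1) ξ) (s.outerDist (i + 2) ξ) - s.outerDist i ξ ≠ 0 := by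
      intro ξ hξ h0
      have h3 : s.outerDist i ξ = s.hi ξ 0 := by
        refine le_antisymm (le_hi_zero.mpr fun j => ?_) (hi_zero_le i ξ)
        rw [← sub_eq_zero.mp h0]
        rcases hcases j with rfl | rfl | rfl
        · exact (sub_eq_zero.mp h0).le
        · exact min_le_left _ _
        · exact min_le_right _ _
      obtain ⟨n, hn⟩ := Finset.card_eq_one.mp (h ξ hξ)
      have hin := (hmem i ξ).mpr h3
      rw [hn, Finset.mem_singleton] at hin
      rcases min_choice (s.outerDist (i + 1) ξ) (s.outerDist (i + 2) ξ) with h4 | h4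
      · have := (hmem (i + 1) ξ).mpr (by rw [← h4, ← h3]; exact sub_eq_zero.mp h0)
        rw [hn, Finset.mem_singleton] at this
        exact h1 (hin.trans this.symm)
      · have := (hmem (i + 2) ξ).mpr (by rw [← h4, ← h3]; exact sub_eq_zero.mp h0)
        rw [hn, Finset.mem_singleton] at this
        exact h2 (hin.trans this.symm)
    have hpos : 0 < min (s.outerDist (i + 1) θ) (s.outerDist (i + 2) θ) - s.outerDist i θ := by
      refine lt_of_le_of_ne (sub_nonneg.mpr ?_) (hno θ hθ).symm
      rw [heq]
      exact le_min (hi_zero_le _ _) (hi_zero_le _ _)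
    have h3 := pos_of_ne_zero hcont hno hθ hpos θ' hθ'
    refine hne (le_antisymm (le_hi_zero.mpr fun j => ?_) (hi_zero_le i θ'))
    rcases hcases j with rfl | rfl | rfl
    · exact le_rfl
    · exact (sub_pos.mp h3).le.trans (min_le_left _ _)
    · exact (sub_pos.mp h3).le.trans (min_le_right _ _)
  ext i
  rw [hmem, hmem]
  exact ⟨key i θ hθ θ' hθ', key i θ' hθ' θ hθ⟩

end IsThreeHoledTriangle

/-- Between the directions of the tangents, the rays meet the same inner discs. -/
theorem meets_eq {a b m θ : ℝ} (h : ∀ j, j ≠ 0 → ∀ θ ∈ Set.Ioo a b, s.lead j θ ≠ s.tangent j)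
    (hm : m ∈ Set.Ioo a b) (hθ : θ ∈ Set.Ioo a b) : s.meets m = s.meets θ := by
  have key : ∀ m ∈ Set.Ioo a b, ∀ θ ∈ Set.Ioo a b, ∀ j, s.meets m j → s.meets θ j := by
    intro m hm θ hθ j hj
    by_cases hj0 : j = 0
    · exact Or.inl hj0
    · refine Or.inr (sub_nonneg.mp ?_)
      exact (pos_of_ne_zero ((continuous_lead j).sub continuous_const)
        (fun θ hθ => sub_ne_zero.mpr (h j hj0 θ hθ)) hm
        (sub_pos.mpr ((hj.resolve_left hj0).lt_of_ne' (h j hj0 m hm))) θ hθ).le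
  ext j
  exact ⟨key m hm θ hθ j, key θ hθ m hm j⟩

/-- The strict inequalities of the open interval become weak at its ends, where a ray may be a
tangent; `Describes` allows exactly this. -/
theorem describes_of_mem_Icc {a b m θ : ℝ}
    (h : ∀ j, j ≠ 0 → ∀ θ ∈ Set.Ioo a b, s.lead j θ ≠ s.tangent j)
    (hm : m ∈ Set.Ioo a b) (hθ : θ ∈ Set.Icc a b) : s.Describes (s.meets m) θ where
  zero := Or.inl rfl
  of_mem j hj hmj := sub_nonneg.mp
    (nonneg_of_ne_zero ((continuous_lead j).sub continuous_const)
      (fun θ hθ => sub_ne_zero.mpr (h j hj θ hθ)) hm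
      (sub_pos.mpr ((hmj.resolve_left hj).lt_of_ne' (h j hj m hm))) θ hθ)
  of_notMem j hj hmj := sub_nonneg.mp
    (nonneg_of_ne_zero (continuous_const.sub (continuous_lead j))
      (fun θ hθ => sub_ne_zero.mpr (h j hj θ hθ).symm) hm
      (sub_pos.mpr (not_le.mp (not_or.mp hmj).2)) θ hθ)

end Spider


/-! ### Subdivisions of the circle of directions -/

/-- A finite set of directions, represented by angles in `[0, 2π)`, with the next angle of each. -/
structure IsSubdivision (Θ : Finset ℝ) (nxt : ℝ → ℝ) : Prop where
  zero_mem : 0 ∈ Θ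
  mem_Ico : ∀ θ ∈ Θ, θ ∈ Set.Ico 0 (2 * Real.pi)
  lt_next : ∀ θ ∈ Θ, θ < nxt θ
  next_mem : ∀ θ ∈ Θ, nxt θ ∈ Θ ∨ nxt θ = 2 * Real.pi
  next_le : ∀ θ ∈ Θ, ∀ θ' ∈ Θ, θ < θ' → nxt θ ≤ θ'

theorem exists_isSubdivision {Θ : Finset ℝ} (h0 : 0 ∈ Θ)
    (h : ∀ θ ∈ Θ, θ ∈ Set.Ico 0 (2 * Real.pi)) : ∃ nxt, IsSubdivision Θ nxt := by
  have key : ∀ θ ∈ Θ, ∃ η, θ < η ∧ (η ∈ Θ ∨ η = 2 * Real.pi) ∧ ∀ θ' ∈ Θ, θ < θ' → η ≤ θ' := by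
    intro θ hθ
    have hne : ((insert (2 * Real.pi) Θ).filter (θ < ·)).Nonempty :=
      ⟨2 * Real.pi, Finset.mem_filter.mpr ⟨Finset.mem_insert_self _ _, (h θ hθ).2⟩⟩
    have hmin := Finset.mem_filter.mp (Finset.min'_mem _ hne)
    refine ⟨_, hmin.2, (Finset.mem_insert.mp hmin.1).symm, fun θ' hθ' hlt => ?_⟩
    exact Finset.min'_le _ _ (Finset.mem_filter.mpr ⟨Finset.mem_insert_of_mem hθ', hlt⟩)
  choose! nxt h1 h2 h3 using key
  exact ⟨nxt, h0, h, h1, h2, h3⟩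

/-- The point `u ∈ [-1, 1]` of the arc after the angle `θ`, or the angle `θ` itself. -/
def arc (nxt : ℝ → ℝ) (h : Bool) (θ u : ℝ) : ℝ :=
  if h then θ + (nxt θ - θ) * ((1 + u) / 2) else θ

theorem continuous_arc (nxt : ℝ → ℝ) (h : Bool) (θ : ℝ) : Continuous (arc nxt h θ) := by
  unfold arc; split_ifs <;> fun_prop

theorem arc_false (nxt : ℝ → ℝ) (θ u : ℝ) : arc nxt false θ u = θ := rfl

theorem arc_true (nxt : ℝ → ℝ) (θ u : ℝ) :
    arc nxt true θ u = θ + (nxt θ - θ) * ((1 + u) / 2) := rfl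

namespace IsSubdivision

variable {Θ : Finset ℝ} {nxt : ℝ → ℝ} (hΘ : IsSubdivision Θ nxt)

include hΘ

theorem next_le_two_pi {θ : ℝ} (hθ : θ ∈ Θ) : nxt θ ≤ 2 * Real.pi := by
  rcases hΘ.next_mem θ hθ with h | h
  · exact (hΘ.mem_Ico _ h).2.le
  · exact h.le

theorem arc_mem_Ioo {θ u : ℝ} (hθ : θ ∈ Θ) (hu : |u| < 1) :
    arc nxt true θ u ∈ Set.Ioo θ (nxt θ) := by
  have h := sub_pos.mpr (hΘ.lt_next θ hθ)
  obtain ⟨h1, h2⟩ := abs_lt.mp hu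
  rw [arc_true]
  constructor
  · nlinarith [mul_pos h (by linarith : 0 < 1 + u)]
  · nlinarith [mul_pos h (by linarith : 0 < 1 - u)]

theorem arc_mem_Icc {θ u : ℝ} (hθ : θ ∈ Θ) (hu : |u| ≤ 1) :
    arc nxt true θ u ∈ Set.Icc θ (nxt θ) := by
  have h := sub_pos.mpr (hΘ.lt_next θ hθ)
  obtain ⟨h1, h2⟩ := abs_le.mp hu
  rw [arc_true]
  constructor
  · nlinarith [mul_nonneg h.le (by linarith : 0 ≤ 1 + u)]
  · nlinarith [mul_nonneg h.le (by linarith : 0 ≤ 1 - u)]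

theorem notMem_of_mem_Ioo {θ x : ℝ} (hθ : θ ∈ Θ) (hx : x ∈ Set.Ioo θ (nxt θ)) : x ∉ Θ :=
  fun h => not_lt.mpr (hΘ.next_le θ hθ x h hx.1) hx.2

theorem Ioo_subset {θ : ℝ} (hθ : θ ∈ Θ) : Set.Ioo θ (nxt θ) ⊆ Set.Ico 0 (2 * Real.pi) :=
  fun _ hx => ⟨(hΘ.mem_Ico θ hθ).1.trans hx.1.le, hx.2.trans_le (hΘ.next_le_two_pi hθ)⟩

theorem arc_mem_Ico {h : Bool} {θ u : ℝ} (hθ : θ ∈ Θ) (hu : |u| < 1) :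
    arc nxt h θ u ∈ Set.Ico 0 (2 * Real.pi) := by
  cases h
  · exact hΘ.mem_Ico θ hθ
  · exact hΘ.Ioo_subset hθ (hΘ.arc_mem_Ioo hθ hu)

theorem arc_injective {h h' : Bool} {θ θ' u u' : ℝ} (hθ : θ ∈ Θ) (hθ' : θ' ∈ Θ) (hu : |u| < 1)
    (hu' : |u'| < 1) (heq : arc nxt h θ u = arc nxt h' θ' u') :
    h = h' ∧ θ = θ' ∧ (h = true → u = u') := by
  match h, h' with
  | false, false => exact ⟨rfl, heq, fun h => by simp at h⟩
  | false, true =>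
    exact absurd (heq ▸ hθ) (hΘ.notMem_of_mem_Ioo hθ' (hΘ.arc_mem_Ioo hθ' hu'))
  | true, false =>
    exact absurd (heq ▸ hθ') (hΘ.notMem_of_mem_Ioo hθ (hΘ.arc_mem_Ioo hθ hu))
  | true, true =>
    have h1 := hΘ.arc_mem_Ioo hθ hu
    have h2 := hΘ.arc_mem_Ioo hθ' hu'
    rw [← heq] at h2
    obtain rfl : θ = θ' := by
      rcases lt_trichotomy θ θ' with h | h | h
      · have := hΘ.next_le θ hθ θ' hθ' h
        linarith [h1.2, h2.1]
      · exact h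
      · have := hΘ.next_le θ' hθ' θ hθ h
        linarith [h2.2, h1.1]
    refine ⟨rfl, rfl, fun _ => ?_⟩
    rw [arc_true, arc_true] at heq
    have := mul_left_cancel₀ (sub_pos.mpr (hΘ.lt_next θ hθ)).ne' (add_left_cancel heq)
    linarith

theorem exists_arc {x : ℝ} (hx : x ∈ Set.Ico 0 (2 * Real.pi)) :
    ∃ h, ∃ θ ∈ Θ, ∃ u, |u| < 1 ∧ (h = false → u = 0) ∧ arc nxt h θ u = x := by
  -- As `0 ∈ Θ`, some angle of the subdivision is at most `x`; the largest such angle starts the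
  -- arc.
  have hne : (Θ.filter (· ≤ x)).Nonempty :=
    ⟨0, Finset.mem_filter.mpr ⟨hΘ.zero_mem, hx.1⟩⟩
  obtain ⟨hθ, hle⟩ := Finset.mem_filter.mp (Finset.max'_mem _ hne)
  have hmax : ∀ θ' ∈ Θ, θ' ≤ x → θ' ≤ (Θ.filter (· ≤ x)).max' hne :=
    fun θ' h1 h2 => Finset.le_max' _ _ (Finset.mem_filter.mpr ⟨h1, h2⟩)
  generalize (Θ.filter (· ≤ x)).max' hne = θ at *
  rcases hle.eq_or_lt with rfl | hlt
  · exact ⟨false, θ, hθ, 0, by simp, fun _ => rfl, rfl⟩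
  · have hxn : x < nxt θ := by
      rcases hΘ.next_mem θ hθ with h | h
      · by_contra hcon
        exact absurd (hmax _ h (not_lt.mp hcon)) (not_le.mpr (hΘ.lt_next θ hθ))
      · rw [h]; exact hx.2
    have h0 : 0 < nxt θ - θ := by linarith
    refine ⟨true, θ, hθ, 2 * ((x - θ) / (nxt θ - θ)) - 1, ?_, fun h => by simp at h, ?_⟩
    · have h1 : 0 < (x - θ) / (nxt θ - θ) := div_pos (by linarith) h0
      have h2 : (x - θ) / (nxt θ - θ) < 1 := by rw [div_lt_one h0]; linarith
      rw [abs_lt]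
      constructor <;> linarith
    · rw [arc_true]
      field_simp
      ring

/-- The end points of an arc belong to the subdivision. -/
theorem exists_dir_arc_eq {θ u : ℝ} (hθ : θ ∈ Θ) (hu : |u| = 1) :
    ∃ θ' ∈ Θ, dir (arc nxt true θ u) = dir θ' := by
  rcases eq_or_eq_neg_of_abs_eq hu with rfl | rfl
  · have : arc nxt true θ 1 = nxt θ := by rw [arc_true]; ring
    rw [this]
    rcases hΘ.next_mem θ hθ with h | h
    · exact ⟨_, h, rfl⟩
    · exact ⟨0, hΘ.zero_mem, by rw [h, dir_two_pi]⟩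
  · exact ⟨θ, hθ, by rw [arc_true]; congr 1; ring⟩

end IsSubdivision


/-! ### The cells of the workspace over the points and arcs of the circle of directions -/

theorem continuous_level {Z : Type*} [TopologicalSpace Z] {lo hi : Z → Fin 3 → ℝ} {w : Z → ℝ}
    (hlo : ∀ κ, Continuous fun x => lo x κ) (hhi : ∀ κ, Continuous fun x => hi x κ)
    (hw : Continuous w) (on : Fin 3 → Prop) (κ : Fin 3) (l : Option Bool) :
    Continuous fun x => level (lo x) (hi x) on κ l (w x) := by
  have h1 : Continuous fun x => upperEnd (hi x) on κ := by
    unfold upperEnd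
    split_ifs
    · exact hhi 1
    · exact hhi 2
    · exact hhi 0
  match l with
  | none => exact (hlo κ).add ((h1.sub (hlo κ)).mul (by fun_prop))
  | some true => exact hhi κ
  | some false => exact hlo κ

namespace Spider

variable {s : Spider}

theorem lead_congr {θ θ' : ℝ} (h : dir θ = dir θ') (i : Fin 3) : s.lead i θ = s.lead i θ' := by
  rw [lead, h, lead]

theorem lo_congr {θ θ' : ℝ} (h : dir θ = dir θ') : s.lo θ = s.lo θ' := by
  ext κ
  simp only [lo, lead_congr h]

theorem hi_congr {θ θ' : ℝ} (h : dir θ = dir θ') : s.hi θ = s.hi θ' := by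
  ext κ
  simp only [hi, outerDist, lead_congr h]

/-- A subdivision of the circle of directions which contains the directions of the corners and of
the tangents to the inner discs. -/
structure IsSweep (s : Spider) (Θ : Finset ℝ) (nxt : ℝ → ℝ) : Prop extends
    IsSubdivision Θ nxt where
  tangent_mem : ∀ j, j ≠ 0 → ∀ θ ∈ Set.Ico 0 (2 * Real.pi), s.lead j θ = s.tangent j → θ ∈ Θ
  corner_mem : ∀ θ ∈ Set.Ico 0 (2 * Real.pi), θ ∉ Θ →
    (s.aligned (s.polar θ (s.hi θ 0))).card = 1

/-- The inner discs met by the rays of an arc of directions. -/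
def arcMeets (s : Spider) (nxt : ℝ → ℝ) (h : Bool) (θ : ℝ) : Fin 3 → Prop :=
  s.meets (arc nxt h θ 0)

/-- The cells over an arc or a point of the circle of directions. -/
def IsCell (s : Spider) (nxt : ℝ → ℝ) (h : Bool) (θ : ℝ) (κ : Fin 3) (l : Option Bool) : Prop :=
  IsLevel (s.lo (arc nxt h θ 0)) (s.hi (arc nxt h θ 0)) (s.arcMeets nxt h θ) κ l

/-- The characteristic maps of the cells of the workspace. -/
def cellMap (s : Spider) (nxt : ℝ → ℝ) (h : Bool) (θ : ℝ) (κ : Fin 3) (l : Option Bool)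
    (a b : ℝ) : Plane :=
  s.polar (arc nxt h θ a) (level (s.lo (arc nxt h θ a)) (s.hi (arc nxt h θ a))
    (s.arcMeets nxt h θ) κ l (if h then b else a))

/-- The dimension of a cell. -/
def cellDim (h : Bool) (l : Option Bool) : ℕ :=
  (if h then 1 else 0) + (if l = none then 1 else 0)

/-- The legs that are aligned on a cell. -/
def cellAligned (s : Spider) (nxt : ℝ → ℝ) (h : Bool) (θ : ℝ) (κ : Fin 3) :
    Option Bool → Finset (Fin 3)
  | none => ∅
  | some false => {κ}
  | some true => if κ = 0 then
      s.aligned (s.polar (arc nxt h θ 0) (s.hi (arc nxt h θ 0) 0)) else {κ}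

theorem continuous_cellMap (nxt : ℝ → ℝ) (h : Bool) (θ : ℝ) (κ : Fin 3) (l : Option Bool) :
    Continuous fun p : ℝ × ℝ => s.cellMap nxt h θ κ l p.1 p.2 := by
  have h1 : Continuous fun p : ℝ × ℝ => arc nxt h θ p.1 := (continuous_arc nxt h θ).comp
    continuous_fst
  refine continuous_polar h1 (continuous_level (fun κ => (continuous_lo κ).comp h1)
    (fun κ => (continuous_hi κ).comp h1) ?_ _ κ l)
  split_ifs <;> fun_prop

namespace IsSweep

variable {Θ : Finset ℝ} {nxt : ℝ → ℝ} (hΘ : s.IsSweep Θ nxt)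

include hΘ

theorem lead_ne {θ : ℝ} (hθ : θ ∈ Θ) (j : Fin 3) (hj : j ≠ 0) :
    ∀ η ∈ Set.Ioo θ (nxt θ), s.lead j η ≠ s.tangent j := fun η hη h =>
  hΘ.notMem_of_mem_Ioo hθ hη (hΘ.tangent_mem j hj η (hΘ.Ioo_subset hθ hη) h)

theorem arcMeets_eq {h : Bool} {θ u : ℝ} (hθ : θ ∈ Θ) (hu : |u| < 1) :
    s.arcMeets nxt h θ = s.meets (arc nxt h θ u) := by
  cases h
  · rfl
  · exact meets_eq (hΘ.lead_ne hθ) (hΘ.arc_mem_Ioo hθ (by simp)) (hΘ.arc_mem_Ioo hθ hu)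

theorem describes {h : Bool} {θ u : ℝ} (hθ : θ ∈ Θ) (hu : |u| ≤ 1) :
    s.Describes (s.arcMeets nxt h θ) (arc nxt h θ u) := by
  cases h
  · exact describes_meets θ
  · exact describes_of_mem_Icc (hΘ.lead_ne hθ) (hΘ.arc_mem_Ioo hθ (by simp))
      (hΘ.arc_mem_Icc hθ hu)

end IsSweep

namespace IsThreeHoledTriangle

variable (hs : s.IsThreeHoledTriangle)

include hs

theorem hi_eq_lo_iff {j : Fin 3} (hj : j ≠ 0) {θ : ℝ} (hon : s.tangent j ≤ s.lead j θ) :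
    s.hi θ j = s.lo θ j ↔ s.lead j θ = s.tangent j := by
  have h0 := hs.tangent_pos hj
  rw [hi_of_ne _ hj, lo_of_ne _ hj]
  constructor
  · intro h
    have h1 : √(s.lead j θ ^ 2 - s.tangent j ^ 2) = 0 := by linarith
    rw [Real.sqrt_eq_zero (by nlinarith)] at h1
    nlinarith
  · intro h
    rw [h, sub_self, Real.sqrt_zero]
    ring

variable {Θ : Finset ℝ} {nxt : ℝ → ℝ} (hΘ : s.IsSweep Θ nxt)

include hΘ

/-- A hole has length zero only in the directions of its tangents, which belong to `Θ`. So within an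
open arc the list of cells does not depend on the direction at which it is read off. -/
theorem isCell_iff {h : Bool} {θ u : ℝ} (hθ : θ ∈ Θ) (hu : |u| < 1) {κ : Fin 3}
    {l : Option Bool} : s.IsCell nxt h θ κ l ↔
      IsLevel (s.lo (arc nxt h θ u)) (s.hi (arc nxt h θ u)) (s.arcMeets nxt h θ) κ l := by
  cases h
  · exact Iff.rfl
  · have key : ∀ u, |u| < 1 → s.arcMeets nxt true θ κ → κ ≠ 0 →
        s.hi (arc nxt true θ u) κ ≠ s.lo (arc nxt true θ u) κ := by
      intro u hu h1 h2
      rw [hΘ.arcMeets_eq hθ hu] at h1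
      rw [Ne, hs.hi_eq_lo_iff h2 (h1.resolve_left h2)]
      exact hΘ.lead_ne hθ κ h2 _ (hΘ.arc_mem_Ioo hθ hu)
    constructor
    · exact fun hc => ⟨hc.1, fun _ h2 => key u hu hc.1 h2⟩
    · exact fun hc => ⟨hc.1, fun _ h2 => key 0 (by simp) hc.1 h2⟩

variable (ht : s.tangent 1 ≤ s.tangent 2)

include ht

theorem isFibre_arc {h : Bool} {θ u : ℝ} (hθ : θ ∈ Θ) (hu : |u| ≤ 1) :
    IsFibre (s.lo (arc nxt h θ u)) (s.hi (arc nxt h θ u)) (s.arcMeets nxt h θ) :=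
  hs.isFibre ht (hΘ.describes hθ hu)

theorem level_pos {h : Bool} {θ u : ℝ} (hθ : θ ∈ Θ) (hu : |u| ≤ 1) {κ : Fin 3}
    (hκ : s.arcMeets nxt h θ κ) (l : Option Bool) {w : ℝ} (hw : |w| ≤ 1) :
    0 < level (s.lo (arc nxt h θ u)) (s.hi (arc nxt h θ u)) (s.arcMeets nxt h θ) κ l w :=
  (s.inner_pos 0).trans_le ((hs.isFibre_arc hΘ ht hθ hu).inFibre_level hκ l hw).1

theorem cellMap_mem {h : Bool} {θ a b : ℝ} (hθ : θ ∈ Θ) {κ : Fin 3} {l : Option Bool}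
    (hc : s.IsCell nxt h θ κ l) (ha : |a| ≤ 1) (hb : |b| ≤ 1) :
    s.cellMap nxt h θ κ l a b ∈ s.workspace := by
  -- The position within the fibre is the second coordinate of the cube over an arc, and the first
  -- one over a single direction.
  have hw : |if h then b else a| ≤ 1 := by split_ifs <;> assumption
  exact (hs.polar_mem_workspace (hΘ.describes hθ ha) (hs.level_pos hΘ ht hθ ha hc.1 l hw)).mpr
    ((hs.isFibre_arc hΘ ht hθ ha).inFibre_level hc.1 l hw)

theorem cellMap_injective {h h' : Bool} {θ θ' a b a' b' : ℝ} {κ κ' : Fin 3} {l l' : Option Bool}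
    (hθ : θ ∈ Θ) (hθ' : θ' ∈ Θ) (hc : s.IsCell nxt h θ κ l) (hc' : s.IsCell nxt h' θ' κ' l')
    (ho : InOpenCube (cellDim h l) a b) (ho' : InOpenCube (cellDim h' l') a' b')
    (heq : s.cellMap nxt h θ κ l a b = s.cellMap nxt h' θ' κ' l' a' b') :
    h = h' ∧ θ = θ' ∧ κ = κ' ∧ l = l' ∧ a = a' ∧ b = b' := by
  obtain ⟨ha, hb, ha0, hb0⟩ := ho
  obtain ⟨ha', hb', ha0', hb0'⟩ := ho'
  have hw : |if h then b else a| < 1 := by split_ifs <;> assumption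
  have hw' : |if h' then b' else a'| < 1 := by split_ifs <;> assumption
  obtain ⟨h1, h2⟩ := polar_injective (hΘ.arc_mem_Ico hθ ha) (hΘ.arc_mem_Ico hθ' ha')
    (hs.level_pos hΘ ht hθ ha.le hc.1 l hw.le) (hs.level_pos hΘ ht hθ' ha'.le hc'.1 l' hw'.le) heq
  obtain ⟨rfl, rfl, h3⟩ := hΘ.arc_injective hθ hθ' ha ha' h1
  rw [← h1] at h2
  obtain ⟨rfl, rfl, h4⟩ := (hs.isFibre_arc hΘ ht hθ ha.le).level_injective
    ((hs.isCell_iff hΘ hθ ha).mp hc)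
    (by rw [h1]; exact (hs.isCell_iff hΘ hθ ha').mp hc') hw hw' h2
  refine ⟨rfl, rfl, rfl, rfl, ?_⟩
  rcases h with _ | _ <;> rcases l with _ | _ <;> simp [cellDim] at * <;> grind

theorem exists_cell {x : Plane} (hx : x ∈ s.workspace) :
    ∃ h, ∃ θ ∈ Θ, ∃ κ l a b, s.IsCell nxt h θ κ l ∧ InOpenCube (cellDim h l) a b ∧
      s.cellMap nxt h θ κ l a b = x := by
  obtain ⟨η, hη, ρ, hρ, rfl⟩ := exists_polar (ne_foot hx 0)
  obtain ⟨h, θ, hθ, u, hu, hu0, rfl⟩ := hΘ.exists_arc hη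
  obtain ⟨κ, l, w, h1, h2, h3, h4⟩ := (hs.isFibre_arc hΘ ht hθ hu.le).exists_level
    ((hs.polar_mem_workspace (hΘ.describes hθ hu.le) hρ).mp hx)
  cases h
  · refine ⟨false, θ, hθ, κ, l, w, 0, (hs.isCell_iff hΘ hθ hu).mpr h1, ⟨h2, by simp, ?_, by simp⟩,
      ?_⟩
    · intro h
      refine h3 fun hl => ?_
      simp [cellDim, hl] at h
    · rw [← h4]
      rfl
  · refine ⟨true, θ, hθ, κ, l, u, w, (hs.isCell_iff hΘ hθ hu).mpr h1, ⟨hu, h2, ?_, ?_⟩, ?_⟩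
    · intro h
      simp [cellDim] at h
    · intro h
      refine h3 fun hl => ?_
      simp [cellDim, hl] at h
    · rw [← h4]
      rfl

/-- The boundary of a cell consists of cells of lower dimension. -/
theorem exists_boundary_cell {h : Bool} {θ a b : ℝ} (hθ : θ ∈ Θ) {κ : Fin 3} {l : Option Bool}
    (hc : s.IsCell nxt h θ κ l) (hcl : InClosedCube (cellDim h l) a b)
    (hno : ¬ InOpenCube (cellDim h l) a b) :
    ∃ h', ∃ θ' ∈ Θ, ∃ κ' l' a' b', s.IsCell nxt h' θ' κ' l' ∧ cellDim h' l' < cellDim h l ∧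
      InOpenCube (cellDim h' l') a' b' ∧
      s.cellMap nxt h' θ' κ' l' a' b' = s.cellMap nxt h θ κ l a b := by
  obtain ⟨ha, hb, ha0, hb0⟩ := hcl
  have hF := hs.isFibre_arc hΘ ht (h := h) hθ ha
  cases h
  · rcases l with _ | l
    · have ha1 : |a| = 1 := by
        by_contra hne
        refine hno ⟨lt_of_le_of_ne ha hne, ?_, ha0, hb0⟩
        rw [hb0 (by simp [cellDim])]
        simp
      obtain ⟨κ', b', h1, h2⟩ := hF.exists_end_of_abs_eq hc.1 ha1
      exact ⟨false, θ, hθ, κ', some b', 0, 0, h1, by simp [cellDim],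
        ⟨by simp, by simp, fun _ => rfl, fun _ => rfl⟩, congrArg (s.polar θ) h2⟩
    · refine absurd ⟨?_, ?_, ha0, hb0⟩ hno
      · rw [ha0 (by simp [cellDim])]; simp
      · rw [hb0 (by simp [cellDim])]; simp
  · by_cases ha1 : |a| = 1
    · obtain ⟨θ', hθ', hdir⟩ := hΘ.exists_dir_arc_eq hθ ha1
      have hF' := hs.isFibre_arc hΘ ht (h := false) hθ' ha
      have hD' := hΘ.describes (h := false) hθ' ha
      rcases l with _ | l
      -- A side of a two-dimensional cell over an end of its arc may cross cells of another kind,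
      -- since a touched hole can divide it. It suffices that its points are in the workspace, hence
      -- in some cell over the end direction.
      · have hmem := hs.cellMap_mem hΘ ht hθ hc ha hb
        have hpos := hs.level_pos hΘ ht hθ ha hc.1 none hb
        simp only [cellMap, if_true] at hmem
        rw [polar, hdir, ← polar] at hmem
        obtain ⟨κ', l', w, h1, h2, h3, h4⟩ :=
          hF'.exists_level ((hs.polar_mem_workspace hD' hpos).mp hmem)
        refine ⟨false, θ', hθ', κ', l', w, 0, h1, ?_, ⟨h2, by simp, ?_, by simp⟩, ?_⟩
        · simp only [cellDim]
          split_ifs <;> simp_all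
        · intro h
          refine h3 fun hl => ?_
          simp [cellDim, hl] at h
        · simp only [cellMap, if_true]
          rw [polar, polar, hdir]
          exact congrArg (fun ρ => s.foot 0 + ρ • dir θ') h4
      -- The hole is still met in the end direction, possibly as a touched hole whose two ends
      -- coincide.
      · have hκ : s.arcMeets nxt false θ' κ := by
          by_cases hκ0 : κ = 0
          · exact Or.inl hκ0
          · have := (hΘ.describes (h := true) hθ ha).of_mem κ hκ0 hc.1
            rw [lead_congr hdir] at this
            exact Or.inr this
        obtain ⟨b', h1, h2⟩ := IsFibre.exists_end (lo := s.lo θ') (hi := s.hi θ') hκ l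
        refine ⟨false, θ', hθ', κ, some b', 0, 0, h1, by simp [cellDim],
          ⟨by simp, by simp, fun _ => rfl, fun _ => rfl⟩, ?_⟩
        simp only [cellMap, if_true]
        rw [polar, polar, hdir, lo_congr hdir, hi_congr hdir]
        refine congrArg (fun ρ => s.foot 0 + ρ • dir θ') (h2.trans ?_)
        cases l <;> rfl
    · have hu := lt_of_le_of_ne ha ha1
      rcases l with _ | l
      · have hb1 : |b| = 1 := by
          by_contra hne
          exact hno ⟨hu, lt_of_le_of_ne hb hne, ha0, hb0⟩
        obtain ⟨κ', b', h1, h2⟩ := hF.exists_end_of_abs_eq hc.1 hb1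
        exact ⟨true, θ, hθ, κ', some b', a, 0, (hs.isCell_iff hΘ hθ hu).mpr h1, by simp [cellDim],
          ⟨hu, by simp, fun h => by simp [cellDim] at h, fun _ => rfl⟩, congrArg (s.polar _) h2⟩
      · refine absurd ⟨hu, ?_, ha0, hb0⟩ hno
        rw [hb0 (by simp [cellDim])]
        simp

/-- No leg is aligned between the ends of a component, and only leg `κ` at an end on its inner
circle. At the far end the stretched legs are aligned, and they stay the same along an arc without
corner directions. -/
theorem legDisc_cellMap {h : Bool} {θ a b : ℝ} (hθ : θ ∈ Θ) {κ : Fin 3} {l : Option Bool}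
    (hc : s.IsCell nxt h θ κ l) (ho : InOpenCube (cellDim h l) a b) (i : Fin 3) :
    s.legDisc i (s.cellMap nxt h θ κ l a b) = 0 ↔ i ∈ s.cellAligned nxt h θ κ l := by
  obtain ⟨ha, hb, -, -⟩ := ho
  have hw : |if h then b else a| < 1 := by split_ifs <;> assumption
  have hF := hs.isFibre_arc hΘ ht (h := h) hθ ha.le
  have hM := hΘ.arcMeets_eq (h := h) hθ ha
  have hκ := hc.1
  have hon := (hΘ.describes (h := h) hθ ha.le).of_mem κ
  match l with
  | none =>
    obtain ⟨h1, h2⟩ := hF.level_none_bounds hκ hw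
    rw [hM] at hκ
    simp only [cellAligned, Finset.notMem_empty, iff_false]
    exact hs.legDisc_between ht hκ h1 (h2.trans_eq (by rw [hM])) i
  | some false =>
    simp only [cellAligned, Finset.mem_singleton]
    exact hs.legDisc_of_inner (hs.dist_lo fun h0 => hon h0 hκ).2 i
  | some true =>
    by_cases h0 : κ = 0
    · subst h0
      simp only [cellAligned, if_true]
      have key : s.aligned (s.polar (arc nxt h θ a) (s.hi (arc nxt h θ a) 0)) =
          s.aligned (s.polar (arc nxt h θ 0) (s.hi (arc nxt h θ 0) 0)) := by
        cases h
        · rfl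
        · exact hs.aligned_hi_zero_eq (fun η hη => hΘ.corner_mem η (hΘ.Ioo_subset hθ hη)
            (hΘ.notMem_of_mem_Ioo hθ hη)) (hΘ.arc_mem_Ioo hθ ha) (hΘ.arc_mem_Ioo hθ (by simp))
      rw [← key, mem_aligned]
      rfl
    · simp only [cellAligned, if_neg h0, Finset.mem_singleton]
      exact hs.legDisc_of_inner (hs.dist_hi h0 (hon h0 hκ)) i

end IsThreeHoledTriangle

end Spider


/-! ### Counting the cells -/

namespace Spider

variable {s : Spider}

namespace IsThreeHoledTriangle

variable (hs : s.IsThreeHoledTriangle)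

include hs

open Classical in
/-- The contribution of the cells over an arc or a point of the circle of directions. -/
theorem sum_cells (nxt : ℝ → ℝ) (h : Bool) (θ : ℝ) :
    (∑ κ, ∑ l, if s.IsCell nxt h θ κ l then
      (-1 : ℤ) ^ cellDim h l * 2 ^ (3 - (s.cellAligned nxt h θ κ l).card) else 0) =
    (if h then -1 else 1) *
      (2 ^ (3 - (s.aligned (s.polar (arc nxt h θ 0) (s.hi (arc nxt h θ 0) 0))).card) - 4 -
        (if s.lead 1 (arc nxt h θ 0) = s.tangent 1 then 4 else 0) -
        (if s.lead 2 (arc nxt h θ 0) = s.tangent 2 then 4 else 0)) := by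
  set η := arc nxt h θ 0 with hη
  -- A hole has two ends of weight `4` and the open interval above it has weight `-8`, so all
  -- cancels, except that the ends of a touched hole coincide and count once.
  have hole : ∀ j, j ≠ 0 → (∑ l, if s.IsCell nxt h θ j l then
      (-1 : ℤ) ^ cellDim h l * 2 ^ (3 - (s.cellAligned nxt h θ j l).card) else 0) =
      (if h then -1 else 1) * -(if s.lead j η = s.tangent j then 4 else 0) := by
    intro j hj
    have h1 : s.arcMeets nxt h θ j ↔ s.tangent j ≤ s.lead j η := or_iff_right hj
    rw [Fintype.sum_option, Fintype.sum_bool]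
    simp only [IsCell, IsLevel, h1, ← hη, cellAligned, cellDim, if_neg hj]
    by_cases hon : s.tangent j ≤ s.lead j η
    · have h2 := hs.hi_eq_lo_iff hj hon
      by_cases he : s.lead j η = s.tangent j
      · have h3 := h2.mpr he
        cases h <;> simp [he, h3, hj]
      · have h3 : s.hi η j ≠ s.lo η j := mt h2.mp he
        cases h <;> simp [hon, he, h3]
    · have he : s.lead j η ≠ s.tangent j := fun he => hon he.ge
      simp [hon, he]
  -- The end on the inner circle of leg `0` has weight `4`, the open interval `-8`, and the weight
  -- of the far end depends on whether it is a corner.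
  have base : (∑ l, if s.IsCell nxt h θ 0 l then
      (-1 : ℤ) ^ cellDim h l * 2 ^ (3 - (s.cellAligned nxt h θ 0 l).card) else 0) =
      (if h then -1 else 1) *
        (2 ^ (3 - (s.aligned (s.polar η (s.hi η 0))).card) - 4) := by
    have h1 : s.arcMeets nxt h θ 0 := Or.inl rfl
    rw [Fintype.sum_option, Fintype.sum_bool]
    simp only [IsCell, IsLevel, h1, ← hη, cellAligned, cellDim]
    cases h <;> simp <;> ring
  rw [Fin.sum_univ_three, base, hole 1 (by decide), hole 2 (by decide)]
  ring

variable (ht : s.tangent 1 ≤ s.tangent 2)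

include ht

/-- The cell decomposition of the workspace into the cells over the points and the arcs of a circle
of directions, lifted to the configuration space. -/
theorem hasEulerCharacteristic_of_isSweep {s' : Spider} {e : Equiv.Perm (Fin 3)}
    (he : s = s'.permute e) {Θ : Finset ℝ} {nxt : ℝ → ℝ} (hΘ : s.IsSweep Θ nxt) {χ : ℤ}
    (hχ : ∑ θ ∈ Θ, ∑ h, (if h then (-1 : ℤ) else 1) *
      (2 ^ (3 - (s.aligned (s.polar (arc nxt h θ 0) (s.hi (arc nxt h θ 0) 0))).card) - 4 -
        (open Classical in if s.lead 1 (arc nxt h θ 0) = s.tangent 1 then 4 else 0) -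
        (open Classical in if s.lead 2 (arc nxt h θ 0) = s.tangent 2 then 4 else 0)) = χ) :
    HasEulerCharacteristic s'.configSpace χ := by
  classical
  -- Renumbering changes the configuration space but not the workspace, so the cells constructed for
  -- `s` are lifted directly to the positions of `s'`.
  have hW : s.workspace = s'.workspace := by rw [he, workspace_permute]
  have hleg : ∀ i x, s'.legDisc (e i) x = s.legDisc i x := by
    subst he
    exact fun _ _ => rfl
  set K := {k : Θ × Bool × Fin 3 × Option Bool // s.IsCell nxt k.2.1 k.1 k.2.2.1 k.2.2.2}
  have h := hasEulerCharacteristic_of_planar_cells (s := s') (K := K)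
    (fun k => cellDim k.1.2.1 k.1.2.2.2)
    (fun k => by simp only [cellDim]; split_ifs <;> simp)
    (fun k => s.cellMap nxt k.1.2.1 k.1.1 k.1.2.2.1 k.1.2.2.2)
    (fun k => continuous_cellMap _ _ _ _ _)
    (fun k a b ha hb => hW ▸ hs.cellMap_mem hΘ ht k.1.1.2 k.2 ha hb) ?_ ?_ ?_ e
    (fun k => s.cellAligned nxt k.1.2.1 k.1.1 k.1.2.2.1 k.1.2.2.2)
    (fun k a b ho i => (hleg i _).symm ▸ hs.legDisc_cellMap hΘ ht k.1.1.2 k.2 ho i)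
  · rw [← hχ, ← Finset.sum_coe_sort]
    simp only [← hs.sum_cells, ← Fintype.sum_prod_type']
    rwa [← Finset.sum_filter, Finset.sum_subtype (p := fun k : Θ × Bool × Fin 3 × Option Bool =>
      s.IsCell nxt k.2.1 k.1 k.2.2.1 k.2.2.2) _ (fun k => by simp)]
  · rintro ⟨⟨⟨θ, hθ⟩, h, κ, l⟩, hc⟩ a b ⟨⟨⟨θ', hθ'⟩, h', κ', l'⟩, hc'⟩ a' b' ho ho' heq
    obtain ⟨h1, h2, h3, h4, h5, h6⟩ := hs.cellMap_injective hΘ ht hθ hθ' hc hc' ho ho' heq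
    simp only at h1 h2 h3 h4
    subst h1 h2 h3 h4
    exact ⟨rfl, h5, h6⟩
  · intro x hx
    obtain ⟨h, θ, hθ, κ, l, a, b, hc, ho, rfl⟩ := hs.exists_cell hΘ ht (hW ▸ hx)
    exact ⟨⟨⟨⟨θ, hθ⟩, h, κ, l⟩, hc⟩, a, b, ho, rfl⟩
  · rintro ⟨⟨⟨θ, hθ⟩, h, κ, l⟩, hc⟩ a b hcl hno
    obtain ⟨h', θ', hθ', κ', l', a', b', hc', hlt, ho, heq⟩ :=
      hs.exists_boundary_cell hΘ ht hθ hc hcl hno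
    exact ⟨⟨⟨⟨θ', hθ'⟩, h', κ', l'⟩, hc'⟩, a', b', hlt, ho, heq⟩

/-- Over an open arc exactly one leg is stretched at the far end and no hole is touched, so the
contribution is `2 ^ 2 - 4 = 0`. At a single direction a corner replaces `2 ^ 2` by `2`,
contributing `-2`, and each tangency contributes `-4`. The angle `0` is in the subdivision only to
cut the circle open. The total is `3 * (-2) + 2 * (-4) + 2 * (-4)`. -/
theorem hasEulerCharacteristic_of_tangent_le {s' : Spider} {e : Equiv.Perm (Fin 3)}
    (he : s = s'.permute e) : HasEulerCharacteristic s'.configSpace (-22) := by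
  classical
  obtain ⟨C, hC3, hCmem, hC⟩ := hs.exists_corner_directions ht
  have hT : ∀ j : Fin 3, j ≠ 0 → ∃ T : Finset ℝ, T.card = 2 ∧
      ∀ θ, θ ∈ T ↔ θ ∈ Set.Ico 0 (2 * Real.pi) ∧ s.lead j θ = s.tangent j := by
    intro j hj
    have h2 := hs.ncard_tangents hj
    have hfin := Set.finite_of_ncard_ne_zero (by rw [h2]; exact two_ne_zero)
    exact ⟨hfin.toFinset, by rw [← Set.ncard_eq_toFinset_card _ hfin, h2],
      fun θ => hfin.mem_toFinset⟩
  obtain ⟨T₁, hT₁, hT₁'⟩ := hT 1 (by decide)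
  obtain ⟨T₂, hT₂, hT₂'⟩ := hT 2 (by decide)
  set Θ : Finset ℝ := insert 0 (C ∪ T₁ ∪ T₂) with hΘdef
  have hΘ0 : 0 ∈ Θ := Finset.mem_insert_self _ _
  have hCΘ : C ⊆ Θ := fun θ hθ => by simp [hΘdef, hθ]
  have hT₁Θ : T₁ ⊆ Θ := fun θ hθ => by simp [hΘdef, hθ]
  have hT₂Θ : T₂ ⊆ Θ := fun θ hθ => by simp [hΘdef, hθ]
  have hΘmem : ∀ θ ∈ Θ, θ ∈ Set.Ico 0 (2 * Real.pi) := by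
    intro θ hθ
    rw [hΘdef, Finset.mem_insert, Finset.mem_union, Finset.mem_union] at hθ
    rcases hθ with rfl | (hθ | hθ) | hθ
    · exact ⟨le_rfl, Real.two_pi_pos⟩
    · exact hCmem θ hθ
    · exact ((hT₁' θ).mp hθ).1
    · exact ((hT₂' θ).mp hθ).1
  obtain ⟨nxt, hsub⟩ := exists_isSubdivision hΘ0 hΘmem
  have hsweep : s.IsSweep Θ nxt :=
    { hsub with
      tangent_mem := fun j hj θ hθ hjθ => by
        rcases fin_three_cases j with rfl | rfl | rfl
        · exact absurd rfl hj
        · exact hT₁Θ ((hT₁' θ).mpr ⟨hθ, hjθ⟩)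
        · exact hT₂Θ ((hT₂' θ).mpr ⟨hθ, hjθ⟩)
      corner_mem := fun θ hθ hθΘ => by rw [hC θ hθ, if_neg fun h => hθΘ (hCΘ h)] }
  refine hs.hasEulerCharacteristic_of_isSweep ht he hsweep ?_
  have hsum : ∀ θ ∈ Θ, (∑ h, (if h then (-1 : ℤ) else 1) *
      (2 ^ (3 - (s.aligned (s.polar (arc nxt h θ 0) (s.hi (arc nxt h θ 0) 0))).card) - 4 -
        (if s.lead 1 (arc nxt h θ 0) = s.tangent 1 then 4 else 0) -
        (if s.lead 2 (arc nxt h θ 0) = s.tangent 2 then 4 else 0))) =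
      (if θ ∈ C then -2 else 0) + (if θ ∈ T₁ then -4 else 0) + (if θ ∈ T₂ then -4 else 0) := by
    intro θ hθ
    have hη := hsub.arc_mem_Ioo hθ (u := 0) (by simp)
    rw [Fintype.sum_bool, hsweep.corner_mem _ (hsub.Ioo_subset hθ hη) (hsub.notMem_of_mem_Ioo hθ hη),
      if_neg (hsweep.lead_ne hθ 1 (by decide) _ hη), if_neg (hsweep.lead_ne hθ 2 (by decide) _ hη),
      arc_false, hC θ (hΘmem θ hθ)]
    have h1 : s.lead 1 θ = s.tangent 1 ↔ θ ∈ T₁ := by simp [hT₁', hΘmem θ hθ]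
    have h2 : s.lead 2 θ = s.tangent 2 ↔ θ ∈ T₂ := by simp [hT₂', hΘmem θ hθ]
    simp only [h1, h2, reduceIte, Bool.false_eq_true]
    split_ifs <;> norm_num
  rw [Finset.sum_congr rfl hsum, Finset.sum_add_distrib, Finset.sum_add_distrib,
    Finset.sum_ite_mem, Finset.sum_ite_mem, Finset.sum_ite_mem, Finset.inter_eq_right.mpr hCΘ,
    Finset.inter_eq_right.mpr hT₁Θ, Finset.inter_eq_right.mpr hT₂Θ, Finset.sum_const,
    Finset.sum_const, Finset.sum_const, hC3, hT₁, hT₂]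
  norm_num

-- The order of the holes along a ray is that of the lengths of their tangents, so legs `1` and `2`
-- are exchanged if necessary.
omit ht in
theorem hasEulerCharacteristic : HasEulerCharacteristic s.configSpace (-22) := by
  rcases le_total (s.tangent 1) (s.tangent 2) with h | h
  · exact hs.hasEulerCharacteristic_of_tangent_le h (e := Equiv.refl _) rfl
  · exact (hs.permute (Equiv.swap 1 2)).hasEulerCharacteristic_of_tangent_le
      (e := Equiv.swap 1 2) h rfl

end IsThreeHoledTriangle

end Spider

end Tripod

end

theorem mainTheorem1 (s : Tripod.Spider) (hs : s.IsThreeHoledTriangle) :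
    Tripod.IsClosedSurfaceOfGenus s.configSpace 12 ∧
    Tripod.HasEulerCharacteristic s.configSpace (-22) ∧
    Tripod.IsMorseOn s.energy s.configSpace ∧
    (Tripod.minima s.energy s.configSpace).ncard = 8 ∧
    (Tripod.saddles s.energy s.configSpace).ncard = 36 ∧
    (Tripod.maxima s.energy s.configSpace).ncard = 6 := by
  exact ⟨⟨hs.isSmoothSurface, s.isCompact_configSpace, hs.isConnected_configSpace, hs.isOrientable,
    hs.hasEulerCharacteristic⟩, hs.hasEulerCharacteristic, hs.isMorseOn, hs.ncard_minima,
    hs.ncard_saddles, hs.ncard_maxima⟩
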